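/- Let $(\mathcal A,\mathcal E)$ be an exact category in the sense of Quillen. Let $\Pi=\{(i,j)\in\mathbb Z\times\mathbb Z : i\le j\}$ with the order induced from $\mathbb Z\times\mathbb Z$. A functor $X:\Pi\to\mathcal A$ is admissible if for all $i\le j\le k$ the sequence $X_{i,j}\to X_{i,k}\to X_{j,k}$ belongs to $\mathcal E$. The Beilinson category $\underleftrightarrow{\lim}\,\mathcal A$ is the localization of the category of admissible functors at all natural maps $(X_{\varphi(i),\varphi(j)})_{i\le j}\to (X_{\psi(i),\psi(j)})_{i\le j}$, where $X$ is admissible and $\varphi\le\psi$ are nondecreasing maps $\mathbb Z\to\mathbb Z$ tending to $\pm\infty$ at $\pm\infty$. A sequence $X\to Y\to Z$ in $\underleftrightarrow{\lim}\,\mathcal A$ is called admissible if it is isomorphic to the image of a sequence $X'\to Y'\to Z'$ of admissible functors such that $X'_{i,j}\to Y'_{i,j}\to Z'_{i,j}$ is in $\mathcal E$ for all $i\le j$. With these sequences $\underleftrightarrow{\lim}\,\mathcal A$ is an exact category. Let $\mathrm{Ind}^a_{\aleph_0}(\mathcal A)\subset \mathrm{Ind}(\mathcal A)$ be the full subcategory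 of the objects that are formal filtered colimits, over countable directed preorders, of systems whose structure maps are admissible monomorphisms, and let $\mathrm{Pro}^a_{\aleph_0}(\mathcal A):=\mathrm{Ind}^a_{\aleph_0}(\mathcal A^{op})^{op}$ (formal limits of countable systems of admissible epimorphisms). (Ind) For every system $X_0\hookrightarrow X_1\hookrightarrow X_2\hookrightarrow\cdots$ of admissible monomorphisms choose quotients $X_j/X_i$, $0\le i\le j$, and attach to the system the admissible functor $$X_{i,j}=X_j/X_i\ \ (0\le i\le j),\qquad X_{i,j}=X_j\ \ (i<0\le j),\qquad X_{i,j}=0\ \ (i\le j<0),$$ with the obvious structure maps. This extends to a functor $F:\mathrm{Ind}^a_{\aleph_0}(\mathcal A)\to\underleftrightarrow{\lim}\,\mathcal A$, in the sense that there is an $F$ whose composite with the formal colimit functor on such systems (and natural transformations between them) is naturally isomorphic to the functor just described. Every such $F$ is fully faithful, its essential image is closed under extensions in $\underleftrightarrow{\lim}\,\mathcal A$, and $\mathrm{Ind}^a_{\aleph_0}(\mathcal A)$, with the sequences which $F$ sends to admissible sequences, is an exact category. (Pro) Dually, for every system $\cdots\twoheadrightarrow P_2\twoheadrightarrow P_1\twoheadrightarrow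 P_0$ of admissible epimorphisms choose kernels $\ker(P_n\to P_m)$, $n\ge m\ge 0$, and attach to the system the admissible functor $$P_{i,j}=\ker(P_{-i}\to P_{-j})\ \ (i\le j\le 0),\qquad P_{i,j}=P_{-i}\ \ (i\le 0<j),\qquad P_{i,j}=0\ \ (0<i\le j).$$ This extends, in the same sense, to a functor $F:\mathrm{Pro}^a_{\aleph_0}(\mathcal A)\to\underleftrightarrow{\lim}\,\mathcal A$, and every such $F$ is fully faithful, its essential image is closed under extensions in $\underleftrightarrow{\lim}\,\mathcal A$, and $\mathrm{Pro}^a_{\aleph_0}(\mathcal A)$, with the sequences which $F$ sends to admissible sequences, is an exact category. Thus both categories are (fully) exact subcategories of $\underleftrightarrow{\lim}\,\mathcal A$. -/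

import Mathlib

open CategoryTheory CategoryTheory.Limits Opposite
open scoped ZeroObject

universe v u

noncomputable section

namespace TateExact

/-! ### Exact categories -/

section Exact

variable {C : Type u} [Category.{v} C]

/-- A class of sequences `X ⟶ Y ⟶ Z` in a category. -/
abbrev SeqClass (C : Type u) [Category.{v} C] : Type (max u v) :=
  ∀ ⦃X Y Z : C⦄, (X ⟶ Y) → (Y ⟶ Z) → Prop

/-- Admissible monomorphisms: the first maps of the sequences of the class. -/
def IsAdmMono (E : SeqClass C) {X Y : C} (f : X ⟶ Y) : Prop :=
  ∃ (Z : C) (g : Y ⟶ Z), E f g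

/-- Admissible epimorphisms: the second maps of the sequences of the class. -/
def IsAdmEpi (E : SeqClass C) {Y Z : C} (g : Y ⟶ Z) : Prop :=
  ∃ (X : C) (f : X ⟶ Y), E f g

/-- Quillen's axioms, for a class of sequences in an additive category. -/
structure IsExactStructure [Preadditive C] (E : SeqClass C) : Prop where
  comp_zero : ∀ ⦃X Y Z : C⦄ (f : X ⟶ Y) (g : Y ⟶ Z), E f g → f ≫ g = 0
  isKernel : ∀ ⦃X Y Z : C⦄ (f : X ⟶ Y) (g : Y ⟶ Z) (_ : E f g) (w : f ≫ g = 0),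
    Nonempty (IsLimit (KernelFork.ofι f w))
  isCokernel : ∀ ⦃X Y Z : C⦄ (f : X ⟶ Y) (g : Y ⟶ Z) (_ : E f g) (w : f ≫ g = 0),
    Nonempty (IsColimit (CokernelCofork.ofπ g w))
  of_iso : ∀ ⦃X Y Z X' Y' Z' : C⦄ (f : X ⟶ Y) (g : Y ⟶ Z) (f' : X' ⟶ Y') (g' : Y' ⟶ Z')
    (a : X ≅ X') (b : Y ≅ Y') (c : Z ≅ Z'),
    f ≫ b.hom = a.hom ≫ f' → g ≫ c.hom = b.hom ≫ g' → E f g → E f' g'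
  split : ∀ ⦃X Z : C⦄ (b : BinaryBicone X Z), b.IsBilimit → E b.inl b.snd
  admMono_comp : ∀ ⦃X Y Z : C⦄ (f : X ⟶ Y) (g : Y ⟶ Z),
    IsAdmMono E f → IsAdmMono E g → IsAdmMono E (f ≫ g)
  admEpi_comp : ∀ ⦃X Y Z : C⦄ (f : X ⟶ Y) (g : Y ⟶ Z),
    IsAdmEpi E f → IsAdmEpi E g → IsAdmEpi E (f ≫ g)
  pullback : ∀ ⦃Y Z W : C⦄ (g : Y ⟶ Z) (h : W ⟶ Z), IsAdmEpi E g →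
    ∃ (P : C) (h' : P ⟶ Y) (g' : P ⟶ W), IsPullback h' g' g h ∧ IsAdmEpi E g'
  pushout : ∀ ⦃X Y W : C⦄ (f : X ⟶ Y) (h : X ⟶ W), IsAdmMono E f →
    ∃ (P : C) (h' : Y ⟶ P) (f' : W ⟶ P), IsPushout f h h' f' ∧ IsAdmMono E f'
  admEpi_of_comp : ∀ ⦃X Y Z : C⦄ (h : X ⟶ Y) (f : Y ⟶ Z), HasKernel f →
    IsAdmEpi E (h ≫ f) → IsAdmEpi E f
  admMono_of_comp : ∀ ⦃X Y Z : C⦄ (f : X ⟶ Y) (h : Y ⟶ Z), HasCokernel f →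
    IsAdmMono E (f ≫ h) → IsAdmMono E f

/-- `(C, E)` is an exact category: `C` is additive and `E` satisfies Quillen's axioms. (The
preadditive structure of an additive category is unique.) -/
def IsExactCategory (E : SeqClass C) : Prop :=
  ∃ _ : Preadditive C, HasFiniteBiproducts C ∧ IsExactStructure E

/-- The sequences of a class, read in the opposite category. -/
def SeqClass.op (E : SeqClass C) : SeqClass Cᵒᵖ := fun _ _ _ f g => E g.unop f.unop

lemma IsAdmMono.unop {E : SeqClass C} {X Y : Cᵒᵖ} {f : X ⟶ Y}
    (h : IsAdmMono (SeqClass.op E) f) : IsAdmEpi E f.unop := by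
  obtain ⟨Z, g, h⟩ := h
  exact ⟨Z.unop, g.unop, h⟩

lemma IsAdmEpi.unop {E : SeqClass C} {X Y : Cᵒᵖ} {f : X ⟶ Y}
    (h : IsAdmEpi (SeqClass.op E) f) : IsAdmMono E f.unop := by
  obtain ⟨Z, g, h⟩ := h
  exact ⟨Z.unop, g.unop, h⟩

lemma IsAdmMono.op {E : SeqClass C} {X Y : C} {f : X ⟶ Y}
    (h : IsAdmMono E f) : IsAdmEpi (SeqClass.op E) f.op := by
  obtain ⟨Z, g, h⟩ := h
  exact ⟨Opposite.op Z, g.op, h⟩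

lemma IsAdmEpi.op {E : SeqClass C} {X Y : C} {f : X ⟶ Y}
    (h : IsAdmEpi E f) : IsAdmMono (SeqClass.op E) f.op := by
  obtain ⟨Z, g, h⟩ := h
  exact ⟨Opposite.op Z, g.op, h⟩

/-- The opposite of an exact category is exact. -/
theorem IsExactStructure.op [Preadditive C] {E : SeqClass C} (hE : IsExactStructure E) :
    IsExactStructure (SeqClass.op E) where
  comp_zero X Y Z f g h := by
    have := hE.comp_zero _ _ h
    exact Quiver.Hom.unop_inj (by simpa using this)
  isKernel X Y Z f g h w := by
    obtain ⟨t⟩ := hE.isCokernel _ _ h (hE.comp_zero _ _ h)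
    exact ⟨CokernelCofork.IsColimit.ofπOp f.unop (f := g.unop) (hE.comp_zero _ _ h) t⟩
  isCokernel X Y Z f g h w := by
    obtain ⟨t⟩ := hE.isKernel _ _ h (hE.comp_zero _ _ h)
    exact ⟨KernelFork.IsLimit.ofιOp g.unop (f := f.unop) (hE.comp_zero _ _ h) t⟩
  of_iso X Y Z X' Y' Z' f g f' g' a b c h₁ h₂ h := by
    refine hE.of_iso g.unop f.unop g'.unop f'.unop c.unop.symm b.unop.symm a.unop.symm ?_ ?_ h
    · have := congrArg Quiver.Hom.unop h₂
      simp only [unop_comp] at this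
      simp only [Iso.symm_hom, Iso.unop_inv]
      have e₁ : c.hom.unop ≫ c.inv.unop = 𝟙 _ := by rw [← unop_comp]; simp
      have e₂ : b.inv.unop ≫ b.hom.unop = 𝟙 _ := by rw [← unop_comp]; simp
      have e₃ : b.hom.unop ≫ b.inv.unop = 𝟙 _ := by rw [← unop_comp]; simp
      have e₄ : c.inv.unop ≫ c.hom.unop = 𝟙 _ := by rw [← unop_comp]; simp
      calc g.unop ≫ b.inv.unop = (c.inv.unop ≫ c.hom.unop) ≫ g.unop ≫ b.inv.unop := by simp [e₄]
        _ = c.inv.unop ≫ (c.hom.unop ≫ g.unop) ≫ b.inv.unop := by simp only [Category.assoc]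
        _ = c.inv.unop ≫ g'.unop ≫ (b.hom.unop ≫ b.inv.unop) := by
          rw [this]; simp only [Category.assoc]
        _ = _ := by rw [e₃, Category.comp_id]
    · have := congrArg Quiver.Hom.unop h₁
      simp only [unop_comp] at this
      simp only [Iso.symm_hom, Iso.unop_inv]
      have e₁ : a.hom.unop ≫ a.inv.unop = 𝟙 _ := by rw [← unop_comp]; simp
      have e₂ : b.inv.unop ≫ b.hom.unop = 𝟙 _ := by rw [← unop_comp]; simp
      calc f.unop ≫ a.inv.unop = (b.inv.unop ≫ b.hom.unop) ≫ f.unop ≫ a.inv.unop := by simp [e₂]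
        _ = b.inv.unop ≫ (b.hom.unop ≫ f.unop) ≫ a.inv.unop := by simp only [Category.assoc]
        _ = b.inv.unop ≫ f'.unop ≫ (a.hom.unop ≫ a.inv.unop) := by
          rw [this]; simp only [Category.assoc]
        _ = _ := by rw [e₁, Category.comp_id]
  split X Z b hb := by
    let b' : BinaryBicone Z.unop X.unop :=
      { pt := b.pt.unop
        fst := b.inr.unop
        snd := b.inl.unop
        inl := b.snd.unop
        inr := b.fst.unop
        inl_fst := by rw [← unop_comp]; simp
        inl_snd := by rw [← unop_comp]; simp
        inr_fst := by rw [← unop_comp]; simp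
        inr_snd := by rw [← unop_comp]; simp }
    have hb' : b'.IsBilimit := by
      apply isBinaryBilimitOfTotal
      have := congrArg Quiver.Hom.unop (IsBilimit.binary_total hb)
      simp only [unop_add, unop_comp, unop_id] at this
      rw [add_comm] at this
      exact this
    exact hE.split b' hb'
  admMono_comp X Y Z f g hf hg := by
    simpa using (hE.admEpi_comp _ _ hg.unop hf.unop).op
  admEpi_comp X Y Z f g hf hg := by
    simpa using (hE.admMono_comp _ _ hg.unop hf.unop).op
  pullback Y Z W g h hg := by
    obtain ⟨P, h', g', hp, ha⟩ := hE.pushout g.unop h.unop hg.unop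
    exact ⟨Opposite.op P, h'.op, g'.op, hp.op.flip, ha.op⟩
  pushout X Y W f h hf := by
    obtain ⟨P, h', f', hp, ha⟩ := hE.pullback f.unop h.unop hf.unop
    exact ⟨Opposite.op P, h'.op, f'.op, hp.op.flip, ha.op⟩
  admEpi_of_comp X Y Z h f hk hc := by
    have : HasCokernel f.unop :=
      ⟨⟨_, KernelFork.IsLimit.ofιUnop _ (kernel.condition f) (kernelIsKernel f)⟩⟩
    exact (hE.admMono_of_comp f.unop h.unop this (by simpa using hc.unop)).op
  admMono_of_comp X Y Z f h hk hc := by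
    have : HasKernel f.unop :=
      ⟨⟨_, CokernelCofork.IsColimit.ofπUnop _ (cokernel.condition f) (cokernelIsCokernel f)⟩⟩
    exact (hE.admEpi_of_comp h.unop f.unop this (by simpa using hc.unop)).op

/-- The descent of a map along the second map of an admissible sequence. -/
def IsExactStructure.desc [Preadditive C] {E : SeqClass C} (hE : IsExactStructure E)
    {X Y Z W : C} {f : X ⟶ Y} {g : Y ⟶ Z} (h : E f g) (k : Y ⟶ W) (hk : f ≫ k = 0) : Z ⟶ W :=
  (hE.isCokernel f g h (hE.comp_zero f g h)).some.desc (CokernelCofork.ofπ k hk)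

lemma IsExactStructure.fac [Preadditive C] {E : SeqClass C} (hE : IsExactStructure E)
    {X Y Z W : C} {f : X ⟶ Y} {g : Y ⟶ Z} (h : E f g) (k : Y ⟶ W) (hk : f ≫ k = 0) :
    g ≫ hE.desc h k hk = k :=
  (hE.isCokernel f g h (hE.comp_zero f g h)).some.fac (CokernelCofork.ofπ k hk)
    WalkingParallelPair.one

lemma IsExactStructure.fac_assoc [Preadditive C] {E : SeqClass C} (hE : IsExactStructure E)
    {X Y Z W V : C} {f : X ⟶ Y} {g : Y ⟶ Z} (h : E f g) (k : Y ⟶ W) (hk : f ≫ k = 0)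
    (l : W ⟶ V) : g ≫ hE.desc h k hk ≫ l = k ≫ l := by
  rw [← Category.assoc, hE.fac]

lemma IsExactStructure.epi [Preadditive C] {E : SeqClass C} (hE : IsExactStructure E)
    {X Y Z : C} {f : X ⟶ Y} {g : Y ⟶ Z} (h : E f g) : Epi g :=
  ⟨fun _ _ e => Cofork.IsColimit.hom_ext
    (hE.isCokernel f g h (hE.comp_zero f g h)).some e⟩

/-- The third isomorphism theorem. -/
lemma IsExactStructure.noether [Preadditive C] {E : SeqClass C} (hE : IsExactStructure E)
    {X Y Z P Q R : C} {f : X ⟶ Y} {g : Y ⟶ Z} {fg : X ⟶ Z} {p : Y ⟶ P} {q : Z ⟶ Q} {r : Z ⟶ R}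
    (hfg : f ≫ g = fg) (hp : E f p) (hq : E fg q) (hr : E g r) {s : P ⟶ Q} {t : Q ⟶ R}
    (hs : p ≫ s = g ≫ q) (ht : q ≫ t = r) : E s t := by
  subst hfg
  have ep := hE.epi hp
  have eq := hE.epi hq
  have er := hE.epi hr
  have z₁ := hE.comp_zero _ _ hp
  have z₂ := hE.comp_zero _ _ hr
  have hpo : IsPushout g p q s := by
    have key : ∀ c : PushoutCocone g p, (f ≫ g) ≫ c.inl = 0 := fun c => by
      rw [Category.assoc, c.condition, reassoc_of% z₁, zero_comp]
    refine ⟨⟨hs.symm⟩, ⟨PushoutCocone.IsColimit.mk _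
      (fun c => hE.desc hq c.inl (key c)) (fun c => hE.fac _ _ _) (fun c => ?_)
      (fun c m h₁ _ => ?_)⟩⟩
    · rw [← cancel_epi p, reassoc_of% hs, hE.fac, c.condition]
    · rw [← cancel_epi q, h₁, hE.fac]
  obtain ⟨P', h', f', hpo', D, c, hc⟩ := hE.pushout g p ⟨_, _, hr⟩
  have hsc : E s ((hpo'.isoIsPushout _ _ hpo).inv ≫ c) :=
    hE.of_iso _ _ _ _ (Iso.refl _) (hpo'.isoIsPushout _ _ hpo) (Iso.refl _) (by simp) (by simp) hc
  set d := (hpo'.isoIsPushout _ _ hpo).inv ≫ c with hd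
  have ed := hE.epi hsc
  have z₃ := hE.comp_zero _ _ hsc
  have h0 : s ≫ t = 0 := by
    rw [← cancel_epi p, reassoc_of% hs, ht, z₂, Limits.comp_zero]
  have h1 : g ≫ q ≫ d = 0 := by
    rw [← reassoc_of% hs, z₃, Limits.comp_zero]
  have h2 : t ≫ hE.desc hr (q ≫ d) h1 = d := by
    rw [← cancel_epi q, reassoc_of% ht, hE.fac]
  refine hE.of_iso _ _ _ _ (Iso.refl _) (Iso.refl _)
    ⟨hE.desc hsc t h0, hE.desc hr (q ≫ d) h1, ?_, ?_⟩
    (by simp) (by simp [hE.fac]) hsc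
  · rw [← cancel_epi d, hE.fac_assoc, h2, Category.comp_id]
  · rw [← cancel_epi r, hE.fac_assoc, Category.assoc, hE.fac, ht, Category.comp_id]

/-- If `X` is zero, then `X ⟶ Y ⟶ Y` is admissible. -/
lemma IsExactStructure.of_isZero_left [Preadditive C] {E : SeqClass C}
    (hE : IsExactStructure E) {X Y : C} (hX : IsZero X) (f : X ⟶ Y) : E f (𝟙 Y) := by
  let b : BinaryBicone X Y :=
    { pt := Y, fst := 0, snd := 𝟙 Y, inl := f, inr := 𝟙 Y
      inl_fst := hX.eq_of_src _ _
      inl_snd := hX.eq_of_src _ _ }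
  exact hE.split b (isBinaryBilimitOfTotal b (by simp [b]))

end Exact

/-! ### The Beilinson category -/

/-- The ordered set `Π` of pairs of integers `i ≤ j`, with the order induced from `ℤ × ℤ`. -/
abbrev Pairs : Type := { p : ℤ × ℤ // p.1 ≤ p.2 }

/-- The element `(i, j)` of `Π`. -/
abbrev pr (i j : ℤ) (h : i ≤ j) : Pairs := ⟨(i, j), h⟩

/-- The map `(i, j) ⟶ (i', j')` of `Π`. -/
abbrev prHom {i j i' j' : ℤ} {h : i ≤ j} {h' : i' ≤ j'} (hi : i ≤ i') (hj : j ≤ j') :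
    pr i j h ⟶ pr i' j' h' :=
  homOfLE (Prod.mk_le_mk.2 ⟨hi, hj⟩)

/-- Bicofinal maps `ℤ → ℤ`. -/
structure Bicofinal where
  toFun : ℤ → ℤ
  monotone : Monotone toFun
  tendsto_top : Filter.Tendsto toFun Filter.atTop Filter.atTop
  tendsto_bot : Filter.Tendsto toFun Filter.atBot Filter.atBot

/-- The endofunctor `(i, j) ↦ (φ i, φ j)` of `Π`. -/
def Bicofinal.tilde (φ : Bicofinal) : Pairs ⥤ Pairs where
  obj p := pr (φ.toFun p.1.1) (φ.toFun p.1.2) (φ.monotone p.2)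
  map {_ _} f := prHom (φ.monotone (leOfHom f).1) (φ.monotone (leOfHom f).2)

/-- For `φ ≤ ψ`, the natural map from the endofunctor of `φ` to that of `ψ`. -/
def Bicofinal.tildeMap {φ ψ : Bicofinal} (h : ∀ i, φ.toFun i ≤ ψ.toFun i) : φ.tilde ⟶ ψ.tilde where
  app p := prHom (h p.1.1) (h p.1.2)

section Beilinson

variable {A : Type u} [Category.{v} A]

/-- The admissible functors `X : Π ⥤ A`: for all `i ≤ j ≤ k` the sequence
`X (i, j) ⟶ X (i, k) ⟶ X (j, k)` is admissible. -/
def IsAdmissible (E : SeqClass A) : ObjectProperty (Pairs ⥤ A) := fun X =>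
  ∀ (i j k : ℤ) (hij : i ≤ j) (hjk : j ≤ k),
    E (X.map (prHom le_rfl hjk : pr i j hij ⟶ pr i k (hij.trans hjk)))
      (X.map (prHom hij le_rfl : pr i k (hij.trans hjk) ⟶ pr j k hjk))

/-- The category of admissible functors `Π ⥤ A`. -/
abbrev AdmFun (E : SeqClass A) := (IsAdmissible E).FullSubcategory

/-- The reindexing `X ∘ φ̃` of an admissible functor. -/
def AdmFun.reindex {E : SeqClass A} (X : AdmFun E) (φ : Bicofinal) : AdmFun E :=
  ⟨φ.tilde ⋙ X.obj, fun _ _ _ hij hjk => X.property _ _ _ (φ.monotone hij) (φ.monotone hjk)⟩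

/-- The natural map `X ∘ φ̃ ⟶ X ∘ ψ̃` for `φ ≤ ψ`. -/
def AdmFun.reindexMap {E : SeqClass A} (X : AdmFun E) {φ ψ : Bicofinal}
    (h : ∀ i, φ.toFun i ≤ ψ.toFun i) : X.reindex φ ⟶ X.reindex ψ :=
  ObjectProperty.homMk (Functor.whiskerRight (Bicofinal.tildeMap h) X.obj)

/-- The class of the natural maps `X ∘ φ̃ ⟶ X ∘ ψ̃`, for `φ ≤ ψ` bicofinal. -/
inductive reindexMaps (E : SeqClass A) : MorphismProperty (AdmFun E)
  | mk (X : AdmFun E) {φ ψ : Bicofinal} (h : ∀ i, φ.toFun i ≤ ψ.toFun i) :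
      reindexMaps E (X.reindexMap h)

/-- The Beilinson category `lim A` of `(A, E)`: the localization of the category of admissible
functors at the maps `X ∘ φ̃ ⟶ X ∘ ψ̃`. -/
abbrev Beilinson (E : SeqClass A) := (reindexMaps E).Localization

/-- The localization functor. -/
abbrev toBeilinson (E : SeqClass A) : AdmFun E ⥤ Beilinson E := (reindexMaps E).Q

/-- The admissible short exact sequences of the Beilinson category: those which are isomorphic to
a sequence of admissible functors that is admissible in every component `(i, j)`. -/
def beilinsonSeq (E : SeqClass A) : SeqClass (Beilinson E) := fun X Y Z f g =>
  ∃ (X' Y' Z' : AdmFun E) (f' : X' ⟶ Y') (g' : Y' ⟶ Z')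
    (a : X ≅ (toBeilinson E).obj X') (b : Y ≅ (toBeilinson E).obj Y')
    (c : Z ≅ (toBeilinson E).obj Z'),
    (∀ p : Pairs, E (f'.hom.app p) (g'.hom.app p)) ∧
      f ≫ b.hom = a.hom ≫ (toBeilinson E).map f' ∧ g ≫ c.hom = b.hom ≫ (toBeilinson E).map g'

/-- The essential image of a functor is closed under extensions, with respect to a class of
sequences in its target. -/
def ClosedUnderExtensions {B : Type*} [Category B] {L : Type*} [Category L]
    (E : SeqClass L) (F : B ⥤ L) : Prop :=
  ∀ ⦃X Y Z : L⦄ (f : X ⟶ Y) (g : Y ⟶ Z), E f g →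
    F.essImage X → F.essImage Z → F.essImage Y

/-- The class of sequences of the source of a functor which the functor sends into a given class;
for the embedding of a full subcategory, the induced class. -/
def SeqClass.induced {B : Type*} [Category B] {L : Type*} [Category L]
    (E : SeqClass L) (F : B ⥤ L) : SeqClass B :=
  fun _ _ _ f g => E (F.map f) (F.map g)

end Beilinson

/-! ### Strictly admissible countable ind-objects -/

section Ind

variable {A : Type u} [Category.{v} A]

/-- The strictly admissible countable ind-objects: the objects of `Ind A` which are formal colimits
of systems of admissible monomorphisms, indexed by a countable directed preorder. -/
def IsIndAdm (E : SeqClass A) : ObjectProperty (Ind A) := fun X =>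
  ∃ (I : Type v) (_ : Preorder I) (_ : IsDirectedOrder I) (_ : Nonempty I) (_ : Countable I)
    (D : I ⥤ A), (∀ ⦃i j : I⦄ (f : i ⟶ j), IsAdmMono E (D.map f)) ∧
      Nonempty (X ≅ (Ind.lim I).obj D)

/-- The category `Ind^a_ℵ₀(A)`. -/
abbrev IndAdm (E : SeqClass A) := (IsIndAdm E).FullSubcategory

/-- The category `Pro^a_ℵ₀(A)`, the opposite of `Ind^a_ℵ₀(Aᵒᵖ)`: its objects are the formal limits
of countable systems of admissible epimorphisms of `A`. -/
abbrev ProAdm (E : SeqClass A) := (IndAdm E.op)ᵒᵖ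

/-- The systems `X 0 ⟶ X 1 ⟶ X 2 ⟶ ⋯` of admissible monomorphisms. -/
abbrev IndSys (E : SeqClass A) :=
  ObjectProperty.FullSubcategory (C := ℕ ⥤ A)
    (fun S => ∀ ⦃i j : ℕ⦄ (f : i ⟶ j), IsAdmMono E (S.map f))

/-- The functor `ULift ℕ ⥤ ℕ`. -/
def natDown : ULift.{v} ℕ ⥤ ℕ where
  obj n := n.down
  map {m n} f := homOfLE (show m ≤ n from leOfHom f)

/-- The formal colimit of a system. -/
def indLim (E : SeqClass A) : IndSys E ⥤ IndAdm E :=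
  ObjectProperty.lift _
    (ObjectProperty.ι _ ⋙ (Functor.whiskeringLeft _ _ A).obj natDown ⋙ Ind.lim (ULift.{v} ℕ))
    (fun S => ⟨ULift.{v} ℕ, inferInstance, inferInstance, inferInstance, inferInstance,
      natDown ⋙ S.obj, fun _ _ _ => S.property _, ⟨Iso.refl _⟩⟩)

end Ind

/-! ### The embedding into the Beilinson category -/

section Embedding

variable {A : Type u} [Category.{v} A]

/-- A choice of quotients `T j / T i`, for all `i ≤ j`, for a functor `T` on an ordered set. -/
structure Quotients {K : Type} [Preorder K] (E : SeqClass A) (T : K ⥤ A) where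
  obj : ∀ (i j : K), i ≤ j → A
  proj : ∀ (i j : K) (h : i ≤ j), T.obj j ⟶ obj i j h
  adm : ∀ (i j : K) (h : i ≤ j), E (T.map (homOfLE h)) (proj i j h)

variable [Preadditive A]

section Quot

variable {E : SeqClass A} (hE : IsExactStructure E)

/-- The functor `(i, j) ↦ T j / T i` on `Π`. -/
def quotFunctor {T : ℤ ⥤ A} (q : Quotients E T) : Pairs ⥤ A where
  obj p := q.obj p.1.1 p.1.2 p.2
  map {p p'} f := hE.desc (q.adm p.1.1 p.1.2 p.2)
    (T.map (homOfLE (leOfHom f).2) ≫ q.proj p'.1.1 p'.1.2 p'.2) (by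
      have h := hE.comp_zero _ _ (q.adm p'.1.1 p'.1.2 p'.2)
      have e : T.map (homOfLE p.2) ≫ T.map (homOfLE (leOfHom f).2) =
          T.map (homOfLE (leOfHom f).1) ≫ T.map (homOfLE p'.2) := by
        rw [← T.map_comp, ← T.map_comp]; rfl
      rw [reassoc_of% e, h, comp_zero])
  map_id p := by
    have := hE.epi (q.adm p.1.1 p.1.2 p.2)
    rw [← cancel_epi (q.proj p.1.1 p.1.2 p.2), hE.fac]
    have e : T.map (homOfLE (leOfHom (𝟙 p)).2) = 𝟙 _ := T.map_id _
    rw [e, Category.id_comp, Category.comp_id]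
  map_comp {p p' p''} f g := by
    have := hE.epi (q.adm p.1.1 p.1.2 p.2)
    rw [← cancel_epi (q.proj p.1.1 p.1.2 p.2), hE.fac, hE.fac_assoc, Category.assoc, hE.fac,
      ← Category.assoc, ← T.map_comp]
    rfl

/-- The projection `T j ⟶ T j / T i`. -/
def quotProj {T : ℤ ⥤ A} (q : Quotients E T) (p : Pairs) :
    T.obj p.1.2 ⟶ (quotFunctor hE q).obj p :=
  q.proj p.1.1 p.1.2 p.2

lemma quotProj_epi {T : ℤ ⥤ A} (q : Quotients E T) (p : Pairs) : Epi (quotProj hE q p) :=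
  hE.epi (q.adm p.1.1 p.1.2 p.2)

lemma quotProj_map {T : ℤ ⥤ A} (q : Quotients E T) {p p' : Pairs} (f : p ⟶ p') :
    quotProj hE q p ≫ (quotFunctor hE q).map f =
      T.map (homOfLE (leOfHom f).2) ≫ quotProj hE q p' :=
  hE.fac (q.adm p.1.1 p.1.2 p.2) _ _

lemma quotFunctor_admissible {T : ℤ ⥤ A} (q : Quotients E T) :
    IsAdmissible E (quotFunctor hE q) := by
  intro i j k hij hjk
  have e : T.map (homOfLE (le_refl k)) = 𝟙 _ := T.map_id _
  refine hE.noether (f := T.map (homOfLE hij)) (g := T.map (homOfLE hjk))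
    (fg := T.map (homOfLE (hij.trans hjk))) (p := quotProj hE q (pr i j hij))
    (q := quotProj hE q (pr i k (hij.trans hjk))) (r := quotProj hE q (pr j k hjk))
    ?_ (q.adm i j hij) (q.adm i k _) (q.adm j k hjk) (quotProj_map hE q _) ?_
  · rw [← T.map_comp]; rfl
  · refine (quotProj_map hE q _).trans ?_
    exact (congrArg (· ≫ quotProj hE q (pr j k hjk)) e).trans (Category.id_comp _)

/-- The map of quotients induced by a natural transformation. -/
def quotMapApp {T T' : ℤ ⥤ A} (q : Quotients E T) (q' : Quotients E T') (f : T ⟶ T') (p : Pairs) :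
    (quotFunctor hE q).obj p ⟶ (quotFunctor hE q').obj p :=
  hE.desc (q.adm p.1.1 p.1.2 p.2) (f.app p.1.2 ≫ quotProj hE q' p) (by
    have h := hE.comp_zero _ _ (q'.adm p.1.1 p.1.2 p.2)
    have e : T.map (homOfLE p.2) ≫ f.app p.1.2 = f.app p.1.1 ≫ T'.map (homOfLE p.2) :=
      f.naturality _
    rw [← Category.assoc, e, Category.assoc]
    exact (congrArg (f.app p.1.1 ≫ ·) h).trans comp_zero)

lemma quotProj_mapApp {T T' : ℤ ⥤ A} (q : Quotients E T) (q' : Quotients E T') (f : T ⟶ T')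
    (p : Pairs) :
    quotProj hE q p ≫ quotMapApp hE q q' f p = f.app p.1.2 ≫ quotProj hE q' p :=
  hE.fac (q.adm p.1.1 p.1.2 p.2) _ _

/-- The natural transformation of the functors of quotients induced by a natural
transformation. -/
def quotMap {T T' : ℤ ⥤ A} (q : Quotients E T) (q' : Quotients E T') (f : T ⟶ T') :
    quotFunctor hE q ⟶ quotFunctor hE q' where
  app p := quotMapApp hE q q' f p
  naturality p p' g := by
    have := quotProj_epi hE q p
    have h₁ := quotProj_map hE q g
    have h₂ := quotProj_map hE q' g
    have h₃ := quotProj_mapApp hE q q' f p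
    have h₄ := quotProj_mapApp hE q q' f p'
    rw [← cancel_epi (quotProj hE q p), reassoc_of% h₁, h₄, reassoc_of% h₃, h₂,
      f.naturality_assoc]

lemma quotMap_id {T : ℤ ⥤ A} (q : Quotients E T) : quotMap hE q q (𝟙 T) = 𝟙 _ := by
  ext p
  have := quotProj_epi hE q p
  rw [← cancel_epi (quotProj hE q p)]
  exact (quotProj_mapApp hE q q _ p).trans
    ((Category.id_comp _).trans (Category.comp_id _).symm)

lemma quotMap_comp {T T' T'' : ℤ ⥤ A} (q : Quotients E T) (q' : Quotients E T')
    (q'' : Quotients E T'') (f : T ⟶ T') (g : T' ⟶ T'') :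
    quotMap hE q q'' (f ≫ g) = quotMap hE q q' f ≫ quotMap hE q' q'' g := by
  ext p
  have := quotProj_epi hE q p
  have h₁ := quotProj_mapApp hE q q' f p
  have h₂ := quotProj_mapApp hE q' q'' g p
  have h₃ := quotProj_mapApp hE q q'' (f ≫ g) p
  rw [← cancel_epi (quotProj hE q p), NatTrans.comp_app]
  refine h₃.trans ?_
  change _ = quotProj hE q p ≫ quotMapApp hE q q' f p ≫ quotMapApp hE q' q'' g p
  rw [reassoc_of% h₁, h₂, NatTrans.comp_app, Category.assoc]

end Quot

variable [HasZeroObject A]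

/-- The extension of a system `S : ℕ ⥤ A` to `ℤ` by zero in negative degrees. -/
def extendZero (S : ℕ ⥤ A) : ℤ ⥤ A where
  obj
    | Int.ofNat n => S.obj n
    | Int.negSucc _ => 0
  map {i j} f := match i, j, f with
    | Int.ofNat _, Int.ofNat _, f => S.map (homOfLE (Int.ofNat_le.1 (leOfHom f)))
    | Int.negSucc _, _, _ => 0
    | Int.ofNat _, Int.negSucc _, _ => 0
  map_id i := match i with
    | Int.ofNat n => S.map_id n
    | Int.negSucc _ => (isZero_zero A).eq_of_src _ _
  map_comp {i j k} f g := match i, j, k, f, g with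
    | Int.ofNat _, Int.ofNat _, Int.ofNat _, _, _ => S.map_comp _ _
    | Int.negSucc _, _, _, _, _ => (isZero_zero A).eq_of_src _ _
    | Int.ofNat _, Int.negSucc _, _, f, _ =>
      absurd (leOfHom f) (by have := Int.negSucc_lt_zero; grind)
    | Int.ofNat _, Int.ofNat _, Int.negSucc _, _, g =>
      absurd (leOfHom g) (by have := Int.negSucc_lt_zero; grind)

/-- The extension by zero of a natural transformation. -/
def extendZeroMap {S S' : ℕ ⥤ A} (f : S ⟶ S') : extendZero S ⟶ extendZero S' where
  app
    | Int.ofNat n => f.app n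
    | Int.negSucc _ => 0
  naturality i j g := match i, j, g with
    | Int.ofNat _, Int.ofNat _, _ => f.naturality _
    | Int.negSucc _, _, _ => (isZero_zero A).eq_of_src _ _
    | Int.ofNat _, Int.negSucc _, g =>
      absurd (leOfHom g) (by have := Int.negSucc_lt_zero; grind)

lemma extendZeroMap_id (S : ℕ ⥤ A) : extendZeroMap (𝟙 S) = 𝟙 _ := by
  ext i
  match i with
  | Int.ofNat _ => rfl
  | Int.negSucc _ => exact (isZero_zero A).eq_of_src _ _

lemma extendZeroMap_comp {S S' S'' : ℕ ⥤ A} (f : S ⟶ S') (g : S' ⟶ S'') :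
    extendZeroMap (f ≫ g) = extendZeroMap f ≫ extendZeroMap g := by
  ext i
  match i with
  | Int.ofNat _ => rfl
  | Int.negSucc _ => exact (isZero_zero A).eq_of_src _ _

variable {E : SeqClass A} (hE : IsExactStructure E)

/-- The extension of a choice of quotients `S j / S i`, `0 ≤ i ≤ j`, to all integers `i ≤ j`: for
`i < 0` the quotient is `S j` itself if `0 ≤ j`, and `0` if `j < 0`. -/
def extendQuotients {S : ℕ ⥤ A} (q : Quotients E S) : Quotients E (extendZero S) where
  obj i j h := match i, j, h with
    | Int.ofNat i, Int.ofNat j, h => q.obj i j (Int.ofNat_le.1 h)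
    | Int.negSucc _, j, _ => (extendZero S).obj j
    | Int.ofNat _, Int.negSucc _, _ => 0
  proj i j h := match i, j, h with
    | Int.ofNat i, Int.ofNat j, h => q.proj i j (Int.ofNat_le.1 h)
    | Int.negSucc _, j, _ => 𝟙 ((extendZero S).obj j)
    | Int.ofNat _, Int.negSucc _, _ => 0
  adm i j h := match i, j, h with
    | Int.ofNat i, Int.ofNat j, h => q.adm i j (Int.ofNat_le.1 h)
    | Int.negSucc _, _, _ => hE.of_isZero_left (isZero_zero A) _
    | Int.ofNat _, Int.negSucc _, h => absurd h (by have := Int.negSucc_lt_zero; grind)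

/-- The functor from systems of admissible monomorphisms to admissible functors on `Π`, for chosen
quotients `S j / S i`: on objects,
`X (i, j) = S j / S i` for `0 ≤ i ≤ j`, `X (i, j) = S j` for `i < 0 ≤ j`, and
`X (i, j) = 0` for `i ≤ j < 0`. -/
def indSysToAdmFun (q : ∀ S : IndSys E, Quotients E S.obj) : IndSys E ⥤ AdmFun E where
  obj S := ⟨quotFunctor hE (extendQuotients hE (q S)), quotFunctor_admissible hE _⟩
  map f := ObjectProperty.homMk (quotMap hE _ _ (extendZeroMap f.hom))
  map_id S := by
    ext1
    exact (congrArg _ (extendZeroMap_id _)).trans (quotMap_id hE _)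
  map_comp f g := by
    ext1
    exact (congrArg _ (extendZeroMap_comp _ _)).trans (quotMap_comp hE _ _ _ _ _)

/-- The object of the Beilinson category attached to a system of admissible monomorphisms. -/
def indSysToBeilinson (q : ∀ S : IndSys E, Quotients E S.obj) : IndSys E ⥤ Beilinson E :=
  indSysToAdmFun hE q ⋙ toBeilinson E

/-- The order reversing involution `(i, j) ↦ (-j, -i)` of `Π`. -/
def pairsNeg : Pairs ⥤ Pairsᵒᵖ where
  obj p := op (pr (-p.1.2) (-p.1.1) (neg_le_neg p.2))
  map {_ _} f := (prHom (neg_le_neg (leOfHom f).2) (neg_le_neg (leOfHom f).1)).op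

/-- The duality which sends an admissible functor `X` on `Π` with values in `Aᵒᵖ` to the
admissible functor `(i, j) ↦ X (-j, -i)` with values in `A`. -/
def dualize (E : SeqClass A) : (AdmFun E.op)ᵒᵖ ⥤ AdmFun E where
  obj X := ⟨pairsNeg ⋙ X.unop.obj.leftOp,
    fun i j k hij hjk => X.unop.property (-k) (-j) (-i) (neg_le_neg hjk) (neg_le_neg hij)⟩
  map f := ObjectProperty.homMk (Functor.whiskerLeft pairsNeg (NatTrans.leftOp f.unop.hom))

/-- The object of the Beilinson category attached to a system of admissible epimorphisms
`⋯ ⟶ P 2 ⟶ P 1 ⟶ P 0` of `A`, i.e. a system of admissible monomorphisms of `Aᵒᵖ`, for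
chosen kernels of the maps `P j ⟶ P i`, i.e. chosen quotients in `Aᵒᵖ`: it is the functor with
`X (i, j) = ker (P (-i) ⟶ P (-j))` for `i ≤ j ≤ 0`, `X (i, j) = P (-i)` for `i ≤ 0 < j`, and
`X (i, j) = 0` for `0 < i ≤ j`. -/
def proSysToBeilinson (q : ∀ S : IndSys E.op, Quotients E.op S.obj) :
    (IndSys E.op)ᵒᵖ ⥤ Beilinson E :=
  (indSysToAdmFun hE.op q).op ⋙ dualize E ⋙ toBeilinson E

end Embedding

end TateExact

end

/-!
The Beilinson category inverts the maps `X ⟶ X ∘ φ` for nondecreasing `φ : ℤ → ℤ` with `φ ≥ id` that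
tend to `±∞`. Composites of such reindexings are again of this kind, and reindexings act on
admissible functors by exact endofunctors, so the localization has a calculus of fractions on both
sides whose fractions only change indices. As reindexing preserves objectwise admissible sequences,
such sequences and their pushouts and pullbacks stay such in the localization, and Quillen's axioms
follow.

For the ind-systems, an admissible functor `X` which vanishes in low degrees is determined by the
row `T = X(p, ·)` for `p` small enough: it is the functor `(i, j) ↦ T j / T i`. Hence, up to
reindexing, the image of the systems consists of the functors that vanish in low degrees, and this
condition is stable under extensions. Maps of such functors are determined by, and can be prescribed
on, the row `T`, so morphisms of formal colimits, which are maps of systems up to reindexing, are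
the morphisms of the Beilinson category.

The pro-systems follow by duality, as `(i, j) ↦ (-j, -i)` identifies the admissible functors of `A`
with the opposite of those of `Aᵒᵖ`.
-/

noncomputable section

namespace TateExact

/-! ### Exact categories: the redundant axioms and diagram lemmas -/

section KernelSquares

variable {C : Type*} [Category* C] [HasZeroMorphisms C]

def isLimitKernelForkOfIsPullback {X Y Z W P : C} {f : X ⟶ Y} {g : Y ⟶ Z} {w : f ≫ g = 0}
    (hf : IsLimit (KernelFork.ofι f w)) {h' : P ⟶ Y} {g' : P ⟶ W} {t : W ⟶ Z}
    (sq : IsPullback h' g' g t) :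
    IsLimit (KernelFork.ofι (f := g') (sq.lift f 0 (by rw [w, zero_comp])) (by simp)) :=
  have : Mono f := mono_of_isLimit_fork hf
  have : Mono (sq.lift f 0 (by rw [w, zero_comp])) :=
    mono_of_mono_fac (sq.lift_fst f 0 (by rw [w, zero_comp]))
  KernelFork.IsLimit.ofι' _ _ fun k hk =>
    let l := KernelFork.IsLimit.lift' hf (k ≫ h') (by
      rw [Category.assoc, sq.w, reassoc_of% hk, zero_comp])
    ⟨l.1, sq.hom_ext (by simpa using l.2) (by simpa using hk.symm)⟩

def isLimitKernelForkCompOfIsPullback {Y Z W V P : C} {z : W ⟶ Z} {z' : Z ⟶ V} {w : z ≫ z' = 0}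
    (hz : IsLimit (KernelFork.ofι z w)) {p : P ⟶ Y} {p' : P ⟶ W} {b : Y ⟶ Z}
    (sq : IsPullback p p' b z) :
    IsLimit (KernelFork.ofι (f := b ≫ z') p (by rw [sq.w_assoc, w, comp_zero])) :=
  have : Mono z := mono_of_isLimit_fork hz
  have : Mono p := ⟨fun u v e => sq.hom_ext e (by
    rw [← cancel_mono z, Category.assoc, Category.assoc, ← sq.w, reassoc_of% e])⟩
  KernelFork.IsLimit.ofι' _ _ fun k hk =>
    let l := KernelFork.IsLimit.lift' hz (k ≫ b) (by simpa using hk)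
    ⟨sq.lift k l.1 l.2.symm, sq.lift_fst _ _ _⟩

variable [HasBinaryBiproducts C]

lemma isPushout_biprodMap_id {X Z : C} (Y : C) (f : X ⟶ Z) :
    IsPushout f (biprod.inr : X ⟶ Y ⊞ X) (biprod.inr : Z ⟶ Y ⊞ Z) (biprod.map (𝟙 Y) f) := by
  refine ⟨⟨by simp⟩, ⟨PushoutCocone.IsColimit.mk _
    (fun s => biprod.desc (biprod.inl ≫ s.inr) s.inl) (fun s => by simp) (fun s => ?_)
    (fun s m h₁ h₂ => ?_)⟩⟩
  · ext
    · simp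
    · simpa using s.condition
  · ext
    · simp [← h₂]
    · simpa using h₁

lemma isPullback_biprodMap_id {Y Q : C} (q : Y ⟶ Q) (Z : C) :
    IsPullback (biprod.inl : Y ⟶ Y ⊞ Z) q (biprod.map q (𝟙 Z)) biprod.inl := by
  refine ⟨⟨by simp⟩, ⟨PullbackCone.IsLimit.mk _
    (fun s => s.fst ≫ biprod.fst) (fun s => ?_) (fun s => ?_) (fun s m h₁ _ => ?_)⟩⟩
  · ext
    · simp
    · simpa using (s.condition =≫ biprod.snd).symm
  · simpa using s.condition =≫ biprod.fst
  · simp [← h₁]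

end KernelSquares

section Exact

variable {C : Type u} [Category.{v} C] [Preadditive C]

/-- Quillen's axioms without the two obscure axioms `admEpi_of_comp` and `admMono_of_comp`, which
Keller showed to follow from the others, see `IsKellerExact.isExactStructure`. -/
structure IsKellerExact (E : SeqClass C) : Prop where
  comp_zero : ∀ ⦃X Y Z : C⦄ (f : X ⟶ Y) (g : Y ⟶ Z), E f g → f ≫ g = 0
  isKernel : ∀ ⦃X Y Z : C⦄ (f : X ⟶ Y) (g : Y ⟶ Z) (_ : E f g) (w : f ≫ g = 0),
    Nonempty (IsLimit (KernelFork.ofι f w))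
  isCokernel : ∀ ⦃X Y Z : C⦄ (f : X ⟶ Y) (g : Y ⟶ Z) (_ : E f g) (w : f ≫ g = 0),
    Nonempty (IsColimit (CokernelCofork.ofπ g w))
  of_iso : ∀ ⦃X Y Z X' Y' Z' : C⦄ (f : X ⟶ Y) (g : Y ⟶ Z) (f' : X' ⟶ Y') (g' : Y' ⟶ Z')
    (a : X ≅ X') (b : Y ≅ Y') (c : Z ≅ Z'),
    f ≫ b.hom = a.hom ≫ f' → g ≫ c.hom = b.hom ≫ g' → E f g → E f' g'
  split : ∀ ⦃X Z : C⦄ (b : BinaryBicone X Z), b.IsBilimit → E b.inl b.snd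
  admMono_comp : ∀ ⦃X Y Z : C⦄ (f : X ⟶ Y) (g : Y ⟶ Z),
    IsAdmMono E f → IsAdmMono E g → IsAdmMono E (f ≫ g)
  admEpi_comp : ∀ ⦃X Y Z : C⦄ (f : X ⟶ Y) (g : Y ⟶ Z),
    IsAdmEpi E f → IsAdmEpi E g → IsAdmEpi E (f ≫ g)
  pullback : ∀ ⦃Y Z W : C⦄ (g : Y ⟶ Z) (h : W ⟶ Z), IsAdmEpi E g →
    ∃ (P : C) (h' : P ⟶ Y) (g' : P ⟶ W), IsPullback h' g' g h ∧ IsAdmEpi E g'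
  pushout : ∀ ⦃X Y W : C⦄ (f : X ⟶ Y) (h : X ⟶ W), IsAdmMono E f →
    ∃ (P : C) (h' : Y ⟶ P) (f' : W ⟶ P), IsPushout f h h' f' ∧ IsAdmMono E f'

variable {E : SeqClass C}

lemma IsExactStructure.isKellerExact (hE : IsExactStructure E) : IsKellerExact E where
  comp_zero := hE.comp_zero
  isKernel := hE.isKernel
  isCokernel := hE.isCokernel
  of_iso := hE.of_iso
  split := hE.split
  admMono_comp := hE.admMono_comp
  admEpi_comp := hE.admEpi_comp
  pullback := hE.pullback
  pushout := hE.pushout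

namespace IsKellerExact

variable (hE : IsKellerExact E)

include hE

theorem op : IsKellerExact E.op where
  comp_zero _ _ _ f g h := Quiver.Hom.unop_inj (hE.comp_zero g.unop f.unop h)
  isKernel _ _ _ f g h _ :=
    ⟨CokernelCofork.IsColimit.ofπOp f.unop (hE.comp_zero g.unop f.unop h)
      (hE.isCokernel _ _ h _).some⟩
  isCokernel _ _ _ f g h _ :=
    ⟨KernelFork.IsLimit.ofιOp g.unop (hE.comp_zero g.unop f.unop h) (hE.isKernel _ _ h _).some⟩
  of_iso _ _ _ _ _ _ f g f' g' a b c h₁ h₂ :=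
    hE.of_iso g.unop f.unop g'.unop f'.unop c.unop.symm b.unop.symm a.unop.symm
      (Quiver.Hom.op_inj (show b.inv ≫ g = g' ≫ c.inv by
        rw [Iso.inv_comp_eq, ← reassoc_of% h₂, c.hom_inv_id, Category.comp_id]))
      (Quiver.Hom.op_inj (show a.inv ≫ f = f' ≫ b.inv by
        rw [Iso.inv_comp_eq, ← reassoc_of% h₁, b.hom_inv_id, Category.comp_id]))
  split X Z b hb := by
    let b' : BinaryBicone Z.unop X.unop :=
      { pt := b.pt.unop, fst := b.inr.unop, snd := b.inl.unop, inl := b.snd.unop, inr := b.fst.unop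
        inl_fst := Quiver.Hom.op_inj b.inr_snd
        inl_snd := Quiver.Hom.op_inj b.inl_snd
        inr_fst := Quiver.Hom.op_inj b.inr_fst
        inr_snd := Quiver.Hom.op_inj b.inl_fst }
    exact hE.split b' (isBinaryBilimitOfTotal b' (Quiver.Hom.op_inj
      ((add_comm _ _).trans (IsBilimit.binary_total hb))))
  admMono_comp _ _ _ _ _ hf hg := (hE.admEpi_comp _ _ hg.unop hf.unop).op
  admEpi_comp _ _ _ _ _ hf hg := (hE.admMono_comp _ _ hg.unop hf.unop).op
  pullback _ _ _ g h hg :=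
    let ⟨_, _, _, sq, hg'⟩ := hE.pushout g.unop h.unop hg.unop
    ⟨_, _, _, sq.op.flip, hg'.op⟩
  pushout _ _ _ f h hf :=
    let ⟨_, _, _, sq, hf'⟩ := hE.pullback f.unop h.unop hf.unop
    ⟨_, _, _, sq.op.flip, hf'.op⟩

lemma mono {X Y Z : C} {f : X ⟶ Y} {g : Y ⟶ Z} (h : E f g) : Mono f :=
  mono_of_isLimit_fork (hE.isKernel f g h (hE.comp_zero f g h)).some

lemma epi {X Y Z : C} {f : X ⟶ Y} {g : Y ⟶ Z} (h : E f g) : Epi g :=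
  epi_of_isColimit_cofork (hE.isCokernel f g h (hE.comp_zero f g h)).some

lemma exists_lift {X Y Z W : C} {f : X ⟶ Y} {g : Y ⟶ Z} (h : E f g) (k : W ⟶ Y)
    (hk : k ≫ g = 0) : ∃ l : W ⟶ X, l ≫ f = k :=
  let l := KernelFork.IsLimit.lift' (hE.isKernel f g h (hE.comp_zero f g h)).some k hk
  ⟨l.1, l.2⟩

lemma exists_desc {X Y Z W : C} {f : X ⟶ Y} {g : Y ⟶ Z} (h : E f g) (k : Y ⟶ W)
    (hk : f ≫ k = 0) : ∃ l : Z ⟶ W, g ≫ l = k :=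
  let l := CokernelCofork.IsColimit.desc' (hE.isCokernel f g h (hE.comp_zero f g h)).some k hk
  ⟨l.1, l.2⟩

lemma isIso_of_isZero_left {X Y Z : C} {f : X ⟶ Y} {g : Y ⟶ Z} (h : E f g) (hX : IsZero X) :
    IsIso g := by
  obtain ⟨r, hr⟩ := hE.exists_desc h (𝟙 Y) (hX.eq_of_src _ _)
  have := hE.epi h
  have : IsSplitMono g := ⟨⟨r, hr⟩⟩
  exact isIso_of_epi_of_isSplitMono g

lemma of_iso_mid {X Y Z Y' : C} {f : X ⟶ Y} {g : Y ⟶ Z} {f' : X ⟶ Y'} {g' : Y' ⟶ Z}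
    (b : Y ≅ Y') (hf : f ≫ b.hom = f') (hg : g = b.hom ≫ g') (h : E f g) : E f' g' :=
  hE.of_iso f g f' g' (Iso.refl _) b (Iso.refl _) (by simpa using hf) (by simpa using hg) h

lemma of_isLimit {X Y Z : C} {f : X ⟶ Y} {g : Y ⟶ Z} (hg : IsAdmEpi E g) {w : f ≫ g = 0}
    (hf : IsLimit (KernelFork.ofι f w)) : E f g := by
  obtain ⟨K, k, hk⟩ := hg
  obtain ⟨hk'⟩ := hE.isKernel k g hk (hE.comp_zero _ _ hk)
  exact hE.of_iso k g f g (hk'.conePointUniqueUpToIso hf) (Iso.refl _) (Iso.refl _)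
    (by simpa using (hk'.conePointUniqueUpToIso_hom_comp hf WalkingParallelPair.zero).symm)
    (by simp) hk

lemma of_isColimit {X Y Z : C} {f : X ⟶ Y} {g : Y ⟶ Z} (hf : IsAdmMono E f) {w : f ≫ g = 0}
    (hg : IsColimit (CokernelCofork.ofπ g w)) : E f g := by
  obtain ⟨Q, q, hq⟩ := hf
  obtain ⟨hq'⟩ := hE.isCokernel f q hq (hE.comp_zero _ _ hq)
  exact hE.of_iso f q f g (Iso.refl _) (Iso.refl _) (hq'.coconePointUniqueUpToIso hg) (by simp)
    (by simpa using hq'.comp_coconePointUniqueUpToIso_hom hg WalkingParallelPair.one) hq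

lemma exists_seq_of_isPullback {X Y Z P W : C} {f : X ⟶ Y} {g : Y ⟶ Z} (h : E f g)
    {h' : P ⟶ Y} {g' : P ⟶ W} {t : W ⟶ Z} (sq : IsPullback h' g' g t) :
    ∃ k : X ⟶ P, k ≫ h' = f ∧ E k g' := by
  obtain ⟨P₀, h₀, g₀, sq₀, K, k, hk⟩ := hE.pullback g t ⟨_, _, h⟩
  have hg' : IsAdmEpi E g' := ⟨K, k ≫ (sq₀.isoIsPullback _ _ sq).hom,
    hE.of_iso_mid (sq₀.isoIsPullback _ _ sq) rfl (by simp) hk⟩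
  exact ⟨_, sq.lift_fst _ _ _, hE.of_isLimit hg'
    (isLimitKernelForkOfIsPullback (hE.isKernel f g h (hE.comp_zero f g h)).some sq)⟩

lemma exists_seq_of_isPushout {X Y Z P W : C} {f : X ⟶ Y} {g : Y ⟶ Z} (h : E f g)
    {h' : Y ⟶ P} {f' : W ⟶ P} {t : X ⟶ W} (sq : IsPushout f t h' f') :
    ∃ k : P ⟶ Z, h' ≫ k = g ∧ E f' k :=
  let ⟨k, hk, hk'⟩ := hE.op.exists_seq_of_isPullback (f := g.op) (g := f.op) h sq.op.flip
  ⟨k.unop, Quiver.Hom.op_inj hk, hk'⟩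

lemma isIso_of_short_five {X Y Z Y' : C} {i : X ⟶ Y} {p : Y ⟶ Z} {i' : X ⟶ Y'} {p' : Y' ⟶ Z}
    (h : E i p) (h' : E i' p') (f : Y ⟶ Y') (hi : i ≫ f = i') (hp : f ≫ p' = p) : IsIso f := by
  obtain ⟨D, d₁, d₂, sq, -⟩ := hE.pullback p p' ⟨_, _, h⟩
  obtain ⟨k, hk₁, hk⟩ := hE.exists_seq_of_isPullback h sq
  obtain ⟨k', hk'₂, hk'⟩ := hE.exists_seq_of_isPullback h' sq.flip
  have hk₂ : k ≫ d₂ = 0 := hE.comp_zero _ _ hk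
  have := hE.mono hk'
  have := hE.mono h'
  have := hE.epi hk
  -- The graph of `f` is a section of `d₁`, so it splits off the kernel of `d₁` through `e`, and
  -- the inverse of `f` sends `y'` to `y + i (e (y, y'))` for any `(y, y')` in the pullback `D`.
  let graph := sq.lift (𝟙 Y) f (by simp [hp])
  have graph_fst : graph ≫ d₁ = 𝟙 Y := sq.lift_fst _ _ _
  have graph_snd : graph ≫ d₂ = f := sq.lift_snd _ _ _
  obtain ⟨e, he⟩ := hE.exists_lift hk' (𝟙 D - d₁ ≫ graph) (by simp [graph_fst])
  have hke : k ≫ e = -𝟙 X := by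
    rw [← cancel_mono i', Category.assoc, ← hk'₂, reassoc_of% he, hk'₂]
    simp [hk₂, reassoc_of% hk₁, graph_snd, hi]
  have graph_e : graph ≫ e = 0 := by
    rw [← cancel_mono k', Category.assoc, he]
    simp [reassoc_of% graph_fst]
  obtain ⟨g, hg⟩ := hE.exists_desc hk (d₁ + e ≫ i) (by simp [hk₁, reassoc_of% hke])
  refine ⟨g, ?_, ?_⟩
  · rw [← graph_snd, Category.assoc, hg]
    simp [graph_fst, reassoc_of% graph_e]
  · rw [← cancel_epi d₂, reassoc_of% hg, Preadditive.add_comp, Category.assoc, hi, ← hk'₂,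
      reassoc_of% he]
    simp [graph_snd]

lemma isPushout_of_comp_eq {X X' Y Y' Z : C} {i : X ⟶ Y} {p : Y ⟶ Z} {i' : X' ⟶ Y'} {p' : Y' ⟶ Z}
    (h : E i p) (h' : E i' p') {x : X ⟶ X'} {y : Y ⟶ Y'} (hi : i ≫ y = x ≫ i')
    (hp : y ≫ p' = p) : IsPushout i x y i' := by
  obtain ⟨P, y₀, i₀, sq, -⟩ := hE.pushout i x ⟨_, _, h⟩
  obtain ⟨c, hc, hc'⟩ := hE.exists_seq_of_isPushout h sq
  have := hE.isIso_of_short_five hc' h' (sq.desc y i' hi) (by simp)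
    (sq.hom_ext (by simp [hp, hc]) (by simp [hE.comp_zero _ _ hc', hE.comp_zero _ _ h']))
  exact sq.of_iso (Iso.refl _) (Iso.refl _) (Iso.refl _) (asIso (sq.desc y i' hi))
    (by simp) (by simp) (by simp) (by simp)

section Biproducts

variable [HasBinaryBiproducts C]

lemma isAdmMono_biprodLift_id {X Y : C} (f : X ⟶ Y) : IsAdmMono E (biprod.lift f (𝟙 X)) := by
  let b : BinaryBicone X Y :=
    { pt := Y ⊞ X, inl := biprod.lift f (𝟙 X), inr := biprod.inl
      fst := biprod.snd, snd := biprod.desc (𝟙 Y) (-f) }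
  exact ⟨_, _, hE.split b (isBinaryBilimitOfTotal b (by ext <;> simp [b]))⟩

lemma isAdmMono_biprodMap_id {X Z : C} (Y : C) {f : X ⟶ Z} (hf : IsAdmMono E f) :
    IsAdmMono E (biprod.map (𝟙 Y) f) := by
  obtain ⟨Q, q, hq⟩ := hf
  obtain ⟨k, -, hk⟩ := hE.exists_seq_of_isPushout hq (isPushout_biprodMap_id Y f)
  exact ⟨_, _, hk⟩

lemma isAdmMono_biprodLift_zero {X Y Z : C} {f : X ⟶ Y} {h : Y ⟶ Z}
    (hfh : IsAdmMono E (f ≫ h)) : IsAdmMono E (biprod.lift f (0 : X ⟶ Z)) := by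
  obtain ⟨Q, q, hq⟩ := hE.admMono_comp _ _ (hE.isAdmMono_biprodLift_id f)
    (hE.isAdmMono_biprodMap_id Y hfh)
  -- The shear `(y, z) ↦ (y, z - h y)` turns `(f, f ≫ h)` into `(f, 0)`.
  let shear : Y ⊞ Z ≅ Y ⊞ Z := Biprod.unipotentUpper (-h)
  exact ⟨Q, shear.inv ≫ q, hE.of_iso_mid shear
    (by ext <;> simp [shear, Biprod.ofComponents]) (by simp) hq⟩

lemma admMono_of_comp {X Y Z : C} (f : X ⟶ Y) (h : Y ⟶ Z) (hc : HasCokernel f)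
    (hfh : IsAdmMono E (f ≫ h)) : IsAdmMono E f := by
  have seq : E (biprod.lift f (0 : X ⟶ Z)) (biprod.map (cokernel.π f) (𝟙 Z)) :=
    hE.of_isColimit (hE.isAdmMono_biprodLift_zero hfh) (w := by ext <;> simp)
      (CokernelCofork.IsColimit.ofπ' _ _ fun v hv =>
        ⟨biprod.desc (cokernel.desc f (biprod.inl ≫ v) (by simpa [biprod.lift_eq] using hv))
          (biprod.inr ≫ v), by ext <;> simp⟩)
  obtain ⟨k, hk, hk'⟩ := hE.exists_seq_of_isPullback seq (isPullback_biprodMap_id (cokernel.π f) Z)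
  obtain rfl : k = f := by simpa using hk =≫ biprod.fst
  exact ⟨_, _, hk'⟩

lemma admEpi_of_comp {X Y Z : C} (h : X ⟶ Y) (f : Y ⟶ Z) (hk : HasKernel f)
    (hfh : IsAdmEpi E (h ≫ f)) : IsAdmEpi E f := by
  have : HasBinaryBiproducts Cᵒᵖ :=
    ⟨fun X Y => ⟨⟨⟨_, (BinaryBiproduct.isBilimit X.unop Y.unop).op⟩⟩⟩⟩
  have hc : HasCokernel f.op :=
    ⟨⟨_, KernelFork.IsLimit.ofιOp _ (kernel.condition f) (kernelIsKernel f)⟩⟩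
  exact (hE.op.admMono_of_comp f.op h.op hc hfh.op).unop

theorem isExactStructure : IsExactStructure E where
  comp_zero := hE.comp_zero
  isKernel := hE.isKernel
  isCokernel := hE.isCokernel
  of_iso := hE.of_iso
  split := hE.split
  admMono_comp := hE.admMono_comp
  admEpi_comp := hE.admEpi_comp
  pullback := hE.pullback
  pushout := hE.pushout
  admEpi_of_comp _ _ _ h f := hE.admEpi_of_comp h f
  admMono_of_comp _ _ _ f h := hE.admMono_of_comp f h

end Biproducts

end IsKellerExact

lemma IsExactStructure.mono (hE : IsExactStructure E) {X Y Z : C} {f : X ⟶ Y} {g : Y ⟶ Z}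
    (h : E f g) : Mono f :=
  hE.isKellerExact.mono h

lemma IsExactStructure.middle_column_of_three_by_three (hE : IsExactStructure E)
    {X₁ X₂ X₃ Y₁ Y₂ Y₃ Z₁ Z₂ Z₃ : C}
    {a₁ : X₁ ⟶ Y₁} {b₁ : Y₁ ⟶ Z₁} {a₂ : X₂ ⟶ Y₂} {b₂ : Y₂ ⟶ Z₂} {a₃ : X₃ ⟶ Y₃} {b₃ : Y₃ ⟶ Z₃}
    (h₁ : E a₁ b₁) (h₂ : E a₂ b₂) (h₃ : E a₃ b₃)
    {x : X₁ ⟶ X₂} {x' : X₂ ⟶ X₃} {y : Y₁ ⟶ Y₂} {y' : Y₂ ⟶ Y₃} {z : Z₁ ⟶ Z₂} {z' : Z₂ ⟶ Z₃}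
    (hx : E x x') (hz : E z z') (hy : y ≫ y' = 0)
    (ha : a₁ ≫ y = x ≫ a₂) (hb : b₁ ≫ z = y ≫ b₂)
    (ha' : a₂ ≫ y' = x' ≫ a₃) (hb' : b₂ ≫ z' = y' ≫ b₃) : E y y' := by
  have hK := hE.isKellerExact
  -- `P` is the preimage of `Z₁` in `Y₂`; it is an extension of `Z₁` by `X₂`, and `y` factors as
  -- `u : Y₁ ⟶ P`, a cobase change of `x`, followed by the inclusion `i` of `P`.
  obtain ⟨P, i, p, sq, -⟩ := hE.pullback b₂ z ⟨_, _, h₂⟩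
  obtain ⟨k, hki, hk⟩ := hK.exists_seq_of_isPullback h₂ sq
  have hkp : k ≫ p = 0 := hE.comp_zero _ _ hk
  have hi : E i (b₂ ≫ z') := hK.of_isLimit (hE.admEpi_comp _ _ ⟨_, _, h₂⟩ ⟨_, _, hz⟩)
    (isLimitKernelForkCompOfIsPullback (hE.isKernel _ _ hz (hE.comp_zero _ _ hz)).some sq)
  obtain ⟨u, hui, hup⟩ : ∃ u : Y₁ ⟶ P, u ≫ i = y ∧ u ≫ p = b₁ :=
    ⟨sq.lift y b₁ hb.symm, sq.lift_fst _ _ _, sq.lift_snd _ _ _⟩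
  have hau : a₁ ≫ u = x ≫ k :=
    sq.hom_ext (by simp [hui, hki, ha]) (by simp [hup, hkp, hE.comp_zero _ _ h₁])
  have sq' : IsPushout a₁ x u k := hK.isPushout_of_comp_eq h₁ hk hau hup
  obtain ⟨r, hkr, hr⟩ := hK.exists_seq_of_isPushout hx sq'.flip
  obtain ⟨Q, c, hc⟩ : IsAdmMono E y := hui ▸ hE.admMono_comp _ _ ⟨_, _, hr⟩ ⟨_, _, hi⟩
  have := hE.epi hr
  have := hE.epi hc
  -- The cokernel `Q` of `y` is an extension of `Z₃` by `X₃` like `Y₃`, hence isomorphic to `Y₃`.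
  obtain ⟨s, hs⟩ := hK.exists_desc hr (i ≫ c) (by rw [reassoc_of% hui, hE.comp_zero _ _ hc])
  obtain ⟨t, ht⟩ := hK.exists_desc hc (b₂ ≫ z') (by
    rw [← reassoc_of% hb, hE.comp_zero _ _ hz, Limits.comp_zero])
  obtain ⟨l, hl⟩ := hK.exists_desc hc y' hy
  have hst : E s t := hE.noether hui hr hc hi hs ht
  have hiy : i ≫ y' = r ≫ a₃ := sq'.hom_ext
    (by rw [reassoc_of% hui, hy, reassoc_of% (hE.comp_zero _ _ hr), zero_comp])
    (by rw [reassoc_of% hki, reassoc_of% hkr, ha'])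
  have := hK.isIso_of_short_five hst h₃ l
    (by rw [← cancel_epi r, reassoc_of% hs, hl, hiy])
    (by rw [← cancel_epi c, reassoc_of% hl, ht, hb'])
  exact hE.of_iso y c y y' (Iso.refl _) (Iso.refl _) (asIso l) (by simp) (by simpa using hl) hc

end Exact

/-! ### Full subcategories closed under extensions -/

section Induced

variable {B : Type*} [Category B] {L : Type*} [Category L] {E : SeqClass L} {F : B ⥤ L}

lemma ClosedUnderExtensions.op (hF : ClosedUnderExtensions E F) :
    ClosedUnderExtensions E.op F.op := by
  rintro X Y Z f g hfg ⟨X', ⟨a⟩⟩ ⟨Z', ⟨c⟩⟩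
  obtain ⟨Y', ⟨b⟩⟩ := hF g.unop f.unop hfg ⟨_, ⟨c.unop.symm⟩⟩ ⟨_, ⟨a.unop.symm⟩⟩
  exact ⟨Opposite.op Y', ⟨b.symm.op⟩⟩

variable [Preadditive L] (hE : IsExactStructure E) [F.Full] [F.Faithful]

include hE

omit [F.Faithful] in
lemma isAdmMono_induced {X Y : B} {f : X ⟶ Y} {Q : L} {c : F.obj Y ⟶ Q} (h : E (F.map f) c)
    (hQ : F.essImage Q) : IsAdmMono (E.induced F) f := by
  obtain ⟨Z, ⟨e⟩⟩ := hQ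
  exact ⟨Z, F.preimage (c ≫ e.inv),
    hE.of_iso _ _ _ _ (Iso.refl _) (Iso.refl _) e.symm (by simp) (by simp) h⟩

variable (hF : ClosedUnderExtensions E F)

include hF

omit [F.Faithful] in
lemma admMono_comp_induced {X Y Z : B} (f : X ⟶ Y) (g : Y ⟶ Z) (hf : IsAdmMono (E.induced F) f)
    (hg : IsAdmMono (E.induced F) g) : IsAdmMono (E.induced F) (f ≫ g) := by
  obtain ⟨P, p, hp⟩ := hf
  obtain ⟨R, r, hr⟩ := hg
  obtain ⟨Q, c, hc⟩ := hE.admMono_comp _ _ ⟨_, _, hp⟩ ⟨_, _, hr⟩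
  have hfgc : F.map f ≫ F.map g ≫ c = 0 := by simpa using hE.comp_zero _ _ hc
  have hfgr : (F.map f ≫ F.map g) ≫ F.map r = 0 := by
    rw [Category.assoc, hE.comp_zero _ _ hr, comp_zero]
  have hs := hE.noether rfl hp hc hr (hE.fac hp _ hfgc) (hE.fac hc _ hfgr)
  rw [← F.map_comp] at hc
  exact isAdmMono_induced hE hc (hF _ _ hs (F.obj_mem_essImage P) (F.obj_mem_essImage R))

lemma pushout_induced {X Y W : B} (f : X ⟶ Y) (h : X ⟶ W) (hf : IsAdmMono (E.induced F) f) :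
    ∃ (P : B) (h' : Y ⟶ P) (f' : W ⟶ P), IsPushout f h h' f' ∧ IsAdmMono (E.induced F) f' := by
  obtain ⟨Z, g, hg⟩ := hf
  obtain ⟨P, h', f', sq, -⟩ := hE.pushout (F.map f) (F.map h) ⟨_, _, hg⟩
  obtain ⟨k, -, hk⟩ := hE.isKellerExact.exists_seq_of_isPushout hg sq
  obtain ⟨P', ⟨e⟩⟩ := hF _ _ hk (F.obj_mem_essImage W) (F.obj_mem_essImage Z)
  have sq' : IsPushout (F.map f) (F.map h) (F.map (F.preimage (h' ≫ e.inv)))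
      (F.map (F.preimage (f' ≫ e.inv))) :=
    sq.of_iso (Iso.refl _) (Iso.refl _) (Iso.refl _) e.symm (by simp) (by simp) (by simp) (by simp)
  have hk' : E (F.map (F.preimage (f' ≫ e.inv))) (e.hom ≫ k) :=
    hE.isKellerExact.of_iso_mid e.symm (by simp) (by simp) hk
  exact ⟨P', _, _, IsPushout.of_map F (F.map_injective (by simpa using sq'.w)) sq',
    isAdmMono_induced hE hk' (F.obj_mem_essImage Z)⟩

lemma isKellerExact_induced [Preadditive B] [F.Additive] : IsKellerExact (E.induced F) where
  comp_zero X Y Z f g h := F.map_injective (by simpa using hE.comp_zero _ _ h)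
  isKernel X Y Z f g h w := by
    have : Mono f := F.mono_of_mono_map (hE.isKellerExact.mono h)
    refine ⟨KernelFork.IsLimit.ofι' f w fun {W} k hk => ?_⟩
    have hl := hE.isKellerExact.exists_lift h (F.map k) (by rw [← F.map_comp, hk, F.map_zero])
    exact ⟨F.preimage hl.choose, F.map_injective (by simpa using hl.choose_spec)⟩
  isCokernel X Y Z f g (h : E (F.map f) (F.map g)) w := by
    have : Epi g := F.epi_of_epi_map (hE.epi h)
    exact ⟨CokernelCofork.IsColimit.ofπ' g w fun {W} k hk =>
      have hk' : F.map f ≫ F.map k = 0 := by rw [← F.map_comp, hk, F.map_zero]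
      ⟨F.preimage (hE.desc h (F.map k) hk'), F.map_injective (by
        rw [F.map_comp, F.map_preimage, hE.fac])⟩⟩
  of_iso _ _ _ _ _ _ _ _ _ _ a b c h₁ h₂ h :=
    hE.of_iso _ _ _ _ (F.mapIso a) (F.mapIso b) (F.mapIso c)
      (by simpa using congrArg F.map h₁) (by simpa using congrArg F.map h₂) h
  split _ _ b hb :=
    have := preservesBinaryBiproducts_of_preservesBiproducts F
    hE.split (F.mapBinaryBicone b) (isBinaryBilimitOfPreserves F hb)
  admMono_comp _ _ _ f g := admMono_comp_induced hE hF f g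
  admEpi_comp _ _ _ f g hf hg :=
    IsAdmMono.unop (E := E.induced F) (admMono_comp_induced hE.op hF.op g.op f.op hg.op hf.op)
  pullback _ _ _ g h hg :=
    let ⟨_, _, _, sq, hg'⟩ := pushout_induced hE.op hF.op g.op h.op hg.op
    ⟨_, _, _, sq.unop.flip, IsAdmMono.unop (E := E.induced F) hg'⟩
  pushout _ _ _ f h := pushout_induced hE hF f h

lemma hasFiniteBiproducts_of_closedUnderExtensions [HasFiniteBiproducts L] [Preadditive B]
    [F.Additive] {O : B} (hO : IsZero (F.obj O)) : HasFiniteBiproducts B := by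
  have : HasZeroObject B := ⟨O, IsZero.of_full_of_faithful_of_isZero F O hO⟩
  have := hasBinaryBiproducts_of_finite_biproducts L
  have : HasBinaryBiproducts B := ⟨fun X Z => by
    obtain ⟨Y, ⟨e⟩⟩ := hF _ _ (hE.split (BinaryBiproduct.bicone (F.obj X) (F.obj Z))
      (BinaryBiproduct.isBilimit _ _)) (F.obj_mem_essImage X) (F.obj_mem_essImage Z)
    let b : BinaryBicone X Z :=
      { pt := Y
        fst := F.preimage (e.hom ≫ biprod.fst)
        snd := F.preimage (e.hom ≫ biprod.snd)
        inl := F.preimage (biprod.inl ≫ e.inv)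
        inr := F.preimage (biprod.inr ≫ e.inv)
        inl_fst := F.map_injective (by simp)
        inl_snd := F.map_injective (by simp)
        inr_fst := F.map_injective (by simp)
        inr_snd := F.map_injective (by simp) }
    refine HasBinaryBiproduct.mk ⟨b, isBinaryBilimitOfTotal b (F.map_injective ?_)⟩
    rw [← cancel_epi e.inv, ← cancel_mono e.hom]
    simp [b]⟩
  have : HasFiniteProducts B := hasFiniteProducts_of_has_binary_and_terminal
  exact HasFiniteBiproducts.of_hasFiniteProducts

omit [Preadditive L] hE in
theorem isExactCategory_induced (hE : IsExactCategory E) {O : B} (hO : IsZero (F.obj O)) :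
    IsExactCategory (E.induced F) := by
  obtain ⟨_, _, hE⟩ := hE
  let : Preadditive B := Preadditive.ofFullyFaithful (Functor.FullyFaithful.ofFullyFaithful F)
  have : F.Additive := (Functor.FullyFaithful.ofFullyFaithful F).additive_ofFullyFaithful
  have := hasFiniteBiproducts_of_closedUnderExtensions hE hF hO
  have := hasBinaryBiproducts_of_finite_biproducts B
  exact ⟨inferInstance, inferInstance, (isKellerExact_induced hE hF).isExactStructure⟩

end Induced

/-! ### Functor categories -/

section FunctorCategory

variable {J : Type*} [Category* J] {A : Type*} [Category* A]

lemma exists_isPullback_of_hasPullback_app {Y Z W : J ⥤ A} (g : Y ⟶ Z) (h : W ⟶ Z)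
    (H : ∀ j, HasPullback (g.app j) (h.app j)) :
    ∃ (P : J ⥤ A) (h' : P ⟶ Y) (g' : P ⟶ W), IsPullback h' g' g h ∧
      ∀ j, IsPullback (h'.app j) (g'.app j) (g.app j) (h.app j) := by
  have (j : J) : HasLimit ((cospan g h).flip.obj j) :=
    have : HasLimit (cospan (((cospan g h).flip.obj j).map WalkingCospan.Hom.inl)
      (((cospan g h).flip.obj j).map WalkingCospan.Hom.inr)) := H j
    hasLimit_of_iso (diagramIsoCospan ((cospan g h).flip.obj j)).symm
  exact ⟨_, _, _, IsPullback.of_hasPullback g h,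
    fun j => (IsPullback.of_hasPullback g h).map ((evaluation J A).obj j)⟩

lemma exists_isPushout_of_hasPushout_app {X Y W : J ⥤ A} (f : X ⟶ Y) (h : X ⟶ W)
    (H : ∀ j, HasPushout (f.app j) (h.app j)) :
    ∃ (P : J ⥤ A) (h' : Y ⟶ P) (f' : W ⟶ P), IsPushout f h h' f' ∧
      ∀ j, IsPushout (f.app j) (h.app j) (h'.app j) (f'.app j) := by
  have (j : J) : HasColimit ((span f h).flip.obj j) :=
    have : HasColimit (span (((span f h).flip.obj j).map WalkingSpan.Hom.fst)
      (((span f h).flip.obj j).map WalkingSpan.Hom.snd)) := H j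
    hasColimit_of_iso (diagramIsoSpan ((span f h).flip.obj j))
  exact ⟨_, _, _, IsPushout.of_hasPushout f h,
    fun j => (IsPushout.of_hasPushout f h).map ((evaluation J A).obj j)⟩

end FunctorCategory

section Pointwise

variable {J : Type*} [Category* J] {A : Type u} [Category.{v} A]

/-- The sequences of functors which belong to `E` at every object. -/
def pointwiseSeq (J : Type*) [Category* J] (E : SeqClass A) : SeqClass (J ⥤ A) :=
  fun _ _ _ f g => ∀ j, E (f.app j) (g.app j)

variable [Preadditive A] {E : SeqClass A} (hE : IsKellerExact E)

include hE

lemma isAdmMono_pointwiseSeq_iff {X Y : J ⥤ A} {f : X ⟶ Y} :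
    IsAdmMono (pointwiseSeq J E) f ↔ ∀ j, IsAdmMono E (f.app j) := by
  refine ⟨fun ⟨Z, g, h⟩ j => ⟨_, _, h j⟩, fun h => ?_⟩
  choose Z g h using h
  have desc {i j : J} (a : i ⟶ j) : ∃ l : Z i ⟶ Z j, g i ≫ l = Y.map a ≫ g j :=
    hE.exists_desc (h i) _ (by rw [← f.naturality_assoc, hE.comp_zero _ _ (h j), comp_zero])
  choose l hl using @desc
  have := fun i => hE.epi (h i)
  exact ⟨{ obj := Z, map := l
           map_id := fun i => by simp [← cancel_epi (g i), hl]
           map_comp := fun a b => by simp [← cancel_epi (g _), hl, reassoc_of% hl] },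
    { app := g, naturality := fun _ _ a => (hl a).symm }, h⟩

lemma isAdmEpi_pointwiseSeq_iff {Y Z : J ⥤ A} {g : Y ⟶ Z} :
    IsAdmEpi (pointwiseSeq J E) g ↔ ∀ j, IsAdmEpi E (g.app j) := by
  refine ⟨fun ⟨X, f, h⟩ j => ⟨_, _, h j⟩, fun h => ?_⟩
  choose X f h using h
  have lift {i j : J} (a : i ⟶ j) : ∃ l : X i ⟶ X j, l ≫ f j = f i ≫ Y.map a :=
    hE.exists_lift (h j) _ (by
      rw [Category.assoc, g.naturality, ← Category.assoc, hE.comp_zero _ _ (h i), zero_comp])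
  choose l hl using @lift
  have := fun i => hE.mono (h i)
  exact ⟨{ obj := X, map := l
           map_id := fun i => by simp [← cancel_mono (f i), hl]
           map_comp := fun a b => by simp [← cancel_mono (f _), hl, reassoc_of% hl] },
    { app := f, naturality := fun _ _ a => hl a }, h⟩

lemma nonempty_isLimit_of_pointwiseSeq {X Y Z : J ⥤ A} {f : X ⟶ Y} {g : Y ⟶ Z}
    (h : pointwiseSeq J E f g) (w : f ≫ g = 0) : Nonempty (IsLimit (KernelFork.ofι f w)) := by
  have := fun j => hE.mono (h j)
  have : Mono f := NatTrans.mono_of_mono_app f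
  refine ⟨KernelFork.IsLimit.ofι' f w fun {W} k hk => ?_⟩
  choose l hl using fun j => hE.exists_lift (h j) (k.app j) (congr_app hk j)
  have natural {i j : J} (a : i ⟶ j) : W.map a ≫ l j = l i ≫ X.map a := by
    rw [← cancel_mono (f.app j), Category.assoc, Category.assoc, f.naturality,
      reassoc_of% hl, hl, k.naturality]
  exact ⟨{ app := l, naturality := fun _ _ => natural }, by ext j; exact hl j⟩

lemma nonempty_isColimit_of_pointwiseSeq {X Y Z : J ⥤ A} {f : X ⟶ Y} {g : Y ⟶ Z}
    (h : pointwiseSeq J E f g) (w : f ≫ g = 0) : Nonempty (IsColimit (CokernelCofork.ofπ g w)) := by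
  have := fun j => hE.epi (h j)
  have : Epi g := NatTrans.epi_of_epi_app g
  refine ⟨CokernelCofork.IsColimit.ofπ' g w fun {W} k hk => ?_⟩
  choose l hl using fun j => hE.exists_desc (h j) (k.app j) (congr_app hk j)
  have natural {i j : J} (a : i ⟶ j) : Z.map a ≫ l j = l i ≫ W.map a := by
    rw [← cancel_epi (g.app i), ← g.naturality_assoc, hl, reassoc_of% hl, k.naturality]
  exact ⟨{ app := l, naturality := fun _ _ => natural }, by ext j; exact hl j⟩

lemma isKellerExact_pointwiseSeq : IsKellerExact (pointwiseSeq J E) where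
  comp_zero X Y Z f g h := by
    ext j
    exact hE.comp_zero _ _ (h j)
  isKernel _ _ _ _ _ := nonempty_isLimit_of_pointwiseSeq hE
  isCokernel _ _ _ _ _ := nonempty_isColimit_of_pointwiseSeq hE
  of_iso _ _ _ _ _ _ _ _ _ _ a b c h₁ h₂ h j :=
    hE.of_iso _ _ _ _ (a.app j) (b.app j) (c.app j) (congr_app h₁ j) (congr_app h₂ j) (h j)
  split _ _ b hb j :=
    have := preservesBinaryBiproducts_of_preservesBiproducts ((evaluation J A).obj j)
    hE.split _ (isBinaryBilimitOfPreserves ((evaluation J A).obj j) hb)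
  admMono_comp _ _ _ f g hf hg := by
    rw [isAdmMono_pointwiseSeq_iff hE] at *
    exact fun j => hE.admMono_comp _ _ (hf j) (hg j)
  admEpi_comp _ _ _ f g hf hg := by
    rw [isAdmEpi_pointwiseSeq_iff hE] at *
    exact fun j => hE.admEpi_comp _ _ (hf j) (hg j)
  pullback Y Z W g h hg := by
    obtain ⟨X, f, hfg⟩ := hg
    obtain ⟨P, h', g', sq, sq'⟩ := exists_isPullback_of_hasPullback_app g h fun j =>
      have ⟨_, _, _, sq, _⟩ := hE.pullback (g.app j) (h.app j) ⟨_, _, hfg j⟩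
      sq.hasPullback
    exact ⟨P, h', g', sq, (isAdmEpi_pointwiseSeq_iff hE).2 fun j =>
      have ⟨_, _, h⟩ := hE.exists_seq_of_isPullback (hfg j) (sq' j)
      ⟨_, _, h⟩⟩
  pushout X Y W f h hf := by
    obtain ⟨Z, g, hfg⟩ := hf
    obtain ⟨P, h', f', sq, sq'⟩ := exists_isPushout_of_hasPushout_app f h fun j =>
      have ⟨_, _, _, sq, _⟩ := hE.pushout (f.app j) (h.app j) ⟨_, _, hfg j⟩
      sq.hasPushout
    exact ⟨P, h', f', sq, (isAdmMono_pointwiseSeq_iff hE).2 fun j =>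
      have ⟨_, _, h⟩ := hE.exists_seq_of_isPushout (hfg j) (sq' j)
      ⟨_, _, h⟩⟩

end Pointwise

/-! ### Localization at well-pointed endofunctors -/

/-- A family of endofunctors `T φ` with points `η φ : X ⟶ T φ X`, closed under composition up to
enlargement of the index. The model is the family of reindexings along bicofinal maps `φ ≥ id`; it
exhibits the localization at its points as a calculus of left fractions. -/
structure Reindexing (C : Type u) [Category.{v} C] where
  ι : Type
  nonempty : Nonempty ι
  T : ι → C ⥤ C
  η : ∀ φ, 𝟭 C ⟶ T φ
  map_η : ∀ φ X, (T φ).map ((η φ).app X) = (η φ).app ((T φ).obj X)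
  comp : ∀ φ ψ, ∃ (χ : ι) (m : T φ ⋙ T ψ ⟶ T χ),
    ∀ X, (η φ).app X ≫ (η ψ).app ((T φ).obj X) ≫ m.app X = (η χ).app X

namespace Reindexing

variable {C : Type u} [Category.{v} C] (R : Reindexing C)

/-- The class of the maps `X ⟶ Y` which are invertible up to the points `X ⟶ T φ X` and
`Y ⟶ T φ Y`: a calculus of left fractions with the same localization as the class of the points. -/
def W : MorphismProperty C := fun X Y s =>
  ∃ (φ : R.ι) (t : Y ⟶ (R.T φ).obj X), s ≫ t = (R.η φ).app X ∧ t ≫ (R.T φ).map s = (R.η φ).app Y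

variable {R} in
lemma η_naturality {X Y : C} (φ : R.ι) (f : X ⟶ Y) :
    (R.η φ).app X ≫ (R.T φ).map f = f ≫ (R.η φ).app Y :=
  ((R.η φ).naturality f).symm

lemma W_η (φ : R.ι) (X : C) : R.W ((R.η φ).app X) :=
  ⟨φ, 𝟙 _, Category.comp_id _, by rw [Category.id_comp]; exact R.map_η φ X⟩

instance : R.W.HasLeftCalculusOfFractions where
  id_mem X := by
    obtain ⟨φ⟩ := R.nonempty
    exact ⟨φ, (R.η φ).app X, Category.id_comp _, by simp⟩
  comp_mem {X Y Z} s s' := by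
    rintro ⟨φ, t, hst, hts⟩ ⟨φ', t', hst', hts'⟩
    obtain ⟨χ, m, hm⟩ := R.comp φ φ'
    refine ⟨χ, t' ≫ (R.T φ').map t ≫ m.app X, ?_, ?_⟩
    · rw [← hm, Category.assoc, reassoc_of% hst', ← hst, reassoc_of% η_naturality φ' t,
        Category.assoc]
    · have hm' : (R.T φ').map t ≫ m.app X ≫ (R.T χ).map (s ≫ s') =
          (R.T φ').map (t ≫ (R.T φ).map s ≫ (R.T φ).map s') ≫ m.app Z := by
        have := m.naturality (s ≫ s')
        rw [Functor.comp_map] at this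
        rw [← this]
        simp
      rw [← hm, Category.assoc, Category.assoc, hm', reassoc_of% hts, η_naturality]
      rw [Functor.map_comp, Category.assoc, reassoc_of% hts', ← Category.assoc, η_naturality]
      exact Category.assoc _ _ _
  exists_leftFraction X Y f := by
    obtain ⟨φ, t, hst, -⟩ := f.hs
    exact ⟨⟨t ≫ (R.T φ).map f.f, (R.η φ).app Y, R.W_η φ Y⟩, by
      simp [reassoc_of% hst, η_naturality]⟩
  ext X' X Y f g s := by
    rintro ⟨φ, t, -, hts⟩ e
    refine ⟨_, (R.η φ).app Y, R.W_η φ Y, ?_⟩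
    rw [← η_naturality, ← η_naturality, ← hts, Category.assoc, Category.assoc, ← Functor.map_comp,
      e, Functor.map_comp]

lemma isInvertedBy {B : Type*} [Category B] (F : C ⥤ B)
    (h : ∀ φ X, IsIso (F.map ((R.η φ).app X))) : R.W.IsInvertedBy F := by
  rintro X Y s ⟨φ, t, hst, hts⟩
  have : IsIso (F.map s ≫ F.map t) := by rw [← F.map_comp, hst]; exact h φ X
  have : IsIso (F.map t ≫ F.map ((R.T φ).map s)) := by
    rw [← F.map_comp, hts]; exact h φ Y
  have : Mono (F.map t) := mono_of_mono _ (F.map ((R.T φ).map s))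
  have : IsSplitEpi (F.map t) := ⟨⟨inv (F.map s ≫ F.map t) ≫ F.map s, by simp⟩⟩
  have : IsIso (F.map t) := isIso_of_mono_of_isSplitEpi _
  exact IsIso.of_isIso_comp_right _ (F.map t)

section Localization

variable {D : Type*} [Category D] (L : C ⥤ D) [L.IsLocalization R.W]

instance isIso_map_η (φ : R.ι) (X : C) : IsIso (L.map ((R.η φ).app X)) :=
  Localization.inverts L R.W _ (R.W_η φ X)

lemma map_eq_iff {X Y : C} (a b : X ⟶ Y) :
    L.map a = L.map b ↔ ∃ φ, a ≫ (R.η φ).app Y = b ≫ (R.η φ).app Y := by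
  rw [MorphismProperty.map_eq_iff_postcomp L R.W]
  constructor
  · rintro ⟨Z, s, ⟨φ, t, hst, -⟩, e⟩
    exact ⟨φ, by rw [← hst, reassoc_of% e]⟩
  · rintro ⟨φ, e⟩
    exact ⟨_, _, R.W_η φ Y, e⟩

lemma exists_map {X Y : C} (f : L.obj X ⟶ L.obj Y) :
    ∃ (φ : R.ι) (a : X ⟶ (R.T φ).obj Y), L.map a = f ≫ L.map ((R.η φ).app Y) := by
  obtain ⟨ψ, rfl⟩ := Localization.exists_leftFraction L R.W f
  obtain ⟨φ, t, hst, -⟩ := ψ.hs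
  exact ⟨φ, ψ.f ≫ t, by simp [← hst]⟩

lemma faithful_of_iso {B : Type*} [Category B] {F : C ⥤ B} {G : D ⥤ B} (e : L ⋙ G ≅ F)
    (h : ∀ ⦃X Y : C⦄ (a b : X ⟶ Y), F.map a = F.map b →
      ∃ φ, a ≫ (R.η φ).app Y = b ≫ (R.η φ).app Y) : G.Faithful :=
  Functor.faithful_of_comp_of_hasLeftCalculusOfFractions L R.W G fun X Y a b hab => by
    rw [R.map_eq_iff]
    refine h a b ?_
    have ha := e.hom.naturality a
    have hb := e.hom.naturality b
    simp only [Functor.comp_map] at ha hb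
    rw [← cancel_epi (e.hom.app X), ← ha, ← hb, hab]

lemma full_of_iso {B : Type*} [Category B] {F : C ⥤ B} {G : D ⥤ B} (e : L ⋙ G ≅ F)
    (h : ∀ ⦃X Y : C⦄ (f : F.obj X ⟶ F.obj Y),
      ∃ (φ : R.ι) (a : X ⟶ (R.T φ).obj Y), F.map a = f ≫ F.map ((R.η φ).app Y)) : G.Full := by
  have exists_preimage ⦃X Y : C⦄ (g : G.obj (L.obj X) ⟶ G.obj (L.obj Y)) :
      ∃ f, G.map f = g := by
    obtain ⟨φ, a, ha⟩ := h (e.inv.app X ≫ g ≫ e.hom.app Y)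
    have hFa : G.map (L.map a) = e.hom.app X ≫ F.map a ≫ e.inv.app _ := by simp
    have hη : F.map ((R.η φ).app Y) ≫ e.inv.app _ =
        e.inv.app Y ≫ G.map (L.map ((R.η φ).app Y)) := e.inv.naturality _
    refine ⟨L.map a ≫ inv (L.map ((R.η φ).app Y)), ?_⟩
    rw [Functor.map_comp, Functor.map_inv, IsIso.comp_inv_eq, hFa, ha]
    simp [hη]
  have := Localization.essSurj L R.W
  refine ⟨fun {X Y} g => ?_⟩
  let eX := L.objObjPreimageIso X
  let eY := L.objObjPreimageIso Y
  obtain ⟨f, hf⟩ := exists_preimage (G.map eX.hom ≫ g ≫ G.map eY.inv)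
  exact ⟨eX.inv ≫ f ≫ eY.hom, by simp [hf]⟩

end Localization

lemma isLocalization {B : Type*} [Category B] (F : C ⥤ B) [F.EssSurj]
    (hη : ∀ φ X, IsIso (F.map ((R.η φ).app X)))
    (h_eq : ∀ ⦃X Y : C⦄ (a b : X ⟶ Y), F.map a = F.map b →
      ∃ φ, a ≫ (R.η φ).app Y = b ≫ (R.η φ).app Y)
    (h_lift : ∀ ⦃X Y : C⦄ (f : F.obj X ⟶ F.obj Y),
      ∃ (φ : R.ι) (a : X ⟶ (R.T φ).obj Y), F.map a = f ≫ F.map ((R.η φ).app Y)) :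
    F.IsLocalization R.W := by
  have hF := R.isInvertedBy F hη
  let G := Localization.lift F hF R.W.Q
  let e : R.W.Q ⋙ G ≅ F := Localization.fac F hF R.W.Q
  have := R.faithful_of_iso R.W.Q e h_eq
  have := R.full_of_iso R.W.Q e h_lift
  have : G.EssSurj := ⟨fun Y => ⟨R.W.Q.obj (F.objPreimage Y),
    ⟨e.app _ ≪≫ F.objObjPreimageIso Y⟩⟩⟩
  have : G.IsEquivalence := {}
  exact Functor.IsLocalization.of_iso R.W e

section Colimits

variable {D : Type*} [Category D] (L : C ⥤ D) [L.IsLocalization R.W]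

include R

lemma exists_map_to {X : C} {T : D} (f : L.obj X ⟶ T) :
    ∃ (Y : C) (e : T ≅ L.obj Y) (a : X ⟶ Y), L.map a = f ≫ e.hom := by
  have := Localization.essSurj L R.W
  let i := L.objObjPreimageIso T
  obtain ⟨φ, a, ha⟩ := R.exists_map L (f ≫ i.inv)
  exact ⟨_, i.symm ≪≫ asIso (L.map ((R.η φ).app (L.objPreimage T))), a, by simp [ha]⟩

lemma exists_map_to_of_comp_eq {X Y Z : C} (f : X ⟶ Y) (t : X ⟶ Z) {T : D} (a : L.obj Y ⟶ T)
    (b : L.obj Z ⟶ T) (h : L.map f ≫ a = L.map t ≫ b) :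
    ∃ (T' : C) (e : T ≅ L.obj T') (a' : Y ⟶ T') (b' : Z ⟶ T'),
      L.map a' = a ≫ e.hom ∧ L.map b' = b ≫ e.hom ∧ f ≫ a' = t ≫ b' := by
  obtain ⟨T₁, e₁, a', ha'⟩ := R.exists_map_to L a
  obtain ⟨φ, b', hb'⟩ := R.exists_map L (b ≫ e₁.hom)
  obtain ⟨ψ, hψ⟩ := (R.map_eq_iff L (f ≫ a' ≫ (R.η φ).app T₁) (t ≫ b')).1 (by
    simp only [Functor.map_comp, ha', hb', Category.assoc, reassoc_of% h])
  exact ⟨_, e₁ ≪≫ asIso (L.map ((R.η φ).app _)) ≪≫ asIso (L.map ((R.η ψ).app _)),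
    a' ≫ (R.η φ).app _ ≫ (R.η ψ).app _, b' ≫ (R.η ψ).app _, by simp [ha'], by simp [hb'],
    by simpa using hψ⟩

lemma map_isPushout {X Y Z P : C} {f : X ⟶ Y} {t : X ⟶ Z} {h : Y ⟶ P} {k : Z ⟶ P}
    (sq : IsPushout f t h k) : IsPushout (L.map f) (L.map t) (L.map h) (L.map k) := by
  have exists_desc {T : D} (a : L.obj Y ⟶ T) (b : L.obj Z ⟶ T) (w : L.map f ≫ a = L.map t ≫ b) :
      ∃ l, L.map h ≫ l = a ∧ L.map k ≫ l = b := by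
    obtain ⟨T', e, a', b', ha, hb, w'⟩ := R.exists_map_to_of_comp_eq L f t a b w
    exact ⟨L.map (sq.desc a' b' w') ≫ e.inv, by simp [← L.map_comp_assoc, ha],
      by simp [← L.map_comp_assoc, hb]⟩
  have hom_ext {T : D} (a b : L.obj P ⟶ T) (hab : L.map h ≫ a = L.map h ≫ b)
      (hab' : L.map k ≫ a = L.map k ≫ b) : a = b := by
    obtain ⟨T', e, a', b', ha, hb, w'⟩ := R.exists_map_to_of_comp_eq L h h a b hab
    obtain ⟨ψ, hψ⟩ := (R.map_eq_iff L (k ≫ a') (k ≫ b')).1 (by simp [ha, hb, reassoc_of% hab'])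
    have : a' ≫ (R.η ψ).app T' = b' ≫ (R.η ψ).app T' :=
      sq.hom_ext (by rw [reassoc_of% w']) (by simpa using hψ)
    rw [← cancel_mono e.hom, ← ha, ← hb, R.map_eq_iff]
    exact ⟨ψ, this⟩
  refine ⟨⟨by rw [← L.map_comp, sq.w, L.map_comp]⟩, ⟨?_⟩⟩
  exact PushoutCocone.IsColimit.mk _ (fun s => (exists_desc s.inl s.inr s.condition).choose)
    (fun s => (exists_desc s.inl s.inr s.condition).choose_spec.1)
    (fun s => (exists_desc s.inl s.inr s.condition).choose_spec.2) fun s m hm hm' =>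
    hom_ext _ _ (by rw [hm, (exists_desc s.inl s.inr s.condition).choose_spec.1])
      (by rw [hm', (exists_desc s.inl s.inr s.condition).choose_spec.2])

lemma epi_map {Y Z : C} (g : Y ⟶ Z) [Epi g] : Epi (L.map g) := by
  refine ⟨fun {T} a b hab => ?_⟩
  obtain ⟨T', e, a', b', ha, hb, h⟩ := R.exists_map_to_of_comp_eq L g g a b hab
  rw [← cancel_mono e.hom, ← ha, ← hb, (cancel_epi g).1 h]

end Colimits

end Reindexing

section MapSeq

variable {C : Type*} [Category* C] {D : Type*} [Category* D]

/-- The sequences isomorphic to the image under `L` of a sequence in `E`. The class of admissible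
sequences of the Beilinson category is by definition of this form. -/
def SeqClass.map (E : SeqClass C) (L : C ⥤ D) : SeqClass D := fun X Y Z f g =>
  ∃ (X' Y' Z' : C) (f' : X' ⟶ Y') (g' : Y' ⟶ Z') (a : X ≅ L.obj X') (b : Y ≅ L.obj Y')
    (c : Z ≅ L.obj Z'),
    E f' g' ∧ f ≫ b.hom = a.hom ≫ L.map f' ∧ g ≫ c.hom = b.hom ≫ L.map g'

variable {L : C ⥤ D} {E : SeqClass C}

lemma SeqClass.map_map {X Y Z : C} {f : X ⟶ Y} {g : Y ⟶ Z} (h : E f g) :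
    E.map L (L.map f) (L.map g) :=
  ⟨X, Y, Z, f, g, Iso.refl _, Iso.refl _, Iso.refl _, h, by simp, by simp⟩

lemma SeqClass.map_of_iso {X Y Z X' Y' Z' : D} {f : X ⟶ Y} {g : Y ⟶ Z} {f' : X' ⟶ Y'}
    {g' : Y' ⟶ Z'} (a : X ≅ X') (b : Y ≅ Y') (c : Z ≅ Z') (hf : f ≫ b.hom = a.hom ≫ f')
    (hg : g ≫ c.hom = b.hom ≫ g') (h : E.map L f g) : E.map L f' g' := by
  obtain ⟨U, V, W, i, p, a', b', c', hip, hi, hp⟩ := h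
  refine ⟨U, V, W, i, p, a.symm ≪≫ a', b.symm ≪≫ b', c.symm ≪≫ c', hip, ?_, ?_⟩
  · rw [← cancel_epi a.hom]
    simp [← reassoc_of% hf, hi]
  · rw [← cancel_epi b.hom]
    simp [← reassoc_of% hg, hp]

lemma SeqClass.isAdmMono_map_of_iso {X Y X' Y' : D} {f : X ⟶ Y} {f' : X' ⟶ Y'}
    (a : X ≅ X') (b : Y ≅ Y') (hf : f ≫ b.hom = a.hom ≫ f') (h : IsAdmMono (E.map L) f) :
    IsAdmMono (E.map L) f' :=
  let ⟨Z, g, h⟩ := h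
  ⟨Z, b.inv ≫ g, SeqClass.map_of_iso a b (Iso.refl _) hf (by simp) h⟩

lemma SeqClass.map_op {X Y Z : Dᵒᵖ} {f : X ⟶ Y} {g : Y ⟶ Z} :
    E.op.map L.op f g ↔ (E.map L).op f g := by
  constructor
  · rintro ⟨X', Y', Z', f', g', a, b, c, h, hf, hg⟩
    refine SeqClass.map_of_iso c.unop b.unop a.unop ?_ ?_ (SeqClass.map_map (L := L) h)
    · exact Quiver.Hom.op_inj hg.symm
    · exact Quiver.Hom.op_inj hf.symm
  · rintro ⟨X', Y', Z', f', g', a, b, c, h, hf, hg⟩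
    refine SeqClass.map_of_iso c.op b.op a.op ?_ ?_
      (SeqClass.map_map (L := L.op) (E := E.op) (f := g'.op) (g := f'.op) h)
    · exact Quiver.Hom.unop_inj hg.symm
    · exact Quiver.Hom.unop_inj hf.symm

end MapSeq

/-! ### Localizations of exact categories -/

section MapExact

variable {C : Type u} [Category.{v} C] [Preadditive C] {D : Type*} [Category* D] [Preadditive D]
  (L : C ⥤ D) [L.Additive]

lemma hasFiniteBiproducts_of_essSurj [HasFiniteBiproducts C] [L.EssSurj] :
    HasFiniteBiproducts D := by
  have := hasBinaryBiproducts_of_finite_biproducts C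
  have := preservesBinaryBiproducts_of_preservesBiproducts L
  have : HasZeroObject D := L.hasZeroObject_of_additive
  have : HasBinaryProducts D :=
    have (X Y : D) : HasLimit (pair X Y) :=
      hasLimit_of_iso (F := pair (L.obj _) (L.obj _))
        (mapPairIso (L.objObjPreimageIso X) (L.objObjPreimageIso Y))
    hasBinaryProducts_of_hasLimit_pair D
  have : HasFiniteProducts D := hasFiniteProducts_of_has_binary_and_terminal
  exact HasFiniteBiproducts.of_hasFiniteProducts

variable {E : SeqClass C} (hE : IsKellerExact E)

include hE

lemma comp_zero_of_map {X Y Z : D} {f : X ⟶ Y} {g : Y ⟶ Z} (h : E.map L f g) : f ≫ g = 0 := by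
  obtain ⟨U, V, W, i, p, a, b, c, hip, hi, hp⟩ := h
  rw [← cancel_mono c.hom, Category.assoc, hp, reassoc_of% hi, ← Functor.map_comp,
    hE.comp_zero _ _ hip]
  simp

lemma map_split [HasFiniteBiproducts C] [L.EssSurj] {X Z : D} (b : BinaryBicone X Z)
    (hb : b.IsBilimit) : E.map L b.inl b.snd := by
  have := hasBinaryBiproducts_of_finite_biproducts C
  have := preservesBinaryBiproducts_of_preservesBiproducts L
  let i := (L.objObjPreimageIso X).symm
  let j := (L.objObjPreimageIso Z).symm
  let B := L.mapBinaryBicone (BinaryBiproduct.bicone (L.objPreimage X) (L.objPreimage Z))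
  have hB : B.IsBilimit := isBinaryBilimitOfPreserves L (BinaryBiproduct.isBilimit _ _)
  let e : b.pt ≅ B.pt :=
    { hom := b.fst ≫ i.hom ≫ B.inl + b.snd ≫ j.hom ≫ B.inr
      inv := B.fst ≫ i.inv ≫ b.inl + B.snd ≫ j.inv ≫ b.inr
      hom_inv_id := by
        simp only [Preadditive.add_comp, Preadditive.comp_add, Category.assoc, B.inl_fst_assoc,
          B.inl_snd_assoc, B.inr_fst_assoc, B.inr_snd_assoc, zero_comp, Limits.comp_zero, add_zero,
          zero_add, i.hom_inv_id_assoc, j.hom_inv_id_assoc, IsBilimit.binary_total hb]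
      inv_hom_id := by
        simp only [Preadditive.add_comp, Preadditive.comp_add, Category.assoc, b.inl_fst_assoc,
          b.inl_snd_assoc, b.inr_fst_assoc, b.inr_snd_assoc, zero_comp, Limits.comp_zero, add_zero,
          zero_add, i.inv_hom_id_assoc, j.inv_hom_id_assoc, IsBilimit.binary_total hB] }
  have hinl : b.inl ≫ e.hom = i.hom ≫ B.inl := by simp [e]
  have hsnd : b.snd ≫ j.hom = e.hom ≫ B.snd := by simp [e]
  exact ⟨_, _, _, _, _, i, e, j, hE.split _ (BinaryBiproduct.isBilimit _ _), hinl, hsnd⟩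

variable (R : Reindexing C) [L.IsLocalization R.W]

include R

lemma isCokernel_of_map {X Y Z : D} {f : X ⟶ Y} {g : Y ⟶ Z} (h : E.map L f g) (w : f ≫ g = 0) :
    Nonempty (IsColimit (CokernelCofork.ofπ g w)) := by
  obtain ⟨U, V, W, i, p, a, b, c, hip, hi, hp⟩ := h
  have := hE.epi hip
  have := R.epi_map L p
  have : Epi g := by
    rw [show g = b.hom ≫ L.map p ≫ c.inv by rw [← reassoc_of% hp]; simp]
    infer_instance
  have exists_desc {T : D} (k : Y ⟶ T) (hk : f ≫ k = 0) : ∃ l, g ≫ l = k := by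
    obtain ⟨T', e, k', z, hk', -, hz⟩ := R.exists_map_to_of_comp_eq L i (0 : U ⟶ V)
      (b.inv ≫ k) 0 (by rw [← cancel_epi a.hom, ← reassoc_of% hi]; simp [hk])
    obtain ⟨l, hl⟩ := hE.exists_desc hip k' (by simpa using hz)
    exact ⟨c.hom ≫ L.map l ≫ e.inv, by
      rw [reassoc_of% hp, ← L.map_comp_assoc, hl, hk']; simp⟩
  exact ⟨CokernelCofork.IsColimit.ofπ' g w fun k hk =>
    ⟨_, (exists_desc k hk).choose_spec⟩⟩

omit [Preadditive D] [L.Additive] in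
lemma pushout_map {X Y W : D} (f : X ⟶ Y) (h : X ⟶ W) (hf : IsAdmMono (E.map L) f) :
    ∃ (P : D) (h' : Y ⟶ P) (f' : W ⟶ P), IsPushout f h h' f' ∧ IsAdmMono (E.map L) f' := by
  obtain ⟨Z, g, U, V, Z', i, p, a, b, c, hip, hi, -⟩ := hf
  obtain ⟨W', e, t, ht⟩ := R.exists_map_to L (a.inv ≫ h)
  obtain ⟨P, h', f', sq, Q, q, hq⟩ := hE.pushout i t ⟨_, _, hip⟩
  refine ⟨L.obj P, b.hom ≫ L.map h', e.hom ≫ L.map f', ?_, ?_⟩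
  · refine (R.map_isPushout L sq).of_iso a.symm b.symm e.symm (Iso.refl _) ?_ ?_ ?_ ?_
    · rw [← cancel_epi a.hom, ← cancel_mono b.hom]
      simp [hi]
    · simp [ht]
    · simp
    · simp
  · exact SeqClass.isAdmMono_map_of_iso e.symm (Iso.refl _) (by simp)
      ⟨_, _, SeqClass.map_map hq⟩

omit [Preadditive D] [L.Additive] in
lemma admMono_comp_map
    (hT : ∀ φ ⦃X Y Z : C⦄ (f : X ⟶ Y) (g : Y ⟶ Z), E f g → E ((R.T φ).map f) ((R.T φ).map g))
    {X Y Z : D} (f : X ⟶ Y) (g : Y ⟶ Z) (hf : IsAdmMono (E.map L) f)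
    (hg : IsAdmMono (E.map L) g) : IsAdmMono (E.map L) (f ≫ g) := by
  obtain ⟨-, -, U, V, _, i, p, a, b, -, hip, hi, -⟩ := hf
  obtain ⟨-, -, V', W, _, j, q, b', c, -, hjq, hj, -⟩ := hg
  -- Lift the isomorphism between the two models `V'` and `V` of `Y` to a map `t : V' ⟶ T φ V`.
  obtain ⟨φ, t, ht⟩ := R.exists_map L (b'.inv ≫ b.hom)
  obtain ⟨P, k, j', sq, hj'⟩ := hE.pushout j t ⟨_, _, hjq⟩
  have : IsIso (L.map t) := by rw [ht]; infer_instance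
  have : IsIso (L.map k) := (R.map_isPushout L sq).flip.isIso_inr_of_isIso
  obtain ⟨Q, r, hr⟩ := hE.admMono_comp _ _ ⟨_, _, hT φ _ _ hip⟩ hj'
  let a₁ := a ≪≫ asIso (L.map ((R.η φ).app U))
  let c₁ := c ≪≫ asIso (L.map k)
  have hf : f ≫ b.hom ≫ L.map ((R.η φ).app V) = a₁.hom ≫ L.map ((R.T φ).map i) := by
    simp only [reassoc_of% hi, a₁, Iso.trans_hom, asIso_hom, Category.assoc, ← L.map_comp,
      Reindexing.η_naturality]
  have hg : g ≫ c₁.hom = b.hom ≫ L.map ((R.η φ).app V) ≫ L.map j' := by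
    have := congrArg L.map sq.w
    simp only [Functor.map_comp] at this
    simp [c₁, reassoc_of% hj, this, ht]
  refine SeqClass.isAdmMono_map_of_iso a₁.symm c₁.symm ?_ ⟨_, _, SeqClass.map_map hr⟩
  rw [← cancel_epi a₁.hom, ← cancel_mono c₁.hom]
  simp [hg, ← reassoc_of% hf]

/-- The kernel half of the axioms is the cokernel half for the opposite localization, which needs
its own calculus of fractions `R'`. -/
theorem isKellerExact_map [HasFiniteBiproducts C]
    (hT : ∀ φ ⦃X Y Z : C⦄ (f : X ⟶ Y) (g : Y ⟶ Z), E f g → E ((R.T φ).map f) ((R.T φ).map g))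
    (R' : Reindexing Cᵒᵖ) [L.op.IsLocalization R'.W]
    (hT' : ∀ φ ⦃X Y Z : Cᵒᵖ⦄ (f : X ⟶ Y) (g : Y ⟶ Z),
      E.op f g → E.op ((R'.T φ).map f) ((R'.T φ).map g)) :
    IsKellerExact (E.map L) := by
  have map_op : E.op.map L.op = (E.map L).op := by
    ext
    exact SeqClass.map_op
  have := Localization.essSurj L R.W
  exact {
    comp_zero := fun _ _ _ _ _ h => comp_zero_of_map L hE h
    isKernel := fun X Y Z f g h w => by
      obtain ⟨hc⟩ := isCokernel_of_map L.op hE.op R' (f := g.op) (g := f.op) (map_op ▸ h)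
        (congrArg Quiver.Hom.op w)
      exact ⟨CokernelCofork.IsColimit.ofπUnop _ _ hc⟩
    isCokernel := fun _ _ _ _ _ => isCokernel_of_map L hE R
    of_iso := fun _ _ _ _ _ _ _ _ _ _ => SeqClass.map_of_iso
    split := fun _ _ => map_split L hE
    admMono_comp := fun _ _ _ => admMono_comp_map L hE R hT
    admEpi_comp := fun _ _ _ f g hf hg =>
      IsAdmMono.unop (map_op ▸ admMono_comp_map L.op hE.op R' hT' g.op f.op (map_op ▸ hg.op)
        (map_op ▸ hf.op))
    pushout := fun _ _ _ => pushout_map L hE R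
    pullback := fun _ _ _ g h hg => by
      obtain ⟨_, _, _, sq, hg'⟩ := pushout_map L.op hE.op R' g.op h.op (map_op ▸ hg.op)
      exact ⟨_, _, _, sq.unop.flip, IsAdmMono.unop (map_op ▸ hg')⟩ }

end MapExact

/-! ### The exact structure of the Beilinson category -/

lemma Reindexing.isLocalization_of_le {C D : Type*} [Category* C] [Category* D] (R : Reindexing C)
    (L : C ⥤ D) (V : MorphismProperty C) [L.IsLocalization V] (hV : V ≤ R.W)
    (hη : ∀ φ X, V ((R.η φ).app X)) : L.IsLocalization R.W :=
  Functor.IsLocalization.of_equivalence_source L V L R.W CategoryTheory.Equivalence.refl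
    (fun _ _ _ hf => R.W.le_isoClosure _ (hV _ hf))
    (R.isInvertedBy _ fun φ X => Localization.inverts L V _ (hη φ X)) L.leftUnitor

namespace Bicofinal

/-- The identity of `ℤ`. -/
protected def id : Bicofinal := ⟨fun i => i, monotone_id, Filter.tendsto_id, Filter.tendsto_id⟩

/-- The composition of bicofinal maps. -/
def comp (φ ψ : Bicofinal) : Bicofinal :=
  ⟨fun i => φ.toFun (ψ.toFun i), φ.monotone.comp ψ.monotone, φ.tendsto_top.comp ψ.tendsto_top,
    φ.tendsto_bot.comp ψ.tendsto_bot⟩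

/-- The maximum of bicofinal maps, an upper bound for two reindexings. -/
protected def max (φ ψ : Bicofinal) : Bicofinal where
  toFun i := max (φ.toFun i) (ψ.toFun i)
  monotone _ _ h := max_le_max (φ.monotone h) (ψ.monotone h)
  tendsto_top := Filter.tendsto_atTop_mono (fun _ => le_max_left _ _) φ.tendsto_top
  tendsto_bot := Filter.tendsto_atBot.2 fun b => by
    filter_upwards [Filter.tendsto_atBot.1 φ.tendsto_bot b, Filter.tendsto_atBot.1 ψ.tendsto_bot b]
      with i h₁ h₂ using max_le h₁ h₂

/-- The conjugate `i ↦ -φ (-i)` of a bicofinal map, which exchanges the two ends of `ℤ`. -/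
def neg (φ : Bicofinal) : Bicofinal where
  toFun i := -φ.toFun (-i)
  monotone _ _ h := neg_le_neg (φ.monotone (neg_le_neg h))
  tendsto_top := Filter.tendsto_neg_atBot_atTop.comp
    (φ.tendsto_bot.comp Filter.tendsto_neg_atTop_atBot)
  tendsto_bot := Filter.tendsto_neg_atTop_atBot.comp
    (φ.tendsto_top.comp Filter.tendsto_neg_atBot_atTop)

lemma exists_le (φ : Bicofinal) (b : ℤ) : ∃ i, φ.toFun i ≤ b :=
  (Filter.tendsto_atBot.1 φ.tendsto_bot b).exists

lemma exists_ge (φ : Bicofinal) (b : ℤ) : ∃ i, b ≤ φ.toFun i :=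
  (Filter.tendsto_atTop.1 φ.tendsto_top b).exists

lemma exists_le_comp (φ ψ : Bicofinal) :
    ∃ θ : Bicofinal, (∀ i, i ≤ θ.toFun i) ∧ ∀ i, ψ.toFun i ≤ φ.toFun (θ.toFun i) := by
  have exists_least (i : ℤ) : ∃ k, ψ.toFun i ≤ φ.toFun k ∧ ∀ l, ψ.toFun i ≤ φ.toFun l → k ≤ l := by
    obtain ⟨n, hn⟩ := φ.exists_le (ψ.toFun i - 1)
    refine Int.exists_least_of_bdd ⟨n, fun z hz => ?_⟩ (φ.exists_ge _)
    by_contra! hc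
    have := φ.monotone hc.le
    lia
  choose k hk hk_least using exists_least
  have hk_mono : Monotone k := fun i j h => hk_least _ _ ((ψ.monotone h).trans (hk j))
  refine ⟨⟨fun i => max i (k i), fun i j h => max_le_max h (hk_mono h),
    Filter.tendsto_atTop_mono (fun _ => le_max_left _ _) Filter.tendsto_id,
    Filter.tendsto_atBot.2 fun b => ?_⟩,
    fun _ => le_max_left _ _, fun i => (hk i).trans (φ.monotone (le_max_right _ _))⟩
  filter_upwards [Filter.eventually_le_atBot b,
    Filter.tendsto_atBot.1 ψ.tendsto_bot (φ.toFun b)] with i h₁ h₂ using max_le h₁ (hk_least _ _ h₂)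

lemma exists_comp_le (φ ψ : Bicofinal) :
    ∃ θ : Bicofinal, (∀ i, θ.toFun i ≤ i) ∧ ∀ i, φ.toFun (θ.toFun i) ≤ ψ.toFun i := by
  obtain ⟨θ, h₁, h₂⟩ := φ.neg.exists_le_comp ψ.neg
  refine ⟨θ.neg, fun i => neg_le.1 (h₁ (-i)), fun i => ?_⟩
  simpa [neg] using h₂ (-i)

end Bicofinal

section Reindex

variable {A : Type u} [Category.{v} A] (E : SeqClass A)

/-- Reindexing, as an endofunctor of the category of admissible functors. -/
def reindexFunctor (φ : Bicofinal) : AdmFun E ⥤ AdmFun E where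
  obj X := X.reindex φ
  map f := ObjectProperty.homMk (Functor.whiskerLeft φ.tilde f.hom)

/-- The reindexings along the bicofinal maps `φ ≥ id`. -/
def admReindexing : Reindexing (AdmFun E) where
  ι := { φ : Bicofinal // ∀ i, i ≤ φ.toFun i }
  nonempty := ⟨⟨Bicofinal.id, fun _ => le_rfl⟩⟩
  T φ := reindexFunctor E φ.1
  η φ :=
    { app X := X.reindexMap (φ := Bicofinal.id) φ.2
      naturality X Y f := by
        ext p
        exact (f.hom.naturality _).symm }
  map_η φ X := by
    ext p
    rfl
  comp φ ψ := ⟨⟨φ.1.comp ψ.1, fun i => (ψ.2 i).trans (φ.2 _)⟩, 𝟙 (reindexFunctor E (φ.1.comp ψ.1)),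
    fun X => by
      ext p
      exact (congrArg _ (Category.comp_id _)).trans (X.obj.map_comp _ _).symm⟩

/-- The reindexings along the bicofinal maps `φ ≤ id`, which are copointed, whence the opposite
category. -/
def admReindexingOp : Reindexing (AdmFun E)ᵒᵖ where
  ι := { φ : Bicofinal // ∀ i, φ.toFun i ≤ i }
  nonempty := ⟨⟨Bicofinal.id, fun _ => le_rfl⟩⟩
  T φ := (reindexFunctor E φ.1).op
  η φ :=
    { app X := (X.unop.reindexMap (ψ := Bicofinal.id) φ.2).op
      naturality X Y f := Quiver.Hom.unop_inj (by
        ext p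
        exact f.unop.hom.naturality _) }
  map_η φ X := Quiver.Hom.unop_inj (by
    ext p
    rfl)
  comp φ ψ := ⟨⟨φ.1.comp ψ.1, fun i => (φ.2 _).trans (ψ.2 i)⟩,
    𝟙 (reindexFunctor E (φ.1.comp ψ.1)).op, fun X => Quiver.Hom.unop_inj (by
      ext p
      exact (congrArg (· ≫ _) (Category.id_comp _)).trans (X.unop.obj.map_comp _ _).symm)⟩

instance isLocalization_toBeilinson : (toBeilinson E).IsLocalization (admReindexing E).W := by
  refine (admReindexing E).isLocalization_of_le _ (reindexMaps E) ?_
    fun φ X => reindexMaps.mk X (φ := Bicofinal.id) φ.2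
  rintro _ _ _ ⟨X, h⟩
  rename_i φ ψ
  obtain ⟨θ, hθ, hφθ⟩ := φ.exists_le_comp ψ
  refine ⟨⟨θ, hθ⟩, X.reindexMap (φ := ψ) (ψ := φ.comp θ) hφθ, ?_, ?_⟩
  all_goals
    ext p
    exact (X.obj.map_comp _ _).symm

instance isLocalization_toBeilinson_op :
    (toBeilinson E).op.IsLocalization (admReindexingOp E).W := by
  refine (admReindexingOp E).isLocalization_of_le _ (reindexMaps E).op ?_
    fun φ X => reindexMaps.mk X.unop (ψ := Bicofinal.id) φ.2
  rintro ⟨_⟩ ⟨_⟩ ⟨_⟩ ⟨X, h⟩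
  rename_i φ ψ
  obtain ⟨θ, hθ, hψθ⟩ := ψ.exists_comp_le φ
  refine ⟨⟨θ, hθ⟩, (X.reindexMap (φ := ψ.comp θ) (ψ := φ) hψθ).op, ?_, ?_⟩
  all_goals
    refine Quiver.Hom.unop_inj ?_
    ext p
    exact (X.obj.map_comp _ _).symm

instance isIso_toBeilinson_reindexMap {X : AdmFun E} {φ ψ : Bicofinal}
    (h : ∀ i, φ.toFun i ≤ ψ.toFun i) : IsIso ((toBeilinson E).map (X.reindexMap h)) :=
  Localization.inverts (toBeilinson E) (reindexMaps E) _ (reindexMaps.mk X h)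

def reindexIso (X : AdmFun E) (φ : Bicofinal) :
    (toBeilinson E).obj (X.reindex φ) ≅ (toBeilinson E).obj X :=
  Localization.isoOfHom (toBeilinson E) (reindexMaps E) _
    (reindexMaps.mk X (φ := φ) (ψ := φ.max Bicofinal.id) fun _ => le_max_left _ _) ≪≫
  (Localization.isoOfHom (toBeilinson E) (reindexMaps E) _
    (reindexMaps.mk X (φ := Bicofinal.id) (ψ := φ.max Bicofinal.id)
      fun _ => le_max_right _ _)).symm

end Reindex

section LevelwiseExact

variable {A : Type u} [Category.{v} A] {E : SeqClass A}

variable (E) in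
/-- The sequences of admissible functors which are admissible in every component. -/
abbrev levelSeq : SeqClass (AdmFun E) := (pointwiseSeq Pairs E).induced (IsAdmissible E).ι

variable [Preadditive A] (hE : IsExactStructure E)

include hE

lemma IsExactStructure.isZero_mid {X Y Z : A} {f : X ⟶ Y} {g : Y ⟶ Z} (h : E f g)
    (hX : IsZero X) (hZ : IsZero Z) : IsZero Y := by
  obtain ⟨l, hl⟩ := hE.isKellerExact.exists_lift h (𝟙 Y) (hZ.eq_of_tgt _ _)
  rw [IsZero.iff_id_eq_zero, ← hl, hX.eq_of_tgt l 0, zero_comp]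

lemma IsAdmissible.isZero_diag {X : Pairs ⥤ A} (hX : IsAdmissible E X) (i : ℤ) :
    IsZero (X.obj (pr i i le_rfl)) := by
  have h := hE.comp_zero _ _ (hX i i i le_rfl le_rfl)
  rw [← X.map_comp] at h
  rw [IsZero.iff_id_eq_zero, ← X.map_id]
  exact h

lemma IsAdmissible.of_extension {X Y Z : Pairs ⥤ A} {f : X ⟶ Y} {g : Y ⟶ Z}
    (h : pointwiseSeq Pairs E f g) (hX : IsAdmissible E X) (hZ : IsAdmissible E Z) :
    IsAdmissible E Y := by
  intro i j k hij hjk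
  refine hE.middle_column_of_three_by_three (h _) (h _) (h _) (hX i j k hij hjk)
    (hZ i j k hij hjk) ?_ (f.naturality _).symm (g.naturality _).symm (f.naturality _).symm
    (g.naturality _).symm
  have isZero_diag : IsZero (Y.obj (pr j j le_rfl)) :=
    hE.isZero_mid (h _) (hX.isZero_diag hE j) (hZ.isZero_diag hE j)
  calc Y.map (prHom le_rfl hjk : pr i j hij ⟶ pr i k (hij.trans hjk)) ≫
      Y.map (prHom hij le_rfl : pr i k (hij.trans hjk) ⟶ pr j k hjk)
    _ = Y.map (prHom hij le_rfl : pr i j hij ⟶ pr j j le_rfl) ≫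
        Y.map (prHom le_rfl hjk : pr j j le_rfl ⟶ pr j k hjk) := by
      rw [← Y.map_comp, ← Y.map_comp]
      rfl
    _ = 0 := by rw [isZero_diag.eq_of_tgt (Y.map _) 0, zero_comp]

lemma closedUnderExtensions_isAdmissible_ι :
    ClosedUnderExtensions (pointwiseSeq Pairs E) (IsAdmissible E).ι := by
  rintro X Y Z f g h ⟨X', ⟨a⟩⟩ ⟨Z', ⟨c⟩⟩
  have h' : pointwiseSeq Pairs E (a.hom ≫ f) (g ≫ c.inv) := fun p =>
    hE.of_iso _ _ _ _ (a.symm.app p) (Iso.refl _) (c.symm.app p) (by simp) (by simp) (h p)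
  exact ⟨⟨Y, IsAdmissible.of_extension hE h' X'.property Z'.property⟩, ⟨Iso.refl _⟩⟩

lemma isAdmissible_of_isZero {X : Pairs ⥤ A} (hX : ∀ p, IsZero (X.obj p)) :
    IsAdmissible E X := fun i j k hij _ =>
  hE.of_iso _ _ _ _ (Iso.refl _) (Iso.refl _) ((hX _).iso (hX _)) ((hX _).eq_of_src _ _)
    ((hX _).eq_of_src _ _) (hE.of_isZero_left (hX (pr i j hij)) (Y := X.obj (pr i k _)) 0)

variable [HasFiniteBiproducts A]

lemma isExactStructure_pointwiseSeq : IsExactStructure (pointwiseSeq Pairs E) :=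
  have : HasFiniteBiproducts (Pairs ⥤ A) := HasFiniteBiproducts.of_hasFiniteProducts
  have := hasBinaryBiproducts_of_finite_biproducts (Pairs ⥤ A)
  (isKellerExact_pointwiseSeq hE.isKellerExact).isExactStructure

lemma hasFiniteBiproducts_admFun : HasFiniteBiproducts (AdmFun E) :=
  have : HasFiniteBiproducts (Pairs ⥤ A) := HasFiniteBiproducts.of_hasFiniteProducts
  hasFiniteBiproducts_of_closedUnderExtensions (isExactStructure_pointwiseSeq hE)
    (closedUnderExtensions_isAdmissible_ι hE)
    (O := ⟨0, isAdmissible_of_isZero hE fun p => (isZero_zero _).obj p⟩) (isZero_zero (Pairs ⥤ A))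

lemma isKellerExact_levelSeq : IsKellerExact (levelSeq E) :=
  isKellerExact_induced (isExactStructure_pointwiseSeq hE) (closedUnderExtensions_isAdmissible_ι hE)

end LevelwiseExact

section BeilinsonExact

variable {A : Type u} [Category.{v} A] [Preadditive A] {E : SeqClass A}

instance : Preadditive (Beilinson E) :=
  Localization.preadditive (toBeilinson E) (admReindexing E).W

instance : (toBeilinson E).Additive :=
  Localization.functor_additive (toBeilinson E) (admReindexing E).W

instance : (toBeilinson E).EssSurj :=
  Localization.essSurj (toBeilinson E) (admReindexing E).W

variable [HasFiniteBiproducts A] (hE : IsExactStructure E)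

include hE

lemma hasFiniteBiproducts_beilinson : HasFiniteBiproducts (Beilinson E) :=
  have := hasFiniteBiproducts_admFun hE
  hasFiniteBiproducts_of_essSurj (toBeilinson E)

lemma isKellerExact_beilinsonSeq : IsKellerExact (beilinsonSeq E) :=
  have := hasFiniteBiproducts_admFun hE
  isKellerExact_map (toBeilinson E) (isKellerExact_levelSeq hE)
    (admReindexing E) (fun _ _ _ _ _ _ h _ => h _)
    (admReindexingOp E) (fun _ _ _ _ _ _ h _ => h _)

theorem isExactStructure_beilinsonSeq : IsExactStructure (beilinsonSeq E) :=
  have := hasFiniteBiproducts_beilinson hE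
  have := hasBinaryBiproducts_of_finite_biproducts (Beilinson E)
  (isKellerExact_beilinsonSeq hE).isExactStructure

end BeilinsonExact

/-! ### Duality -/

section SeqClassTransport

variable {C C' D D' : Type*} [Category C] [Category C'] [Category D] [Category D']

lemma SeqClass.map_iff_of_fullyFaithful {E : SeqClass C} {L : C ⥤ D} {L' : C ⥤ D'} {K : D ⥤ D'}
    [K.Full] [K.Faithful] (e : L ⋙ K ≅ L') {X Y Z : D} {f : X ⟶ Y} {g : Y ⟶ Z} :
    E.map L' (K.map f) (K.map g) ↔ E.map L f g := by
  constructor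
  · rintro ⟨X', Y', Z', f', g', a, b, c, h, hf, hg⟩
    refine ⟨X', Y', Z', f', g', K.preimageIso (a ≪≫ (e.app X').symm),
      K.preimageIso (b ≪≫ (e.app Y').symm), K.preimageIso (c ≪≫ (e.app Z').symm), h, ?_, ?_⟩
    · exact K.map_injective (by simp [reassoc_of% hf])
    · exact K.map_injective (by simp [reassoc_of% hg])
  · rintro ⟨X', Y', Z', f', g', a, b, c, h, hf, hg⟩
    have map_w {U V : D} {U' V' : C} {k : U ⟶ V} {k' : U' ⟶ V'} {s : U ≅ L.obj U'}
        {t : V ≅ L.obj V'} (w : k ≫ t.hom = s.hom ≫ L.map k') :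
        K.map k ≫ (K.mapIso t ≪≫ e.app V').hom = (K.mapIso s ≪≫ e.app U').hom ≫ L'.map k' := by
      have w' := congrArg K.map w
      rw [K.map_comp, K.map_comp] at w'
      simpa [reassoc_of% w'] using congrArg (K.map s.hom ≫ ·) (e.hom.naturality k')
    exact ⟨X', Y', Z', f', g', K.mapIso a ≪≫ e.app X', K.mapIso b ≪≫ e.app Y',
      K.mapIso c ≪≫ e.app Z', h, map_w hf, map_w hg⟩

lemma SeqClass.map_comp_iff_of_isEquivalence {E : SeqClass C} {E' : SeqClass C'} {K : C ⥤ C'}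
    {L : C' ⥤ D} [K.IsEquivalence] (hE' : ∀ ⦃X Y Z X' Y' Z' : C'⦄ (f : X ⟶ Y) (g : Y ⟶ Z)
      (f' : X' ⟶ Y') (g' : Y' ⟶ Z') (a : X ≅ X') (b : Y ≅ Y') (c : Z ≅ Z'),
      f ≫ b.hom = a.hom ≫ f' → g ≫ c.hom = b.hom ≫ g' → E' f g → E' f' g')
    (hK : ∀ ⦃X Y Z : C⦄ (f : X ⟶ Y) (g : Y ⟶ Z), E f g ↔ E' (K.map f) (K.map g))
    {X Y Z : D} {f : X ⟶ Y} {g : Y ⟶ Z} : E.map (K ⋙ L) f g ↔ E'.map L f g := by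
  constructor
  · rintro ⟨X', Y', Z', f', g', a, b, c, h, hf, hg⟩
    exact ⟨_, _, _, _, _, a, b, c, (hK _ _).1 h, hf, hg⟩
  · rintro ⟨X', Y', Z', f', g', a, b, c, h, hf, hg⟩
    let δ (T : C') := K.objObjPreimageIso T
    refine ⟨_, _, _, K.preimage ((δ X').hom ≫ f' ≫ (δ Y').inv),
      K.preimage ((δ Y').hom ≫ g' ≫ (δ Z').inv), a ≪≫ L.mapIso (δ X').symm,
      b ≪≫ L.mapIso (δ Y').symm, c ≪≫ L.mapIso (δ Z').symm, (hK _ _).2 ?_, ?_, ?_⟩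
    · exact hE' f' g' _ _ (δ X').symm (δ Y').symm (δ Z').symm (by simp) (by simp) h
    · simp [reassoc_of% hf]
    · simp [reassoc_of% hg]

end SeqClassTransport

section Duality

def pairsNegCompLeftOpIso : pairsNeg ⋙ pairsNeg.leftOp ≅ 𝟭 Pairs :=
  NatIso.ofComponents fun _ => eqToIso (Subtype.ext (Prod.ext (neg_neg _) (neg_neg _)))

instance : pairsNeg.IsEquivalence where
  full := ⟨fun {p q} f =>
    ⟨(pairsNegCompLeftOpIso.inv.app p ≫ (pairsNeg.map f.unop).unop ≫
      pairsNegCompLeftOpIso.hom.app q), rfl⟩⟩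
  essSurj := ⟨fun p => ⟨_, ⟨(pairsNegCompLeftOpIso.app p.unop).op.symm⟩⟩⟩

lemma Bicofinal.neg_neg (φ : Bicofinal) : φ.neg.neg = φ := by
  cases φ
  simp only [neg, _root_.neg_neg]

def pairsNegTildeIso (φ : Bicofinal) : pairsNeg ⋙ φ.tilde.op ≅ φ.neg.tilde ⋙ pairsNeg :=
  NatIso.ofComponents fun _ => (eqToIso (Subtype.ext (Prod.ext (neg_neg _) (neg_neg _)))).op

variable {A : Type u} [Category.{v} A] {E : SeqClass A}

variable (E) in
/-- The right-hand side is a fully faithful functor, as it makes sense for all functors and is then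
an equivalence. -/
def dualizeCompιIso : dualize E ⋙ (IsAdmissible E).ι ≅ (IsAdmissible E.op).ι.op ⋙
    (Functor.leftOpRightOpEquiv Pairs A).inverse.leftOp ⋙
      (Functor.whiskeringLeft _ _ A).obj pairsNeg :=
  Iso.refl _

variable (E) in
def fullyFaithfulDualize : (dualize E).FullyFaithful :=
  .ofCompFaithful ((Functor.FullyFaithful.ofFullyFaithful _).ofIso (dualizeCompιIso E).symm)

instance : (dualize E).Full := (fullyFaithfulDualize E).full
instance : (dualize E).Faithful := (fullyFaithfulDualize E).faithful

instance : (dualize E).EssSurj where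
  mem_essImage Y := by
    let X : AdmFun E.op := ⟨pairsNeg ⋙ Y.obj.op, fun i j k hij hjk =>
      Y.property (-k) (-j) (-i) (neg_le_neg hjk) (neg_le_neg hij)⟩
    exact ⟨op X, ⟨(IsAdmissible E).isoMk (Functor.isoWhiskerRight pairsNegCompLeftOpIso Y.obj)⟩⟩

instance : (dualize E).IsEquivalence where

def dualizeReindexIso (X : AdmFun E.op) (φ : Bicofinal) :
    (dualize E).obj (op (X.reindex φ)) ≅ ((dualize E).obj (op X)).reindex φ.neg :=
  (IsAdmissible E).isoMk (Functor.isoWhiskerRight (pairsNegTildeIso φ) X.obj.leftOp)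

def dualizeReindexMapIso (X : AdmFun E.op) {φ ψ : Bicofinal} (h : ∀ i, φ.toFun i ≤ ψ.toFun i) :
    Arrow.mk ((dualize E).map (X.reindexMap h).op) ≅
      Arrow.mk (((dualize E).obj (op X)).reindexMap (φ := ψ.neg) (ψ := φ.neg)
        fun _ => neg_le_neg (h _)) :=
  Arrow.isoMk (dualizeReindexIso X ψ) (dualizeReindexIso X φ) (by
    ext p
    exact (X.obj.leftOp.map_comp _ _).symm.trans (X.obj.leftOp.map_comp
      ((Bicofinal.tildeMap h).app (pairsNeg.obj p).unop).op ((pairsNegTildeIso φ).hom.app p)))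

def reindexMapIso {Y Y' : AdmFun E} (e : Y ≅ Y') {φ ψ : Bicofinal}
    (h : ∀ i, φ.toFun i ≤ ψ.toFun i) : Arrow.mk (Y.reindexMap h) ≅ Arrow.mk (Y'.reindexMap h) :=
  Arrow.isoMk ((reindexFunctor E φ).mapIso e) ((reindexFunctor E ψ).mapIso e) (by
    ext p
    exact (e.hom.hom.naturality _).symm)

lemma isInvertedBy_dualize_comp_toBeilinson :
    (reindexMaps E.op).op.IsInvertedBy (dualize E ⋙ toBeilinson E) := by
  rintro ⟨_⟩ ⟨_⟩ f hf
  obtain ⟨f, rfl⟩ : ∃ g, f = Quiver.Hom.op g := ⟨f.unop, rfl⟩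
  obtain ⟨X, h⟩ := hf
  exact ((MorphismProperty.isomorphisms _).arrow_mk_iso_iff
    ((toBeilinson E).mapArrow.mapIso (dualizeReindexMapIso X h))).2
      (isIso_toBeilinson_reindexMap E _)

lemma exists_dualize_reindexMap_iso (Y : AdmFun E) {φ ψ : Bicofinal}
    (h : ∀ i, φ.toFun i ≤ ψ.toFun i) : ∃ (U V : AdmFun E.op) (f : U ⟶ V), reindexMaps E.op f ∧
      Nonempty (Arrow.mk ((dualize E).map f.op) ≅ Arrow.mk (Y.reindexMap h)) := by
  obtain ⟨φ, rfl⟩ : ∃ φ', φ = Bicofinal.neg φ' := ⟨_, φ.neg_neg.symm⟩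
  obtain ⟨ψ, rfl⟩ : ∃ ψ', ψ = Bicofinal.neg ψ' := ⟨_, ψ.neg_neg.symm⟩
  have h' (i) : ψ.toFun i ≤ φ.toFun i := by simpa [Bicofinal.neg] using h (-i)
  exact ⟨_, _, _, reindexMaps.mk ((dualize E).objPreimage Y).unop h', ⟨dualizeReindexMapIso _ h' ≪≫
    reindexMapIso ((dualize E).objObjPreimageIso Y) h⟩⟩

instance : (dualize E ⋙ toBeilinson E).IsLocalization (reindexMaps E.op).op := by
  let D := (dualize E).asEquivalence
  refine Functor.IsLocalization.of_equivalence_source (toBeilinson E) (reindexMaps E)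
    (dualize E ⋙ toBeilinson E) (reindexMaps E.op).op D.symm ?_
    isInvertedBy_dualize_comp_toBeilinson
    (Functor.isoWhiskerRight D.counitIso (toBeilinson E) ≪≫ Functor.leftUnitor _)
  rintro _ _ _ ⟨Y, h⟩
  obtain ⟨U, V, f, hf, ⟨e⟩⟩ := exists_dualize_reindexMap_iso Y h
  let i : Arrow.mk f.op ≅ Arrow.mk (D.inverse.map (D.functor.map f.op)) :=
    Arrow.isoMk (D.unitIso.app _) (D.unitIso.app _) (D.unitIso.hom.naturality _).symm
  exact ((reindexMaps E.op).op.isoClosure.arrow_mk_iso_iff (i ≪≫ D.inverse.mapArrow.mapIso e)).1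
    ((reindexMaps E.op).op.le_isoClosure _ hf)

variable (E) in
/-- The duality of Beilinson categories induced by `dualize E`, through the universal property of
the localizations. -/
def beilinsonDuality : (Beilinson E.op)ᵒᵖ ≌ Beilinson E :=
  Localization.uniq (toBeilinson E.op).op (dualize E ⋙ toBeilinson E) (reindexMaps E.op).op

variable (E) in
def beilinsonDualityIso : (toBeilinson E.op).op ⋙ (beilinsonDuality E).functor ≅
    dualize E ⋙ toBeilinson E :=
  Localization.compUniqFunctor _ _ _

lemma levelSeq_dualize_iff {X Y Z : (AdmFun E.op)ᵒᵖ} (f : X ⟶ Y) (g : Y ⟶ Z) :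
    (levelSeq E.op).op f g ↔ levelSeq E ((dualize E).map f) ((dualize E).map g) := by
  refine ⟨fun h p => h (pairsNeg.obj p).unop, fun h p => ?_⟩
  obtain ⟨p, rfl⟩ : ∃ p', p = (pairsNeg.obj p').unop :=
    ⟨(pairsNeg.obj p).unop, Subtype.ext (Prod.ext (neg_neg _).symm (neg_neg _).symm)⟩
  exact h p

variable [Preadditive A] (hE : IsExactStructure E)

include hE

lemma beilinsonSeq_op_iff {X Y Z : (Beilinson E.op)ᵒᵖ} {f : X ⟶ Y} {g : Y ⟶ Z} :
    (beilinsonSeq E.op).op f g ↔ beilinsonSeq E ((beilinsonDuality E).functor.map f)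
      ((beilinsonDuality E).functor.map g) :=
  SeqClass.map_op.symm.trans <|
    (SeqClass.map_iff_of_fullyFaithful (beilinsonDualityIso E)).symm.trans <|
      SeqClass.map_comp_iff_of_isEquivalence (fun _ _ _ _ _ _ _ _ _ _ a b c hf hg h p =>
        hE.of_iso _ _ _ _ (((IsAdmissible E).ι ⋙ (evaluation _ _).obj p).mapIso a)
          (((IsAdmissible E).ι ⋙ (evaluation _ _).obj p).mapIso b)
          (((IsAdmissible E).ι ⋙ (evaluation _ _).obj p).mapIso c)
          (congrArg (fun k => k.hom.app p) hf) (congrArg (fun k => k.hom.app p) hg) (h p))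
        fun _ _ _ => levelSeq_dualize_iff

lemma beilinsonSeq_inverse {X Y Z : Beilinson E} {f : X ⟶ Y} {g : Y ⟶ Z}
    (h : beilinsonSeq E f g) : (beilinsonSeq E.op).op ((beilinsonDuality E).inverse.map f)
      ((beilinsonDuality E).inverse.map g) :=
  (beilinsonSeq_op_iff hE).2 <| SeqClass.map_of_iso ((beilinsonDuality E).counitIso.symm.app X)
    ((beilinsonDuality E).counitIso.symm.app Y) ((beilinsonDuality E).counitIso.symm.app Z)
    ((beilinsonDuality E).counitIso.inv.naturality f)
    ((beilinsonDuality E).counitIso.inv.naturality g) h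

end Duality

/-! ### Formal colimits of systems -/

section IndLim

variable {A : Type u} [Category.{v} A]

/-- In `Ind A`, the objects of `A` are finitely presentable. -/
instance preservesColimitsOfShape_coyoneda_indYoneda (X : A) (I : Type v) [SmallCategory I]
    [IsFiltered I] :
    PreservesColimitsOfShape I (coyoneda.obj (op ((Ind.yoneda (C := A)).obj X))) := by
  let e : coyoneda.obj (op ((Ind.yoneda (C := A)).obj X)) ≅
      Ind.inclusion A ⋙ (evaluation _ _).obj (op X) :=
    NatIso.ofComponents (fun P => (((Ind.inclusion.fullyFaithful (C := A)).homEquiv).trans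
      (((Ind.yonedaCompInclusion.app X).homFromEquiv).trans yonedaEquiv)).toIso)
      (fun {P Q} f => by
        ext g
        simp [yonedaEquiv, Iso.homFromEquiv])
  exact preservesColimitsOfShape_of_natIso e.symm

instance : (natDown.{v}).IsEquivalence where
  faithful := ⟨fun _ => Subsingleton.elim _ _⟩
  full := ⟨fun {n m} f => ⟨homOfLE (show n.down ≤ m.down from leOfHom f), Subsingleton.elim _ _⟩⟩
  essSurj := ⟨fun n => ⟨⟨n⟩, ⟨Iso.refl _⟩⟩⟩

lemma exists_orderHom_ge (k : ℕ → ℕ) : ∃ φ : ℕ →o ℕ, (∀ n, n ≤ φ n) ∧ ∀ n, k n ≤ φ n :=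
  ⟨OrderHom.id ⊔ partialSups k, fun _ => le_sup_left,
    fun n => (le_partialSups k n).trans le_sup_right⟩

variable {E : SeqClass A}

/-- The map from a term of a system to the formal colimit. -/
def indι (S : IndSys E) (n : ℕ) :
    Ind.yoneda.obj (S.obj.obj n) ⟶ ((indLim E).obj S).obj :=
  colimit.ι ((natDown ⋙ S.obj) ⋙ Ind.yoneda) ⟨n⟩

lemma indι_w (S : IndSys E) {n m : ℕ} (f : n ⟶ m) :
    Ind.yoneda.map (S.obj.map f) ≫ indι S m = indι S n :=
  colimit.w ((natDown ⋙ S.obj) ⋙ Ind.yoneda) (j := ⟨m⟩) (j' := ⟨n⟩)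
    (homOfLE (show n ≤ m from leOfHom f))

lemma indι_map {S S' : IndSys E} (a : S ⟶ S') (n : ℕ) :
    indι S n ≫ ((indLim E).map a).hom = Ind.yoneda.map (a.hom.app n) ≫ indι S' n :=
  ι_colimMap (Functor.whiskerRight (Functor.whiskerLeft natDown a.hom) Ind.yoneda) ⟨n⟩

lemma indLim_hom_ext {S : IndSys E} {P : IndAdm E} {f g : (indLim E).obj S ⟶ P}
    (h : ∀ n, indι S n ≫ f.hom = indι S n ≫ g.hom) : f = g := by
  ext1
  exact colimit.hom_ext fun n => h n.down

lemma exists_indι_comp_eq (S : IndSys E) {P : IndAdm E}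
    (f : ∀ n, Ind.yoneda.obj (S.obj.obj n) ⟶ P.obj)
    (hf : ∀ {n m} (a : n ⟶ m), Ind.yoneda.map (S.obj.map a) ≫ f m = f n) :
    ∃ g : (indLim E).obj S ⟶ P, ∀ n, indι S n ≫ g.hom = f n :=
  ⟨ObjectProperty.homMk (colimit.desc ((natDown ⋙ S.obj) ⋙ Ind.yoneda)
    { pt := P.obj
      ι := { app := fun n => f n.down
             naturality := fun _ _ a => (hf (natDown.map a)).trans (Category.comp_id _).symm } }),
    fun _ => colimit.ι_desc _ _⟩

lemma exists_eq_comp_indι {X : A} (S : IndSys E)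
    (f : Ind.yoneda.obj X ⟶ ((indLim E).obj S).obj) :
    ∃ (n : ℕ) (g : X ⟶ S.obj.obj n), f = Ind.yoneda.map g ≫ indι S n := by
  obtain ⟨n, g, hg⟩ := Types.jointly_surjective_of_isColimit
    (isColimitOfPreserves (coyoneda.obj (op (Ind.yoneda.obj X)))
      (colimit.isColimit ((natDown ⋙ S.obj) ⋙ Ind.yoneda))) f
  obtain ⟨g, rfl⟩ := Ind.yoneda.map_surjective g
  exact ⟨n.down, g, hg.symm⟩

lemma indι_cancel (hE : ∀ ⦃X Y : A⦄ (f : X ⟶ Y), IsAdmMono E f → Mono f)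
    {X : A} (S : IndSys E) {n : ℕ} {a b : X ⟶ S.obj.obj n}
    (h : Ind.yoneda.map a ≫ indι S n = Ind.yoneda.map b ≫ indι S n) : a = b := by
  obtain ⟨k, f, g, e⟩ := (Types.FilteredColimit.isColimit_eq_iff _
    (isColimitOfPreserves (coyoneda.obj (op (Ind.yoneda.obj X)))
      (colimit.isColimit ((natDown ⋙ S.obj) ⋙ Ind.yoneda)))
      (i := ⟨n⟩) (j := ⟨n⟩) (xi := Ind.yoneda.map a) (xj := Ind.yoneda.map b)).1 h
  obtain rfl : f = g := Subsingleton.elim _ _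
  have := hE _ (S.property (natDown.map f))
  refine (cancel_mono (S.obj.map (natDown.map f))).1 (Ind.yoneda.map_injective ?_)
  exact (Ind.yoneda.map_comp _ _).trans (e.trans (Ind.yoneda.map_comp _ _).symm)

/-- The reindexing of a system along a monotone map. -/
def IndSys.reindex (S : IndSys E) (φ : ℕ →o ℕ) : IndSys E :=
  ⟨φ.monotone.functor ⋙ S.obj, fun _ _ _ => S.property _⟩

/-- The natural map `S ⟶ S ∘ φ`, for `φ ≥ id`. -/
def IndSys.toReindex (S : IndSys E) (φ : ℕ →o ℕ) (h : ∀ n, n ≤ φ n) : S ⟶ S.reindex φ :=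
  ObjectProperty.homMk
    { app n := S.obj.map (homOfLE (h n))
      naturality n m f := (S.obj.map_comp f (homOfLE (h m))).symm.trans
        (S.obj.map_comp (homOfLE (h n)) (homOfLE (φ.monotone (leOfHom f)))) }

variable (E)

/-- Reindexing, as an endofunctor of the category of systems. -/
def indReindexFunctor (φ : ℕ →o ℕ) : IndSys E ⥤ IndSys E where
  obj S := S.reindex φ
  map f := ObjectProperty.homMk (Functor.whiskerLeft φ.monotone.functor f.hom)

/-- The endofunctors `S ↦ S ∘ φ` of the category of systems, for `φ ≥ id`. -/
def indReindexing : Reindexing (IndSys E) where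
  ι := { φ : ℕ →o ℕ // ∀ n, n ≤ φ n }
  nonempty := ⟨⟨OrderHom.id, fun _ => le_rfl⟩⟩
  T φ := indReindexFunctor E φ.1
  η φ :=
    { app S := S.toReindex φ.1 φ.2
      naturality S S' f := by
        ext n
        exact (f.hom.naturality _).symm }
  map_η φ S := by
    ext n
    rfl
  comp φ ψ := ⟨⟨φ.1.comp ψ.1, fun i => (ψ.2 i).trans (φ.2 _)⟩,
    𝟙 (indReindexFunctor E (φ.1.comp ψ.1)),
    fun S => by
      ext n
      exact (congrArg _ (Category.comp_id _)).trans (S.obj.map_comp _ _).symm⟩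

variable {E}

lemma indι_comp_toReindex (S : IndSys E) (φ : ℕ →o ℕ) (h : ∀ n, n ≤ φ n) (n : ℕ) :
    indι S (φ n) ≫ ((indLim E).map (S.toReindex φ h)).hom = indι (S.reindex φ) n :=
  (indι_map _ _).trans (indι_w (S.reindex φ) (homOfLE (h n)))

lemma isIso_indLim_map_toReindex (S : IndSys E) (φ : ℕ →o ℕ) (h : ∀ n, n ≤ φ n) :
    IsIso ((indLim E).map (S.toReindex φ h)) := by
  obtain ⟨r, hr⟩ := exists_indι_comp_eq (S.reindex φ) (P := (indLim E).obj S)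
    (fun n => indι S (φ n)) (fun {n m} a => indι_w S (homOfLE (φ.monotone (leOfHom a))))
  refine ⟨r, indLim_hom_ext fun n => ?_, indLim_hom_ext fun n => ?_⟩
  · rw [ObjectProperty.FullSubcategory.comp_hom,
      reassoc_of% indι_map (S.toReindex φ h) n, hr]
    exact (indι_w S (homOfLE (h n))).trans (Category.comp_id _).symm
  · rw [ObjectProperty.FullSubcategory.comp_hom, reassoc_of% hr n]
    exact (indι_comp_toReindex S φ h n).trans (Category.comp_id _).symm

instance : (indLim E).EssSurj where
  mem_essImage := by
    rintro ⟨X, I, _, _, _, _, D, hD, ⟨i⟩⟩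
    let s := IsFiltered.sequentialFunctor I
    refine ⟨⟨s ⋙ D, fun _ _ _ => hD _⟩, ⟨ObjectProperty.isoMk _
      (Functor.Final.colimitIso (natDown.{v} ⋙ s) (D ⋙ Ind.yoneda) ≪≫ i.symm)⟩⟩

variable (hE : ∀ ⦃X Y : A⦄ (f : X ⟶ Y), IsAdmMono E f → Mono f)

include hE

lemma exists_indLim_map_eq {S S' : IndSys E} (f : (indLim E).obj S ⟶ (indLim E).obj S') :
    ∃ (φ : ℕ →o ℕ) (h : ∀ n, n ≤ φ n) (a : S ⟶ S'.reindex φ),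
      (indLim E).map a = f ≫ (indLim E).map (S'.toReindex φ h) := by
  choose k g hg using fun n => exists_eq_comp_indι S' (indι S n ≫ f.hom)
  obtain ⟨φ, hφ, hkφ⟩ := exists_orderHom_ge k
  let a (n : ℕ) : S.obj.obj n ⟶ S'.obj.obj (φ n) := g n ≫ S'.obj.map (homOfLE (hkφ n))
  have map_a_indι (n) : Ind.yoneda.map (a n) ≫ indι S' (φ n) = indι S n ≫ f.hom := by
    rw [Functor.map_comp, Category.assoc, indι_w, hg]
  have naturality {n m : ℕ} (t : n ⟶ m) : S.obj.map t ≫ a m =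
      a n ≫ S'.obj.map (homOfLE (φ.monotone (leOfHom t))) := by
    apply indι_cancel hE
    rw [Functor.map_comp, Category.assoc, map_a_indι, reassoc_of% indι_w S t,
      Functor.map_comp, Category.assoc, indι_w, map_a_indι]
  refine ⟨φ, hφ, ObjectProperty.homMk { app := a, naturality n m t := naturality t },
    indLim_hom_ext fun n => ?_⟩
  rw [indι_map, ObjectProperty.FullSubcategory.comp_hom, ← reassoc_of% map_a_indι n]
  exact congrArg (Ind.yoneda.map (a n) ≫ ·) (indι_comp_toReindex S' φ hφ n).symm

lemma isLocalization_indLim : (indLim E).IsLocalization (indReindexing E).W := by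
  refine (indReindexing E).isLocalization (indLim E)
    (fun φ S => isIso_indLim_map_toReindex S φ.1 φ.2) (fun S S' a b h => ?_) fun S S' f => ?_
  · obtain ⟨φ⟩ := (indReindexing E).nonempty
    refine ⟨φ, ?_⟩
    congr 1
    ext n
    apply indι_cancel hE
    rw [← indι_map, ← indι_map, h]
  · obtain ⟨φ, h, a, ha⟩ := exists_indLim_map_eq hE f
    exact ⟨⟨φ, h⟩, a, ha⟩

end IndLim

/-! ### Functors of quotients -/

section Quot

variable {A : Type u} [Category.{v} A] [Preadditive A] {E : SeqClass A} (hE : IsExactStructure E)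
  {T T' : ℤ ⥤ A} (q : Quotients E T)

/-- The projection `T j ⟶ T j / T i`: this is `quotProj`, with the endpoints named. -/
def quotMk {i j : ℤ} (h : i ≤ j) : T.obj j ⟶ (quotFunctor hE q).obj (pr i j h) :=
  quotProj hE q (pr i j h)

instance {i j : ℤ} (h : i ≤ j) : Epi (quotMk hE q h) :=
  quotProj_epi hE q (pr i j h)

lemma quotMk_map {i j i' j' : ℤ} {h : i ≤ j} {h' : i' ≤ j'} (hi : i ≤ i') (hj : j ≤ j') :
    quotMk hE q h ≫ (quotFunctor hE q).map (prHom hi hj : pr i j h ⟶ pr i' j' h') =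
      T.map (homOfLE hj) ≫ quotMk hE q h' :=
  quotProj_map hE q _

lemma quotMk_map_left {i i' j : ℤ} (hi : i ≤ i') (h : i' ≤ j) :
    quotMk hE q (hi.trans h) ≫ (quotFunctor hE q).map (prHom hi le_rfl) = quotMk hE q h := by
  rw [quotMk_map]
  exact (congrArg (· ≫ quotMk hE q h) (T.map_id j)).trans (Category.id_comp _)

variable (q' : Quotients E T')

lemma quotMk_quotMap_app (f : T ⟶ T') {i j : ℤ} (h : i ≤ j) :
    quotMk hE q h ≫ (quotMap hE q q' f).app (pr i j h) = f.app j ≫ quotMk hE q' h :=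
  quotProj_mapApp hE q q' f _

variable {q} in
lemma quotFunctor_hom_ext {X : Pairs ⥤ A} {f g : quotFunctor hE q ⟶ X}
    (hfg : ∀ ⦃i j : ℤ⦄ (h : i ≤ j),
      quotMk hE q h ≫ f.app (pr i j h) = quotMk hE q h ≫ g.app (pr i j h)) : f = g := by
  ext ⟨⟨i, j⟩, h⟩
  exact (cancel_epi (quotMk hE q h)).1 (hfg h)

lemma isIso_quotMk {i j : ℤ} (h : i ≤ j) (hi : IsZero (T.obj i)) : IsIso (quotMk hE q h) :=
  hE.isKellerExact.isIso_of_isZero_left (q.adm i j h) hi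

variable {q q'} in
lemma comp_quotMk_eq_of_le {u : quotFunctor hE q ⟶ quotFunctor hE q'} {i i' j : ℤ} (hi : i ≤ i')
    (h : i' ≤ j) {a : T.obj j ⟶ T'.obj j}
    (ha : a ≫ quotMk hE q' (hi.trans h) = quotMk hE q (hi.trans h) ≫ u.app _) :
    a ≫ quotMk hE q' h = quotMk hE q h ≫ u.app _ := by
  rw [← quotMk_map_left hE q' hi h, reassoc_of% ha, ← u.naturality,
    reassoc_of% quotMk_map_left hE q hi h]

lemma exists_quotMap_eq (i₀ : ℤ) (hT' : ∀ i ≤ i₀, IsZero (T'.obj i))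
    (u : quotFunctor hE q ⟶ quotFunctor hE q') : ∃ f : T ⟶ T', quotMap hE q q' f = u := by
  have isIso_quotMk' {i j : ℤ} (h : i ≤ j) (hi : i ≤ i₀) : IsIso (quotMk hE q' h) :=
    isIso_quotMk hE q' h (hT' i hi)
  have exists_a {i j : ℤ} (h : i ≤ j) (hi : i ≤ i₀) :
      ∃ a, a ≫ quotMk hE q' h = quotMk hE q h ≫ u.app _ := by
    have := isIso_quotMk' h hi
    exact ⟨quotMk hE q h ≫ u.app _ ≫ inv (quotMk hE q' h), by simp⟩
  choose a ha using fun j => exists_a (min_le_right i₀ j) (min_le_left i₀ j)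
  have a_comp_quotMk {i j : ℤ} (h : i ≤ j) : a j ≫ quotMk hE q' h = quotMk hE q h ≫ u.app _ := by
    have hi := min_le_right i (min i₀ j)
    obtain ⟨b, hb⟩ := exists_a (hi.trans (min_le_right _ _)) (hi.trans (min_le_left _ _))
    have := isIso_quotMk' (min_le_right i₀ j) (min_le_left i₀ j)
    obtain rfl : b = a j := (cancel_mono (quotMk hE q' (min_le_right i₀ j))).1
      ((comp_quotMk_eq_of_le hE hi _ hb).trans (ha j).symm)
    exact comp_quotMk_eq_of_le hE (min_le_left i (min i₀ j)) h hb
  refine ⟨{ app := a, naturality j j' f := ?_ }, quotFunctor_hom_ext hE fun i j h =>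
    (quotMk_quotMap_app hE q q' _ h).trans (a_comp_quotMk h)⟩
  have hj := min_le_right i₀ j
  have := isIso_quotMk' (hj.trans (leOfHom f)) (min_le_left i₀ j)
  rw [← cancel_mono (quotMk hE q' (hj.trans (leOfHom f))), Category.assoc, a_comp_quotMk,
    Category.assoc, Subsingleton.elim f (homOfLE (leOfHom f)), ← quotMk_map hE q' le_rfl,
    reassoc_of% a_comp_quotMk hj, ← u.naturality, ← reassoc_of% quotMk_map hE q le_rfl]

variable {q q'} in
lemma quotMap_injective (i₀ : ℤ) (hT' : ∀ i ≤ i₀, IsZero (T'.obj i)) {f g : T ⟶ T'}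
    (hfg : quotMap hE q q' f = quotMap hE q q' g) : f = g := by
  ext j
  have := isIso_quotMk hE q' (min_le_right i₀ j) (hT' _ (min_le_left i₀ j))
  rw [← cancel_mono (quotMk hE q' (min_le_right i₀ j)), ← quotMk_quotMap_app hE q,
    ← quotMk_quotMap_app hE q, hfg]

include hE q in
lemma Quotients.mono_map {i j : ℤ} (h : i ≤ j) : Mono (T.map (homOfLE h)) :=
  hE.mono (q.adm i j h)

/-- The quotients of `T ∘ φ`. -/
def Quotients.reindex (φ : Bicofinal) : Quotients E (φ.monotone.functor ⋙ T) where
  obj i j h := q.obj (φ.toFun i) (φ.toFun j) (φ.monotone h)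
  proj i j h := q.proj (φ.toFun i) (φ.toFun j) (φ.monotone h)
  adm i j h := q.adm (φ.toFun i) (φ.toFun j) (φ.monotone h)

variable (T) in
/-- The natural map `T ∘ φ ⟶ T ∘ ψ` for `φ ≤ ψ`. -/
def precompMap {φ ψ : Bicofinal} (h : ∀ i, φ.toFun i ≤ ψ.toFun i) :
    φ.monotone.functor ⋙ T ⟶ ψ.monotone.functor ⋙ T :=
  Functor.whiskerRight { app i := homOfLE (h i) } T

variable (T) in
/-- The natural map `T ⟶ T ∘ φ` for `φ ≥ id`. -/
def toPrecomp {φ : Bicofinal} (h : ∀ i, i ≤ φ.toFun i) : T ⟶ φ.monotone.functor ⋙ T :=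
  precompMap T (φ := Bicofinal.id) h

/-- The admissible functor `(i, j) ↦ T j / T i`. -/
def quotAdm : AdmFun E :=
  ⟨quotFunctor hE q, quotFunctor_admissible hE q⟩

/-- The map of admissible functors `(i, j) ↦ T j / T i` induced by a natural transformation. -/
def quotAdmMap (f : T ⟶ T') : quotAdm hE q ⟶ quotAdm hE q' :=
  ObjectProperty.homMk (quotMap hE q q' f)

lemma quotAdmMap_comp {T'' : ℤ ⥤ A} (q'' : Quotients E T'') (f : T ⟶ T') (g : T' ⟶ T'') :
    quotAdmMap hE q q' f ≫ quotAdmMap hE q' q'' g = quotAdmMap hE q q'' (f ≫ g) := by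
  ext1
  exact (quotMap_comp hE q q' q'' f g).symm

lemma quotAdmMap_id : quotAdmMap hE q q (𝟙 T) = 𝟙 _ := by
  ext1
  exact quotMap_id hE q

instance (f : T ⟶ T') [IsIso f] : IsIso (quotAdmMap hE q q' f) :=
  ⟨quotAdmMap hE q' q (inv f), by rw [quotAdmMap_comp, IsIso.hom_inv_id, quotAdmMap_id],
    by rw [quotAdmMap_comp, IsIso.inv_hom_id, quotAdmMap_id]⟩

lemma quotAdmMap_precompMap {φ ψ : Bicofinal} (h : ∀ i, φ.toFun i ≤ ψ.toFun i) :
    quotAdmMap hE (q.reindex φ) (q.reindex ψ) (precompMap T h) = (quotAdm hE q).reindexMap h := by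
  ext1
  exact quotFunctor_hom_ext hE fun i j hij =>
    (quotMk_quotMap_app hE (q.reindex φ) (q.reindex ψ) (precompMap T h) hij).trans
      (quotMk_map hE q (h i) (h j)).symm

lemma quotAdmMap_toPrecomp {φ : Bicofinal} (h : ∀ i, i ≤ φ.toFun i) :
    quotAdmMap hE q (q.reindex φ) (toPrecomp T h) =
      ((admReindexing E).η ⟨φ, h⟩).app (quotAdm hE q) :=
  quotAdmMap_precompMap hE q (φ := Bicofinal.id) h

end Quot

/-! ### From ind-systems to the Beilinson category -/

section Ind

variable {A : Type u} [Category.{v} A] [Preadditive A] [HasZeroObject A] {E : SeqClass A}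
  (hE : IsExactStructure E)

/-- The extension of a map `φ ≥ id` of `ℕ` to a bicofinal map, by the identity in negative
degrees. -/
def extendNat (φ : ℕ →o ℕ) (h : ∀ n, n ≤ φ n) : Bicofinal where
  toFun
    | Int.ofNat n => Int.ofNat (φ n)
    | Int.negSucc n => Int.negSucc n
  monotone i j hij := by
    match i, j with
    | Int.ofNat n, Int.ofNat m => exact Int.ofNat_le.2 (φ.monotone (Int.ofNat_le.1 hij))
    | Int.negSucc _, Int.negSucc _ => exact hij
    | Int.negSucc n, Int.ofNat m =>
      exact (Int.negSucc_lt_zero n).le.trans (Int.natCast_nonneg _)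
    | Int.ofNat n, Int.negSucc m =>
      exact absurd (hij.trans_lt (Int.negSucc_lt_zero m)) (Int.natCast_nonneg n).not_gt
  tendsto_top := Filter.tendsto_atTop_mono (fun
    | Int.ofNat n => Int.ofNat_le.2 (h n)
    | Int.negSucc n => le_rfl) Filter.tendsto_id
  tendsto_bot := by
    refine Filter.tendsto_id.congr' ?_
    filter_upwards [Filter.eventually_lt_atBot (0 : ℤ)] with i hi
    match i with
    | Int.ofNat n => exact absurd hi (Int.natCast_nonneg n).not_gt
    | Int.negSucc n => rfl

lemma le_extendNat (φ : ℕ →o ℕ) (h : ∀ n, n ≤ φ n) : ∀ i, i ≤ (extendNat φ h).toFun i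
  | Int.ofNat n => Int.ofNat_le.2 (h n)
  | Int.negSucc _ => le_rfl

lemma isZero_extendZero (S : ℕ ⥤ A) {i : ℤ} (h : i < 0) : IsZero ((extendZero S).obj i) :=
  match i with
  | Int.ofNat n => absurd h (Int.natCast_nonneg n).not_gt
  | Int.negSucc _ => isZero_zero A

lemma exists_isZero_comp_extendZero (S : ℕ ⥤ A) (φ : Bicofinal) :
    ∃ i₀, ∀ i ≤ i₀, IsZero ((φ.monotone.functor ⋙ extendZero S).obj i) := by
  obtain ⟨i₀, hi₀⟩ := φ.exists_le (-1)
  exact ⟨i₀, fun i hi => isZero_extendZero S ((φ.monotone hi).trans_lt (by lia))⟩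

/-- The extension by zero of a reindexed system. -/
def extendZeroReindex (S : IndSys E) (φ : ℕ →o ℕ) (h : ∀ n, n ≤ φ n) :
    extendZero (S.reindex φ).obj ≅ (extendNat φ h).monotone.functor ⋙ extendZero S.obj :=
  NatIso.ofComponents (fun
    | Int.ofNat n => Iso.refl (S.obj.obj (φ n))
    | Int.negSucc _ => Iso.refl 0) (fun {i j} f => match i, j, f with
    | Int.ofNat _, Int.ofNat _, _ => (Category.comp_id _).trans (Category.id_comp _).symm
    | Int.negSucc _, _, _ => (isZero_zero A).eq_of_src _ _
    | Int.ofNat _, Int.negSucc _, g =>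
      absurd (leOfHom g) (by have := Int.negSucc_lt_zero; grind))

/-- The natural map from the extension by zero of `S ∘ φ` to `extendZero S ∘ θ`, for a bicofinal
map `θ` that is at least the extension of `φ`. -/
def extendZeroReindexMap (S : IndSys E) (φ : ℕ →o ℕ) (h : ∀ n, n ≤ φ n) {θ : Bicofinal}
    (hθ : ∀ i, (extendNat φ h).toFun i ≤ θ.toFun i) :
    extendZero (S.reindex φ).obj ⟶ θ.monotone.functor ⋙ extendZero S.obj :=
  (extendZeroReindex S φ h).hom ≫ precompMap (extendZero S.obj) hθ

lemma extendZeroMap_toReindex (S : IndSys E) (φ : ℕ →o ℕ) (h : ∀ n, n ≤ φ n) {θ : Bicofinal}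
    (hθ : ∀ i, (extendNat φ h).toFun i ≤ θ.toFun i) :
    extendZeroMap (S.toReindex φ h).hom ≫ extendZeroReindexMap S φ h hθ =
      toPrecomp (extendZero S.obj) fun i => (le_extendNat φ h i).trans (hθ i) := by
  ext i
  match i with
  | Int.ofNat n =>
    exact (congrArg _ (Category.id_comp _)).trans ((extendZero S.obj).map_comp
      (homOfLE (le_extendNat φ h (Int.ofNat n))) (homOfLE (hθ (Int.ofNat n)))).symm
  | Int.negSucc _ => exact (isZero_zero A).eq_of_src _ _

/-- The map `ψ` is the restriction of `φ` to `ℕ`. -/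
lemma exists_extendZeroMap_comp_eq {S S' : IndSys E} {φ : Bicofinal} (hφ : ∀ i, i ≤ φ.toFun i)
    (g : extendZero S.obj ⟶ φ.monotone.functor ⋙ extendZero S'.obj) :
    ∃ (ψ : ℕ →o ℕ) (hψ : ∀ n, n ≤ ψ n) (a : S ⟶ S'.reindex ψ)
      (hψφ : ∀ i, (extendNat ψ hψ).toFun i ≤ φ.toFun i),
      extendZeroMap a.hom ≫ extendZeroReindexMap S' ψ hψ hψφ = g := by
  have hn (n : ℕ) : φ.toFun (Int.ofNat n) = Int.ofNat (φ.toFun (Int.ofNat n)).toNat :=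
    (Int.toNat_of_nonneg ((Int.natCast_nonneg n).trans (hφ _))).symm
  let ψ : ℕ →o ℕ := ⟨fun n => (φ.toFun (Int.ofNat n)).toNat, fun n m h =>
    Int.toNat_le_toNat (φ.monotone (Int.ofNat_le.2 h))⟩
  have hψ (n) : n ≤ ψ n := Int.ofNat_le.1 ((hφ _).trans (hn n).le)
  have hψφ : ∀ i, (extendNat ψ hψ).toFun i ≤ φ.toFun i
    | Int.ofNat n => (hn n).ge
    | Int.negSucc n => hφ _
  let a (n : ℕ) : S.obj.obj n ⟶ S'.obj.obj (ψ n) :=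
    g.app (Int.ofNat n) ≫ (extendZero S'.obj).map (homOfLE (hn n).le)
  have naturality {n m : ℕ} (t : n ⟶ m) :
      S.obj.map t ≫ a m = a n ≫ S'.obj.map (homOfLE (ψ.monotone (leOfHom t))) := by
    have h₁ := g.naturality (homOfLE (Int.ofNat_le.2 (leOfHom t)))
    refine (Category.assoc _ _ _).symm.trans ((congrArg (· ≫ _) h₁).trans ?_)
    refine (Category.assoc _ _ _).trans (Eq.trans ?_ (Category.assoc _ _ _).symm)
    exact congrArg (g.app (Int.ofNat n) ≫ ·) (((extendZero S'.obj).map_comp _ _).symm.trans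
      ((extendZero S'.obj).map_comp (homOfLE (hn n).le)
        (homOfLE (Int.ofNat_le.2 (ψ.monotone (leOfHom t))))))
  refine ⟨ψ, hψ, ObjectProperty.homMk { app := a, naturality n m t := naturality t }, hψφ, ?_⟩
  ext i
  match i with
  | Int.ofNat n =>
    refine (congrArg _ (Category.id_comp _)).trans ((Category.assoc _ _ _).trans ?_)
    refine (congrArg _ ((extendZero S'.obj).map_comp _ _).symm).trans ?_
    exact (congrArg _ ((extendZero S'.obj).map_id _)).trans (Category.comp_id _)
  | Int.negSucc _ => exact (isZero_zero A).eq_of_src _ _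

variable (q : ∀ S : IndSys E, Quotients E S.obj)

/-- The map of admissible functors induced by `extendZeroReindexMap`. -/
def indSysToAdmFunReindexMap (S : IndSys E) (φ : ℕ →o ℕ) (h : ∀ n, n ≤ φ n) {θ : Bicofinal}
    (hθ : ∀ i, (extendNat φ h).toFun i ≤ θ.toFun i) :
    (indSysToAdmFun hE q).obj (S.reindex φ) ⟶ ((indSysToAdmFun hE q).obj S).reindex θ :=
  quotAdmMap hE (extendQuotients hE (q (S.reindex φ))) ((extendQuotients hE (q S)).reindex θ)
    (extendZeroReindexMap S φ h hθ)

instance (S : IndSys E) (φ : ℕ →o ℕ) (h : ∀ n, n ≤ φ n) {θ : Bicofinal}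
    (hθ : ∀ i, (extendNat φ h).toFun i ≤ θ.toFun i) :
    IsIso ((toBeilinson E).map (indSysToAdmFunReindexMap hE q S φ h hθ)) := by
  let X := (indSysToAdmFun hE q).obj S
  let c : (indSysToAdmFun hE q).obj (S.reindex φ) ⟶ X.reindex (extendNat φ h) :=
    quotAdmMap hE (extendQuotients hE (q (S.reindex φ)))
      ((extendQuotients hE (q S)).reindex (extendNat φ h)) (extendZeroReindex S φ h).hom
  have : IsIso c := inferInstanceAs (IsIso (quotAdmMap hE _ _ (extendZeroReindex S φ h).hom))
  have factorization : indSysToAdmFunReindexMap hE q S φ h hθ = c ≫ X.reindexMap hθ :=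
    (quotAdmMap_comp hE _ _ _ _ _).symm.trans
      (congrArg (c ≫ ·) (quotAdmMap_precompMap hE (extendQuotients hE (q S)) hθ))
  rw [factorization, Functor.map_comp]
  infer_instance

lemma indSysToAdmFun_map_toReindex (S : IndSys E) (φ : ℕ →o ℕ) (h : ∀ n, n ≤ φ n) {θ : Bicofinal}
    (hθ : ∀ i, (extendNat φ h).toFun i ≤ θ.toFun i) :
    (indSysToAdmFun hE q).map (S.toReindex φ h) ≫ indSysToAdmFunReindexMap hE q S φ h hθ =
      ((admReindexing E).η ⟨θ, fun i => (le_extendNat φ h i).trans (hθ i)⟩).app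
        ((indSysToAdmFun hE q).obj S) :=
  (quotAdmMap_comp hE _ _ _ _ _).trans ((congrArg _ (extendZeroMap_toReindex S φ h hθ)).trans
    (quotAdmMap_toPrecomp hE _ _))

lemma isIso_indSysToBeilinson_toReindex (S : IndSys E) (φ : ℕ →o ℕ) (h : ∀ n, n ≤ φ n) :
    IsIso ((indSysToBeilinson hE q).map (S.toReindex φ h)) := by
  have hθ (i : ℤ) : (extendNat φ h).toFun i ≤ (extendNat φ h).toFun i := le_rfl
  have isIso_comp : IsIso ((toBeilinson E).map ((indSysToAdmFun hE q).map (S.toReindex φ h)) ≫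
      (toBeilinson E).map (indSysToAdmFunReindexMap hE q S φ h hθ)) := by
    rw [← Functor.map_comp, indSysToAdmFun_map_toReindex]
    exact isIso_toBeilinson_reindexMap E _
  exact IsIso.of_isIso_comp_right
    ((toBeilinson E).map ((indSysToAdmFun hE q).map (S.toReindex φ h)))
    ((toBeilinson E).map (indSysToAdmFunReindexMap hE q S φ h hθ))

lemma indSysToBeilinson_map_injective {S S' : IndSys E} {a b : S ⟶ S'}
    (hab : (indSysToBeilinson hE q).map a = (indSysToBeilinson hE q).map b) : a = b := by
  obtain ⟨⟨φ, hφ⟩, hη⟩ := ((admReindexing E).map_eq_iff (toBeilinson E) _ _).1 hab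
  let Q := extendQuotients hE (q S')
  have map_comp_η (c : S ⟶ S') : (indSysToAdmFun hE q).map c ≫
      ((admReindexing E).η ⟨φ, hφ⟩).app ((indSysToAdmFun hE q).obj S') =
      quotAdmMap hE _ (Q.reindex φ) (extendZeroMap c.hom ≫ toPrecomp _ hφ) :=
    (congrArg (_ ≫ ·) (quotAdmMap_toPrecomp hE Q hφ).symm).trans (quotAdmMap_comp hE _ Q _ _ _)
  obtain ⟨i₀, hi₀⟩ := exists_isZero_comp_extendZero S'.obj φ
  have extendZero_eq := quotMap_injective hE i₀ hi₀ (congrArg (·.hom)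
    ((map_comp_η a).symm.trans (hη.trans (map_comp_η b))))
  ext n
  have := Q.mono_map hE (hφ (Int.ofNat n))
  exact (cancel_mono ((extendZero S'.obj).map (homOfLE (hφ (Int.ofNat n))))).1
    (NatTrans.congr_app extendZero_eq (Int.ofNat n))

lemma exists_indSysToBeilinson_map_eq {S S' : IndSys E}
    (f : (indSysToBeilinson hE q).obj S ⟶ (indSysToBeilinson hE q).obj S') :
    ∃ (φ : ℕ →o ℕ) (h : ∀ n, n ≤ φ n) (a : S ⟶ S'.reindex φ), (indSysToBeilinson hE q).map a =
      f ≫ (indSysToBeilinson hE q).map (S'.toReindex φ h) := by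
  obtain ⟨⟨φ, hφ⟩, u, hu⟩ := (admReindexing E).exists_map (toBeilinson E)
    (X := (indSysToAdmFun hE q).obj S) (Y := (indSysToAdmFun hE q).obj S') f
  obtain ⟨i₀, hi₀⟩ := exists_isZero_comp_extendZero S'.obj φ
  obtain ⟨g, hg⟩ := exists_quotMap_eq hE (extendQuotients hE (q S))
    ((extendQuotients hE (q S')).reindex φ) i₀ hi₀ u.hom
  obtain ⟨ψ, hψ, a, hψφ, rfl⟩ := exists_extendZeroMap_comp_eq hφ g
  let r := indSysToAdmFunReindexMap hE q S' ψ hψ hψφ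
  have map_a_comp_r : (indSysToAdmFun hE q).map a ≫ r = u := by
    refine (quotAdmMap_comp hE _ (extendQuotients hE (q (S'.reindex ψ))) _ _ _).trans ?_
    ext1
    exact hg
  have map_u : (toBeilinson E).map u =
      f ≫ (toBeilinson E).map ((indSysToAdmFun hE q).map (S'.toReindex ψ hψ) ≫ r) := by
    rw [indSysToAdmFun_map_toReindex, hu]
    rfl
  refine ⟨ψ, hψ, a, (cancel_mono ((toBeilinson E).map r)).1 ?_⟩
  refine ((toBeilinson E).map_comp _ _).symm.trans ?_
  refine (congrArg (toBeilinson E).map map_a_comp_r).trans (map_u.trans ?_)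
  exact (congrArg (f ≫ ·) ((toBeilinson E).map_comp _ _)).trans (Category.assoc _ _ _).symm

end Ind

/-! ### Bounded below admissible functors -/

section BoundedBelow

variable {A : Type u} [Category.{v} A] [Preadditive A] {E : SeqClass A} {X Y : AdmFun E}

/-- The admissible functors that vanish in low degrees. -/
def AdmFun.IsBoundedBelow (X : AdmFun E) : Prop :=
  ∃ N : ℤ, ∀ p : Pairs, p.1.2 ≤ N → IsZero (X.obj.obj p)

lemma AdmFun.IsBoundedBelow.exists_map_eq_zero (hY : Y.IsBoundedBelow)
    (e : (toBeilinson E).obj X ≅ (toBeilinson E).obj Y) :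
    ∃ (θ : Bicofinal) (hθ : ∀ i, i ≤ θ.toFun i) (N : ℤ), ∀ ⦃i j : ℤ⦄ (h : i ≤ j), j ≤ N →
      X.obj.map (prHom (hθ i) (hθ j) : pr i j h ⟶ pr _ _ (θ.monotone h)) = 0 := by
  obtain ⟨M, hM⟩ := hY
  obtain ⟨φ, a, ha⟩ := (admReindexing E).exists_map (toBeilinson E) e.hom
  have : IsIso ((toBeilinson E).map a) := by
    rw [ha]
    infer_instance
  obtain ⟨ψ, b, hb⟩ := (admReindexing E).exists_map (toBeilinson E) (inv ((toBeilinson E).map a))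
  obtain ⟨χ, hχ⟩ := ((admReindexing E).map_eq_iff (toBeilinson E) (a ≫ b)
    (((admReindexing E).η ψ).app X)).1 (by rw [Functor.map_comp, hb, IsIso.hom_inv_id_assoc])
  obtain ⟨N, hN⟩ := φ.1.exists_le M
  refine ⟨ψ.1.comp χ.1, fun i => (χ.2 i).trans (ψ.2 _), N, fun i j h hj => ?_⟩
  have a_eq_zero : a.hom.app (pr i j h) = 0 := (hM _ ((φ.1.monotone hj).trans hN)).eq_of_tgt _ _
  have map_eq_comp_a := congrArg (fun t : X ⟶ (X.reindex ψ.1).reindex χ.1 =>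
    t.hom.app (pr i j h)) hχ.symm
  refine (X.obj.map_comp (prHom (ψ.2 i) (ψ.2 j) : pr i j h ⟶ pr _ _ (ψ.1.monotone h))
    (prHom (ψ.1.monotone (χ.2 i)) (ψ.1.monotone (χ.2 j)))).trans (map_eq_comp_a.trans ?_)
  exact (Category.assoc _ _ _).trans ((congrArg (· ≫ _) a_eq_zero).trans zero_comp)

variable (hE : IsExactStructure E)

include hE

/-- The map `X (i, j) ⟶ X (i', j')` factors as an epimorphism onto `X (i', j)` followed by a
monomorphism. -/
lemma IsAdmissible.isZero_of_map_eq_zero {X : Pairs ⥤ A} (hX : IsAdmissible E X)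
    {i i' j j' : ℤ} (hi : i ≤ i') (h : i' ≤ j) (hj : j ≤ j')
    (h0 : X.map (prHom hi hj : pr i j (hi.trans h) ⟶ pr i' j' (h.trans hj)) = 0) :
    IsZero (X.obj (pr i' j h)) := by
  have := hE.epi (hX i i' j hi h)
  have := hE.mono (hX i' j j' h hj)
  rw [IsZero.iff_id_eq_zero, ← cancel_epi (X.map (prHom hi le_rfl)),
    ← cancel_mono (X.map (prHom le_rfl hj)), Category.comp_id, ← X.map_comp, comp_zero, zero_comp]
  exact h0

lemma AdmFun.IsBoundedBelow.of_iso (hY : Y.IsBoundedBelow)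
    (e : (toBeilinson E).obj X ≅ (toBeilinson E).obj Y) : X.IsBoundedBelow := by
  obtain ⟨θ, hθ, N, map_eq_zero⟩ := hY.exists_map_eq_zero e
  refine ⟨N, ?_⟩
  rintro ⟨⟨k, j⟩, hkj : k ≤ j⟩ (hj : j ≤ N)
  obtain ⟨i, hi⟩ := θ.exists_le k
  have := hE.epi (X.property (θ.toFun i) k j hi hkj)
  exact IsZero.of_epi (X.obj.map (prHom hi le_rfl))
    (X.property.isZero_of_map_eq_zero hE (hθ i) (hi.trans hkj) (hθ j) (map_eq_zero _ hj))

end BoundedBelow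

/-! ### The essential image of the ind-systems -/

section Row

variable {A : Type u} [Category.{v} A]

lemma isIso_map_of_hom_of_hom {C : Type*} [Preorder C] (F : C ⥤ A) {x y : C} (f : x ⟶ y)
    (g : y ⟶ x) : IsIso (F.map f) :=
  have : IsIso f := ⟨g, Subsingleton.elim _ _, Subsingleton.elim _ _⟩
  inferInstance

/-- The functor `(i, j) ↦ (max (-1) i, max (-1) j)` on `Π`. -/
def truncPairs : Pairs ⥤ Pairs where
  obj p := pr (max (-1) p.1.1) (max (-1) p.1.2) (max_le_max le_rfl p.2)
  map f := prHom (max_le_max le_rfl (leOfHom f).1) (max_le_max le_rfl (leOfHom f).2)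

/-- The map from a pair to its truncation. -/
def toTruncPairs (p : Pairs) : p ⟶ truncPairs.obj p :=
  prHom (le_max_right _ _) (le_max_right _ _)

/-- The functor `j ↦ (-1, max (-1) j)`. -/
def rowPairs : ℤ ⥤ Pairs where
  obj j := pr (-1) (max (-1) j) (le_max_left _ _)
  map f := prHom le_rfl (max_le_max le_rfl (leOfHom f))

variable {E : SeqClass A}

/-- The values of `X` as quotients of the row `X (-1, j)`. -/
def rowQuotients (X : AdmFun E) : Quotients E (rowPairs ⋙ X.obj) where
  obj i j h := X.obj.obj (truncPairs.obj (pr i j h))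
  proj _ _ _ := X.obj.map (prHom (le_max_left _ _) le_rfl)
  adm _ _ h := X.property (-1) _ _ (le_max_left _ _) (max_le_max le_rfl h)

/-- The system `X (-1, 0) ⟶ X (-1, 1) ⟶ ⋯`. -/
def rowSys (X : AdmFun E) : IndSys E :=
  ⟨{ obj n := X.obj.obj (pr (-1) (Int.ofNat n) (by grind))
     map {n m} f := X.obj.map (prHom le_rfl (Int.ofNat_le.2 (leOfHom f)))
     map_id n := X.obj.map_id _
     map_comp f g := X.obj.map_comp _ _ },
    fun {n m} f => ⟨_, _, X.property (-1) (Int.ofNat n) (Int.ofNat m) _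
      (Int.ofNat_le.2 (leOfHom f))⟩⟩

variable [Preadditive A] (hE : IsExactStructure E)

lemma quotFunctor_rowQuotients_map (X : AdmFun E) {p p' : Pairs} (g : p ⟶ p') :
    (quotFunctor hE (rowQuotients X)).map g = X.obj.map (truncPairs.map g) :=
  (cancel_epi (quotMk hE (rowQuotients X) p.2)).1
    ((quotMk_map hE (rowQuotients X) (leOfHom g).1 (leOfHom g).2).trans
      ((X.obj.map_comp _ _).symm.trans (X.obj.map_comp
        (prHom (le_max_left _ _) le_rfl : rowPairs.obj p.1.2 ⟶ truncPairs.obj p) _)))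

/-- The natural map from `X` to its truncation. -/
def toRowQuotients (X : AdmFun E) : X ⟶ quotAdm hE (rowQuotients X) :=
  ObjectProperty.homMk
    { app p := X.obj.map (toTruncPairs p)
      naturality p p' g := by
        refine Eq.trans ?_ (congrArg _ (quotFunctor_rowQuotients_map hE X g)).symm
        exact (X.obj.map_comp _ _).symm.trans (X.obj.map_comp (toTruncPairs p) _) }

include hE in
lemma isIso_map_toTruncPairs {X : AdmFun E} (hX : ∀ p : Pairs, p.1.2 ≤ -1 → IsZero (X.obj.obj p))
    (p : Pairs) : IsIso (X.obj.map (toTruncPairs p)) := by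
  obtain ⟨⟨i, j⟩, hij : i ≤ j⟩ := p
  by_cases hi : -1 ≤ i
  · exact isIso_map_of_hom_of_hom _ _ (prHom (max_le hi le_rfl) (max_le (hi.trans hij) le_rfl))
  by_cases hj : j ≤ -1
  · exact (hX _ hj).isIso (hX (truncPairs.obj (pr i j hij)) (max_le le_rfl hj)) _
  have h₁ : i ≤ max (-1) i := le_max_right _ _
  have h₂ : max (-1) i ≤ max (-1) j := max_le_max le_rfl hij
  let f₁ : pr i j hij ⟶ pr i (max (-1) j) (h₁.trans h₂) := prHom le_rfl (le_max_right _ _)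
  let f₂ : pr i (max (-1) j) (h₁.trans h₂) ⟶ pr (max (-1) i) (max (-1) j) h₂ := prHom h₁ le_rfl
  have : IsIso (X.obj.map f₁) :=
    isIso_map_of_hom_of_hom _ _ (prHom le_rfl (max_le (by lia) le_rfl))
  have : IsIso (X.obj.map f₂) := hE.isKellerExact.isIso_of_isZero_left
    (X.property i (max (-1) i) (max (-1) j) h₁ h₂)
    (hX (pr i (max (-1) i) h₁) (max_le le_rfl (by lia)))
  have : IsIso (X.obj.map f₁ ≫ X.obj.map f₂) := inferInstance
  rwa [← X.obj.map_comp] at this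

lemma isIso_toRowQuotients {X : AdmFun E} (hX : ∀ p : Pairs, p.1.2 ≤ -1 → IsZero (X.obj.obj p)) :
    IsIso (toRowQuotients hE X) := by
  have (p : Pairs) : IsIso ((toRowQuotients hE X).hom.app p) := isIso_map_toTruncPairs hE hX p
  have : IsIso (toRowQuotients hE X).hom := NatIso.isIso_of_isIso_app _
  exact (ObjectProperty.isoMk _ (asIso (toRowQuotients hE X).hom)).isIso_hom

variable [HasZeroObject A]

/-- The comparison of the extension by zero of the row of `X`. -/
def extendZeroRow (X : AdmFun E) : extendZero (rowSys X).obj ⟶ rowPairs ⋙ X.obj where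
  app
    | Int.ofNat n => X.obj.map (prHom le_rfl (le_max_right _ _))
    | Int.negSucc _ => 0
  naturality i j f := match i, j, f with
    | Int.ofNat _, Int.ofNat _, f => (X.obj.map_comp _ _).symm.trans (X.obj.map_comp
        (prHom le_rfl (le_max_right _ _)) (rowPairs.map f))
    | Int.negSucc _, _, _ => (isZero_zero A).eq_of_src _ _
    | Int.ofNat _, Int.negSucc _, g =>
      absurd (leOfHom g) (by have := Int.negSucc_lt_zero; grind)

include hE in
lemma isIso_extendZeroRow (X : AdmFun E) : IsIso (extendZeroRow X) := by
  have : ∀ i, IsIso ((extendZeroRow X).app i)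
    | Int.ofNat n => isIso_map_of_hom_of_hom X.obj _ (prHom le_rfl (max_le (by grind) le_rfl))
    | Int.negSucc n => by
      have row_eq : rowPairs.obj (Int.negSucc n) = pr (-1) (-1) le_rfl := by
        have : max (-1) (Int.negSucc n) = -1 := max_eq_left (by grind)
        simp [rowPairs, this]
      have isZero_row : IsZero ((rowPairs ⋙ X.obj).obj (Int.negSucc n)) := by
        rw [Functor.comp_obj, row_eq]
        exact X.property.isZero_diag hE (-1)
      exact (isZero_zero A).isIso isZero_row _
  exact NatIso.isIso_of_isIso_app _

end Row

section EssImage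

variable {A : Type u} [Category.{v} A] [Preadditive A] [HasZeroObject A] {E : SeqClass A}
  (hE : IsExactStructure E) (q : ∀ S : IndSys E, Quotients E S.obj)

lemma isBoundedBelow_indSysToAdmFun (S : IndSys E) :
    ((indSysToAdmFun hE q).obj S).IsBoundedBelow := by
  refine ⟨-1, fun p hp => ?_⟩
  change IsZero ((quotFunctor hE (extendQuotients hE (q S))).obj (pr p.1.1 p.1.2 p.2))
  exact IsZero.of_epi (quotMk hE (extendQuotients hE (q S)) p.2) (isZero_extendZero _ (by lia))

def indSysToAdmFunRowSysIso {X : AdmFun E} (hX : ∀ p : Pairs, p.1.2 ≤ -1 → IsZero (X.obj.obj p)) :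
    (indSysToAdmFun hE q).obj (rowSys X) ≅ X :=
  have := isIso_toRowQuotients hE hX
  have := isIso_extendZeroRow hE X
  let e : quotAdm hE (extendQuotients hE (q (rowSys X))) ≅ quotAdm hE (rowQuotients X) :=
    asIso (quotAdmMap hE _ _ (extendZeroRow X))
  e ≪≫ (asIso (toRowQuotients hE X)).symm

lemma AdmFun.IsBoundedBelow.essImage_indSysToBeilinson {X : AdmFun E} (hX : X.IsBoundedBelow) :
    (indSysToBeilinson hE q).essImage ((toBeilinson E).obj X) := by
  obtain ⟨N, hN⟩ := hX
  let shift : Bicofinal := ⟨fun i => i + (N + 1), fun i j h => by simpa using h,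
    Filter.tendsto_atTop_add_const_right _ _ Filter.tendsto_id,
    Filter.tendsto_atBot_add_const_right _ _ Filter.tendsto_id⟩
  have hY (p : Pairs) (hp : p.1.2 ≤ -1) : IsZero ((X.reindex shift).obj.obj p) :=
    hN _ (show p.1.2 + (N + 1) ≤ N by lia)
  exact ⟨rowSys (X.reindex shift),
    ⟨(toBeilinson E).mapIso (indSysToAdmFunRowSysIso hE q hY) ≪≫ reindexIso E X shift⟩⟩

lemma essImage_indSysToBeilinson_iff (X : AdmFun E) :
    (indSysToBeilinson hE q).essImage ((toBeilinson E).obj X) ↔ X.IsBoundedBelow :=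
  ⟨fun ⟨S, ⟨e⟩⟩ => (isBoundedBelow_indSysToAdmFun hE q S).of_iso hE e.symm,
    fun hX => hX.essImage_indSysToBeilinson hE q⟩

lemma closedUnderExtensions_indSysToBeilinson :
    ClosedUnderExtensions (beilinsonSeq E) (indSysToBeilinson hE q) := by
  rintro X Y Z f g ⟨X', Y', Z', f', g', a, b, c, h, -, -⟩ hX hZ
  obtain ⟨N, hN⟩ := (essImage_indSysToBeilinson_iff hE q X').1 (Functor.essImage.ofIso a hX)
  obtain ⟨M, hM⟩ := (essImage_indSysToBeilinson_iff hE q Z').1 (Functor.essImage.ofIso c hZ)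
  exact Functor.essImage.ofIso b.symm ((essImage_indSysToBeilinson_iff hE q Y').2
    ⟨min N M, fun p hp => hE.isZero_mid (h p) (hN p (hp.trans (min_le_left _ _)))
      (hM p (hp.trans (min_le_right _ _)))⟩)

end EssImage

/-! ### The embeddings into the Beilinson category -/

section FullyExact

variable {B L L' : Type*} [Category* B] [Category* L] [Category* L'] {E : SeqClass L}
  {E' : SeqClass L'} {F : B ⥤ L}

/-- The embeddings of fully exact subcategories: fully faithful functors whose essential image
contains zero and is closed under extensions. The existence of zero is not automatic, since the
class of sequences is arbitrary and the subcategory may be empty. -/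
structure IsFullyExactEmbedding (E : SeqClass L) (F : B ⥤ L) : Prop where
  full : F.Full
  faithful : F.Faithful
  closedUnderExtensions : ClosedUnderExtensions E F
  exists_isZero : ∃ O, IsZero (F.obj O)

namespace IsFullyExactEmbedding

lemma isExactCategory (hF : IsFullyExactEmbedding E F) (hE : IsExactCategory E) :
    IsExactCategory (E.induced F) :=
  have := hF.full
  have := hF.faithful
  isExactCategory_induced hF.closedUnderExtensions hE hF.exists_isZero.choose_spec

lemma op (hF : IsFullyExactEmbedding E F) : IsFullyExactEmbedding E.op F.op where
  full := have := hF.full; inferInstance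
  faithful := have := hF.faithful; inferInstance
  closedUnderExtensions := hF.closedUnderExtensions.op
  exists_isZero := hF.exists_isZero.imp' Opposite.op fun _ hO => hO.op

lemma of_comp (D : L ⥤ L') [D.Full] [D.Faithful]
    (hD : ∀ ⦃X Y Z : L⦄ (f : X ⟶ Y) (g : Y ⟶ Z), E f g → E' (D.map f) (D.map g))
    (hF : IsFullyExactEmbedding E' (F ⋙ D)) : IsFullyExactEmbedding E F := by
  have := hF.full
  have := hF.faithful
  have essImage_iff {X : L} : (F ⋙ D).essImage (D.obj X) ↔ F.essImage X :=
    ⟨fun ⟨Y, ⟨e⟩⟩ => ⟨Y, ⟨D.preimageIso e⟩⟩, fun ⟨Y, ⟨e⟩⟩ => ⟨Y, ⟨D.mapIso e⟩⟩⟩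
  refine ⟨Functor.Full.of_comp_faithful F D, Functor.Faithful.of_comp F D,
    fun X Y Z f g h hX hZ => ?_, ?_⟩
  · exact essImage_iff.1 (hF.closedUnderExtensions _ _ (hD f g h) (essImage_iff.2 hX)
      (essImage_iff.2 hZ))
  · exact hF.exists_isZero.imp fun _ => IsZero.of_full_of_faithful_of_isZero D _

end IsFullyExactEmbedding

end FullyExact

section Embeddings

variable {A : Type u} [Category.{v} A] [Preadditive A] [HasFiniteBiproducts A] {E : SeqClass A}
  (hE : IsExactStructure E)

include hE in
theorem isExactCategory_beilinsonSeq : IsExactCategory (beilinsonSeq E) :=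
  ⟨inferInstance, hasFiniteBiproducts_beilinson hE, isExactStructure_beilinsonSeq hE⟩

theorem exists_indLim_comp_iso (q : ∀ S : IndSys E, Quotients E S.obj) :
    ∃ F : IndAdm E ⥤ Beilinson E, Nonempty (indLim E ⋙ F ≅ indSysToBeilinson hE q) :=
  have := isLocalization_indLim (E := E) fun _ _ _ ⟨_, _, h⟩ => hE.mono h
  have inverts := (indReindexing E).isInvertedBy (indSysToBeilinson hE q) fun φ S =>
    isIso_indSysToBeilinson_toReindex hE q S φ.1 φ.2
  ⟨Localization.lift _ inverts (indLim E), ⟨Localization.fac _ inverts (indLim E)⟩⟩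

theorem isFullyExactEmbedding_of_indLim_comp_iso (q : ∀ S : IndSys E, Quotients E S.obj)
    {F : IndAdm E ⥤ Beilinson E} (e : indLim E ⋙ F ≅ indSysToBeilinson hE q) :
    IsFullyExactEmbedding (beilinsonSeq E) F := by
  have := isLocalization_indLim (E := E) fun _ _ _ ⟨_, _, h⟩ => hE.mono h
  have := Localization.essSurj (indLim E) (indReindexing E).W
  have essImage_eq : F.essImage = (indSysToBeilinson hE q).essImage :=
    Functor.essImage_comp_of_essSurj.symm.trans (Functor.essImage_eq_of_natIso e)
  refine ⟨(indReindexing E).full_of_iso (indLim E) e fun S S' f => ?_,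
    (indReindexing E).faithful_of_iso (indLim E) e fun S S' a b h => ?_, ?_, ?_⟩
  · obtain ⟨φ, h, a, ha⟩ := exists_indSysToBeilinson_map_eq hE q f
    exact ⟨⟨φ, h⟩, a, ha⟩
  · obtain ⟨φ⟩ := (indReindexing E).nonempty
    exact ⟨φ, by rw [indSysToBeilinson_map_injective hE q h]⟩
  · rw [ClosedUnderExtensions, essImage_eq]
    exact closedUnderExtensions_indSysToBeilinson hE q
  · have := hasFiniteBiproducts_admFun hE
    have isBoundedBelow_zero : (0 : AdmFun E).IsBoundedBelow := ⟨0, fun p _ =>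
      ((IsAdmissible E).ι ⋙ (evaluation Pairs A).obj p).map_isZero (isZero_zero _)⟩
    obtain ⟨O, ⟨i⟩⟩ : F.essImage ((toBeilinson E).obj 0) :=
      essImage_eq ▸ isBoundedBelow_zero.essImage_indSysToBeilinson hE q
    exact ⟨O, ((toBeilinson E).map_isZero (isZero_zero _)).of_iso i⟩

variable (q : ∀ S : IndSys E.op, Quotients E.op S.obj)

omit [HasFiniteBiproducts A] in
def proSysToBeilinsonIso [HasZeroObject A] : proSysToBeilinson hE q ≅
    (indSysToBeilinson hE.op q).op ⋙ (beilinsonDuality E).functor :=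
  Functor.isoWhiskerLeft (indSysToAdmFun hE.op q).op (beilinsonDualityIso E).symm

theorem exists_indLim_op_comp_iso :
    ∃ F : ProAdm E ⥤ Beilinson E, Nonempty ((indLim E.op).op ⋙ F ≅ proSysToBeilinson hE q) :=
  have : HasFiniteBiproducts Aᵒᵖ := HasFiniteBiproducts.of_hasFiniteProducts
  let ⟨F, ⟨e⟩⟩ := exists_indLim_comp_iso hE.op q
  let D := (beilinsonDuality E).functor
  let e' : (indLim E.op).op ⋙ F.op ≅ (indSysToBeilinson hE.op q).op := NatIso.op e.symm
  ⟨F.op ⋙ D, ⟨(Functor.associator _ _ _).symm ≪≫ Functor.isoWhiskerRight e' D ≪≫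
    (proSysToBeilinsonIso hE q).symm⟩⟩

theorem isFullyExactEmbedding_of_indLim_op_comp_iso {F : ProAdm E ⥤ Beilinson E}
    (e : (indLim E.op).op ⋙ F ≅ proSysToBeilinson hE q) :
    IsFullyExactEmbedding (beilinsonSeq E) F := by
  have : HasFiniteBiproducts Aᵒᵖ := HasFiniteBiproducts.of_hasFiniteProducts
  let D := beilinsonDuality E
  let F' : IndAdm E.op ⥤ Beilinson E.op := (F ⋙ D.inverse).unop
  let e' : (indLim E.op ⋙ F').op ≅ (indSysToBeilinson hE.op q).op :=
    Functor.isoWhiskerRight (e ≪≫ proSysToBeilinsonIso hE q) D.inverse ≪≫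
      Functor.isoWhiskerLeft (indSysToBeilinson hE.op q).op D.unitIso.symm
  have hF' := isFullyExactEmbedding_of_indLim_comp_iso hE.op q (NatIso.removeOp e').symm
  exact hF'.op.of_comp D.inverse fun _ _ _ _ _ h => beilinsonSeq_inverse hE h

end Embeddings

end TateExact

end

theorem mainTheorem10 {A : Type u} [Category.{v} A] [Preadditive A] [HasFiniteBiproducts A]
    (E : TateExact.SeqClass A) (hE : TateExact.IsExactStructure E) :
    TateExact.IsExactCategory (TateExact.beilinsonSeq E) ∧
    (∀ q : ∀ S : TateExact.IndSys E, TateExact.Quotients E S.obj,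
      (∃ F : TateExact.IndAdm E ⥤ TateExact.Beilinson E,
        Nonempty (TateExact.indLim E ⋙ F ≅ TateExact.indSysToBeilinson hE q)) ∧
      ∀ F : TateExact.IndAdm E ⥤ TateExact.Beilinson E,
        Nonempty (TateExact.indLim E ⋙ F ≅ TateExact.indSysToBeilinson hE q) →
        F.Full ∧ F.Faithful ∧
        TateExact.ClosedUnderExtensions (TateExact.beilinsonSeq E) F ∧
        TateExact.IsExactCategory ((TateExact.beilinsonSeq E).induced F)) ∧
    (∀ q : ∀ S : TateExact.IndSys E.op, TateExact.Quotients E.op S.obj,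
      (∃ F : TateExact.ProAdm E ⥤ TateExact.Beilinson E,
        Nonempty ((TateExact.indLim E.op).op ⋙ F ≅ TateExact.proSysToBeilinson hE q)) ∧
      ∀ F : TateExact.ProAdm E ⥤ TateExact.Beilinson E,
        Nonempty ((TateExact.indLim E.op).op ⋙ F ≅ TateExact.proSysToBeilinson hE q) →
        F.Full ∧ F.Faithful ∧
        TateExact.ClosedUnderExtensions (TateExact.beilinsonSeq E) F ∧
        TateExact.IsExactCategory ((TateExact.beilinsonSeq E).induced F)) := by
  have hB := TateExact.isExactCategory_beilinsonSeq hE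
  refine ⟨hB, fun q => ⟨TateExact.exists_indLim_comp_iso hE q, ?_⟩,
    fun q => ⟨TateExact.exists_indLim_op_comp_iso hE q, ?_⟩⟩
  · rintro F ⟨e⟩
    have hF := TateExact.isFullyExactEmbedding_of_indLim_comp_iso hE q e
    exact ⟨hF.full, hF.faithful, hF.closedUnderExtensions, hF.isExactCategory hB⟩
  · rintro F ⟨e⟩
    have hF := TateExact.isFullyExactEmbedding_of_indLim_op_comp_iso hE q e
    exact ⟨hF.full, hF.faithful, hF.closedUnderExtensions, hF.isExactCategory hB⟩
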